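/- Let $X=SL_2(\mathbb Z)\backslash\mathfrak H$, where $\mathfrak H=\{z=x+iy: y>0\}= SL_2(\mathbb R)/SO(2,\mathbb R)$, with the invariant measure $dx\,dy/y^2$ and the invariant Laplacian $\Delta=y^2\left(\frac{\partial^2}{\partial x^2}+\frac{\partial^2}{\partial y^2}\right)$. Smooth functions on $X$ are the smooth $SL_2(\mathbb Z)$-invariant functions on $\mathfrak H$, and $C_c^\infty(X)$ is the space of complex-valued smooth functions with compact support on $X$. Let $q$ be a smooth real-valued function on $X$ such that $q(x+iy)\gg y^2$ in the cusp: there are $c>0$ and $Y$ with $q(x+iy)\ge c\,y^2$ whenever $y\ge Y$. Let $S=-\Delta+q$ with domain $C_c^\infty(X)$. (1) $S$ is a densely defined, symmetric operator on $L^2(X)$ which is bounded below, and its Friedrichs extension $\tilde S$ is self-adjoint and has Hilbert-Schmidt resolvent: the resolvent set of $\tilde S$ is non-empty, and $(\tilde S-\lambda)^{-1}$ is a Hilbert-Schmidt operator on $L^2(X)$ for every $\lambda$ in it. (2) If $q\ge 0$, then $S$ has a positive lower bound: there is $\delta>0$ with $\langle Sf,f\rangle\ge\delta\,\langle f,f\rangle$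 for all $f\in C_c^\infty(X)$. (3) Whenever $S$ has a positive lower bound (in particular if $q\ge0$), $\langle S^nf,g\rangle_{L^2}$ is an inner product on $C_c^\infty(X)$ for every integer $n\ge0$. Let $V^n$ be the Hilbert space completion of $C_c^\infty(X)$ for the norm $|f|_{V^n}^2=\langle S^nf,f\rangle_{L^2}$. For every $n\ge2$ the identity map of $C_c^\infty(X)$ extends to a continuous linear transition map $V^n\to V^{n-2}$, and this map is Hilbert-Schmidt. -/

import Mathlib

open MeasureTheory Filter Topology UpperHalfPlane
open scoped MatrixGroups Modular ContDiff Laplacian InnerProductSpace ComplexConjugate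

noncomputable section

namespace AutomorphicHamiltonian

/-! ### Operators on Hilbert spaces -/

section Operators

universe u v

variable {E : Type u} [NormedAddCommGroup E] [InnerProductSpace ℂ E]

/-- A bounded operator between Hilbert spaces is Hilbert-Schmidt if `∑ ‖T eᵢ‖² < ∞` for the
orthonormal bases `(eᵢ)` of its source. -/
def IsHilbertSchmidt {F : Type v} [NormedAddCommGroup F] [InnerProductSpace ℂ F]
    (T : E →L[ℂ] F) : Prop :=
  ∀ (ι : Type u) (b : HilbertBasis ι ℂ E), Summable fun i => ‖T (b i)‖ ^ 2

/-- `T` is bounded below: `⟨T x, x⟩ ≥ c ‖x‖²` on the domain of `T`, for some real `c`. -/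
def IsSemibounded (T : E →ₗ.[ℂ] E) : Prop :=
  ∃ c : ℝ, ∀ x : T.domain, c * ‖(x : E)‖ ^ 2 ≤ (⟪T x, (x : E)⟫_ℂ).re

/-- `T` is bounded below by a positive constant. -/
def HasPositiveLowerBound (T : E →ₗ.[ℂ] E) : Prop :=
  ∃ c : ℝ, 0 < c ∧ ∀ x : T.domain, c * ‖(x : E)‖ ^ 2 ≤ (⟪T x, (x : E)⟫_ℂ).re

/-- `u` is a limit in `E` of vectors `vₙ` in the domain of `T` which form a Cauchy sequence for
the quadratic form `⟨T v, v⟩`. For a `T` which is bounded below, this says that `u` belongs to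
(the image in `E` of) the completion of the domain for the norm `⟨T v, v⟩ + C ‖v‖²`, `C` large. -/
def IsFormLimit (T : E →ₗ.[ℂ] E) (u : E) : Prop :=
  ∃ v : ℕ → T.domain, Tendsto (fun n => (v n : E)) atTop (𝓝 u) ∧
    Tendsto (fun p : ℕ × ℕ => (⟪T (v p.1 - v p.2), ((v p.1 - v p.2 : T.domain) : E)⟫_ℂ).re)
      atTop (𝓝 0)

theorem IsFormLimit.add {T : E →ₗ.[ℂ] E} (hT : IsSemibounded T) {u w : E}
    (hu : IsFormLimit T u) (hw : IsFormLimit T w) : IsFormLimit T (u + w) := by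
  obtain ⟨c, hc⟩ := hT
  obtain ⟨a, ha, ha2⟩ := hu
  obtain ⟨b, hb, hb2⟩ := hw
  refine ⟨fun n => a n + b n, by simpa using ha.add hb, ?_⟩
  have hdiff : ∀ {s : ℕ → T.domain} {x : E}, Tendsto (fun n => (s n : E)) atTop (𝓝 x) →
      Tendsto (fun p : ℕ × ℕ => ‖((s p.1 - s p.2 : T.domain) : E)‖ ^ 2) atTop (𝓝 0) := by
    intro s x hs
    rw [← prod_atTop_atTop_eq]
    have := ((hs.comp tendsto_fst).sub (hs.comp tendsto_snd) :
      Tendsto _ ((atTop : Filter ℕ) ×ˢ (atTop : Filter ℕ)) _)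
    simpa [Function.comp_def] using (this.norm.pow 2)
  have hA := hdiff ha
  have hB := hdiff hb
  have hAB := hdiff (s := fun n => a n + b n) (by simpa using ha.add hb)
  have hlow := hAB.const_mul c
  have hup := (((ha2.const_mul 2).add (hb2.const_mul 2)).sub
    (((hA.const_mul (2 * c)).add (hB.const_mul (2 * c))))).add hlow
  simp only [mul_zero, add_zero, sub_zero] at hlow hup
  refine tendsto_of_tendsto_of_tendsto_of_le_of_le hlow hup (fun p => hc _) (fun p => ?_)
  set x := a p.1 - a p.2 with hx
  set y := b p.1 - b p.2 with hy
  have hxy : a p.1 + b p.1 - (a p.2 + b p.2) = x + y := by rw [hx, hy]; abel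
  have h1 := hc (x - y)
  have h2 : ‖((x + y : T.domain) : E)‖ ^ 2 + ‖((x - y : T.domain) : E)‖ ^ 2
      = 2 * (‖(x : E)‖ ^ 2 + ‖(y : E)‖ ^ 2) := by
    have := parallelogram_law_with_norm ℂ (x : E) (y : E)
    simp only [Submodule.coe_add, Submodule.coe_sub]
    nlinarith [this]
  have h3 : (⟪T (x + y), ((x + y : T.domain) : E)⟫_ℂ).re
      + (⟪T (x - y), ((x - y : T.domain) : E)⟫_ℂ).re
      = 2 * (⟪T x, (x : E)⟫_ℂ).re + 2 * (⟪T y, (y : E)⟫_ℂ).re := by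
    rw [LinearPMap.map_add T x y, LinearPMap.map_sub T x y]
    simp only [Submodule.coe_add, Submodule.coe_sub, inner_add_left, inner_add_right,
      inner_sub_left, inner_sub_right, Complex.add_re, Complex.sub_re]
    ring
  simp only [hxy]
  have h4 : c * ‖((x - y : T.domain) : E)‖ ^ 2
      = c * (2 * (‖(x : E)‖ ^ 2 + ‖(y : E)‖ ^ 2)) - c * ‖((x + y : T.domain) : E)‖ ^ 2 := by
    rw [← h2]; ring
  linarith

theorem IsFormLimit.smul {T : E →ₗ.[ℂ] E} {u : E} (k : ℂ) (hu : IsFormLimit T u) :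
    IsFormLimit T (k • u) := by
  obtain ⟨a, ha, ha2⟩ := hu
  refine ⟨fun n => k • a n, by simpa using ha.const_smul k, ?_⟩
  have h := ha2.const_mul (‖k‖ ^ 2)
  rw [mul_zero] at h
  refine h.congr fun p => ?_
  rw [← smul_sub, LinearPMap.map_smul, Submodule.coe_smul, inner_smul_left, inner_smul_right,
    ← mul_assoc, ← Complex.normSq_eq_conj_mul_self, Complex.normSq_eq_norm_sq,
    Complex.re_ofReal_mul]

/-- The form domain of an operator which is bounded below. -/
def formDomain (T : E →ₗ.[ℂ] E) (hT : IsSemibounded T) : Submodule ℂ E where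
  carrier := {u | IsFormLimit T u}
  add_mem' := fun hu hw => IsFormLimit.add hT hu hw
  zero_mem' := ⟨fun _ => 0, by simp, by simp⟩
  smul_mem' := fun k _ hu => IsFormLimit.smul k hu

/-- The Friedrichs extension of a (densely defined, symmetric) operator which is bounded below:
the restriction of the adjoint `T†` to the vectors of its domain which lie in the form domain. -/
def friedrichs [CompleteSpace E] (T : E →ₗ.[ℂ] E) (hT : IsSemibounded T) : E →ₗ.[ℂ] E :=
  T.adjoint.domRestrict (formDomain T hT)

/-- The bounded operator `R` is the resolvent `(A - z)⁻¹` of the unbounded operator `A`. -/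
def IsResolvent (A : E →ₗ.[ℂ] E) (z : ℂ) (R : E →L[ℂ] E) : Prop :=
  (∀ x : A.domain, R (A x - z • (x : E)) = x) ∧
    ∀ y : E, ∃ h : R y ∈ A.domain, A ⟨R y, h⟩ - z • R y = y

/-- The resolvent set of `A` is non-empty, and `(A - z)⁻¹` is a Hilbert-Schmidt operator for every
point `z` of the resolvent set. -/
def HasHilbertSchmidtResolvent (A : E →ₗ.[ℂ] E) : Prop :=
  (∃ z R, IsResolvent A z R) ∧ ∀ z R, IsResolvent A z R → IsHilbertSchmidt R

end Operators

/-! ### Functions on the modular curve -/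

/-- The quotient `SL₂(ℤ) \ ℍ`, where `ℍ = SL₂(ℝ) / SO(2)`. -/
abbrev ModularCurve : Type := MulAction.orbitRel.Quotient SL(2, ℤ) ℍ

/-- The projection of the upper half-plane to the modular curve. -/
def proj (z : ℍ) : ModularCurve := Quotient.mk _ z

theorem proj_smul (γ : SL(2, ℤ)) (z : ℍ) : proj (γ • z) = proj z :=
  Quotient.sound (MulAction.orbitRel_apply.mpr ⟨γ, rfl⟩)

theorem exists_smul_of_proj_eq {z w : ℍ} (h : proj z = proj w) : ∃ γ : SL(2, ℤ), γ • w = z :=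
  MulAction.orbitRel_apply.mp (Quotient.exact h)

/-- The invariant measure on the modular curve: the image of `dx dy / y²` on the standard
fundamental domain `{|x| ≤ 1/2, |z| ≥ 1}`. -/
def modularMeasure : Measure ModularCurve := ((volume : Measure ℍ).restrict 𝒟).map proj

/-- The Hilbert space `L²(SL₂(ℤ) \ ℍ, dx dy / y²)`. -/
abbrev L2 : Type := Lp ℂ 2 modularMeasure

/-- A function on the modular curve, as an `SL₂(ℤ)`-invariant function of `x + iy` on `y > 0`
(extended in an irrelevant way to `y ≤ 0`). -/
def lift {F : Type} (f : ModularCurve → F) : ℂ → F := fun w => f (proj (ofComplex w))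

/-- Smooth functions on the modular curve: their lifts to the upper half-plane are smooth. -/
def IsSmooth {F : Type} [NormedAddCommGroup F] [NormedSpace ℝ F] (f : ModularCurve → F) : Prop :=
  ContDiffOn ℝ ∞ (lift f) {w : ℂ | 0 < w.im}

theorem lift_coe {F : Type} (f : ModularCurve → F) (z : ℍ) : lift f z = f (proj z) := by
  simp [lift]

/-- The space of test functions `C_c^∞(SL₂(ℤ) \ ℍ)`. -/
def TestFn : Submodule ℂ (ModularCurve → ℂ) where
  carrier := {f | IsSmooth f ∧ HasCompactSupport f}
  add_mem' := fun hf hg => ⟨ContDiffOn.add hf.1 hg.1, hf.2.add hg.2⟩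
  zero_mem' := ⟨contDiffOn_const, HasCompactSupport.zero⟩
  smul_mem' := fun k f hf => ⟨ContDiffOn.const_smul k hf.1, hf.2.mono fun p hp => by
    intro h0
    exact hp (by simp [h0])⟩

/-! ### The invariant Laplacian -/

/-- The invariant Laplacian `y² (∂²/∂x² + ∂²/∂y²)` on the modular curve, computed at any
representative of an orbit: see `hypLaplacian_proj`. -/
def hypLaplacian (f : ModularCurve → ℂ) : ModularCurve → ℂ := fun p =>
  ((Quotient.out p : ℍ).im : ℂ) ^ 2 * (Δ (lift f)) (Quotient.out p : ℍ)

theorem laplacian_comp_holomorphic {F : ℂ → ℂ} {φ : ℂ → ℂ} {z : ℂ}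
    (hφ : AnalyticAt ℂ φ z) (hF : ContDiffAt ℝ 2 F (φ z)) :
    (Δ (F ∘ φ)) z = ((‖deriv φ z‖ ^ 2 : ℝ) : ℂ) * (Δ F) (φ z) := by
  have key : ∀ v : ℂ, iteratedFDeriv ℝ 2 (F ∘ φ) z ![v, v] =
      fderiv ℝ (fderiv ℝ F) (φ z) (deriv φ z * v) (deriv φ z * v)
        + fderiv ℝ F (φ z) (deriv (deriv φ) z * v * v) := by
    intro v
    have hφ' : ∀ᶠ w in 𝓝 z, HasFDerivAt φ
        ((ContinuousLinearMap.toSpanSingleton ℂ (deriv φ w)).restrictScalars ℝ) w := by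
      filter_upwards [hφ.eventually_analyticAt] with w hw
      exact hw.differentiableAt.hasDerivAt.hasFDerivAt.restrictScalars ℝ
    have hF' : ∀ᶠ w in 𝓝 z, DifferentiableAt ℝ F (φ w) := by
      have h2 : ∀ᶠ y in 𝓝 (φ z), DifferentiableAt ℝ F y := by
        filter_upwards [hF.eventually (by simp)] with y hy
        exact hy.differentiableAt (by simp)
      exact hφ.continuousAt.eventually h2
    have h1 : (fun w => fderiv ℝ (F ∘ φ) w v) =ᶠ[𝓝 z]
        fun w => fderiv ℝ F (φ w) (deriv φ w * v) := by
      filter_upwards [hφ', hF'] with w hw1 hw2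
      rw [(hw2.hasFDerivAt.comp w hw1).fderiv]
      simp [mul_comm]
    have hdF : DifferentiableAt ℝ (fderiv ℝ F) (φ z) :=
      (hF.fderiv_right (m := 1) (by norm_num)).differentiableAt (by simp)
    have hd2 : HasFDerivAt (fun w => deriv φ w * v)
        ((ContinuousLinearMap.toSpanSingleton ℂ (deriv (deriv φ) z * v)).restrictScalars ℝ) z :=
      ((hφ.deriv.differentiableAt.hasDerivAt.mul_const v).hasFDerivAt).restrictScalars ℝ
    have h3 : HasFDerivAt (fun w => fderiv ℝ F (φ w)) _ z :=
      hdF.hasFDerivAt.comp z hφ'.self_of_nhds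
    have h4 := h3.clm_apply hd2
    have hdd : DifferentiableAt ℝ (fderiv ℝ (F ∘ φ)) z := by
      have : ContDiffAt ℝ 2 (F ∘ φ) z :=
        hF.comp z ((hφ.contDiffAt (n := 2)).restrict_scalars ℝ)
      exact (this.fderiv_right (m := 1) (by norm_num)).differentiableAt (by simp)
    rw [iteratedFDeriv_two_apply]
    simp only [Matrix.cons_val_zero, Matrix.cons_val_one]
    have h5 : fderiv ℝ (fun w => fderiv ℝ (F ∘ φ) w v) z v
        = fderiv ℝ (fderiv ℝ (F ∘ φ)) z v v := by
      rw [(hdd.hasFDerivAt.clm_apply (hasFDerivAt_const v z)).fderiv]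
      simp
    rw [← h5, h1.fderiv_eq, h4.fderiv]
    simp [mul_comm]
    ring
  have hb : ∀ (B : ℂ →L[ℝ] ℂ →L[ℝ] ℂ) (a : ℂ), B (a * 1) (a * 1) + B (a * Complex.I) (a * Complex.I)
      = ((‖a‖ ^ 2 : ℝ) : ℂ) * (B 1 1 + B Complex.I Complex.I) := by
    intro B a
    have e1 : a * 1 = a.re • (1 : ℂ) + a.im • Complex.I := by
      apply Complex.ext <;> simp
    have e2 : a * Complex.I = (-a.im) • (1 : ℂ) + a.re • Complex.I := by
      apply Complex.ext <;> simp
    rw [e1, e2, ← Complex.normSq_eq_norm_sq, Complex.normSq_apply]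
    simp only [map_add, map_smul, add_apply, smul_apply]
    simp only [Complex.real_smul]
    push_cast
    ring
  rw [InnerProductSpace.laplacian_eq_iteratedFDeriv_complexPlane,
    InnerProductSpace.laplacian_eq_iteratedFDeriv_complexPlane]
  simp only [key]
  have h7 := hb (fderiv ℝ (fderiv ℝ F) (φ z)) (deriv φ z)
  simp only [iteratedFDeriv_two_apply, Matrix.cons_val_zero, Matrix.cons_val_one]
  rw [← h7]
  have h8 : deriv (deriv φ) z * Complex.I * Complex.I = - (deriv (deriv φ) z * 1 * 1) := by
    rw [mul_assoc, Complex.I_mul_I]; ring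
  rw [h8, map_neg]
  ring


theorem IsSmooth.contDiffAt {F : Type} [NormedAddCommGroup F] [NormedSpace ℝ F]
    {f : ModularCurve → F} (hf : IsSmooth f) (z : ℍ) : ContDiffAt ℝ ∞ (lift f) z :=
  ContDiffOn.contDiffAt hf (isOpen_upperHalfPlaneSet.mem_nhds z.im_pos)

theorem two_le_infty : (2 : WithTop ℕ∞) ≤ ∞ := 
  WithTop.coe_le_coe.mpr (le_top : (2 : ℕ∞) ≤ ⊤)

theorem hypLaplacian_proj {f : ModularCurve → ℂ} (hf : IsSmooth f) (z : ℍ) :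
    hypLaplacian f (proj z) = (z.im : ℂ) ^ 2 * (Δ (lift f)) z := by
  obtain ⟨γ, hγ⟩ : ∃ γ : SL(2, ℤ), γ • z = (Quotient.out (proj z) : ℍ) :=
    exists_smul_of_proj_eq (Quotient.out_eq (proj z))
  unfold hypLaplacian
  rw [← hγ]
  have hdet1 : (γ : GL (Fin 2) ℝ).val.det = 1 :=
    (Matrix.SpecialLinearGroup.map (Int.castRingHom ℝ) γ).2
  have hdet : (0 : ℝ) < (γ : GL (Fin 2) ℝ).val.det := by rw [hdet1]; exact one_pos
  set φ : ℂ → ℂ := fun w => ((γ : GL (Fin 2) ℝ) • ofComplex w : ℍ) with hφ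
  have hφz : φ z = (γ • z : ℍ) := by simp [hφ]
  have hcomp : lift f ∘ φ = lift f := by
    funext w
    simp only [Function.comp, hφ, lift, ofComplex_apply]
    exact congrArg f (proj_smul γ (ofComplex w))
  have h1 := laplacian_comp_holomorphic (F := lift f) (analyticAt_smul hdet z)
    (by
      have := (hf.contDiffAt (γ • z)).of_le two_le_infty
      rw [← hφz] at this
      exact this)
  change (Δ (lift f ∘ φ)) z = ((‖deriv φ z‖ ^ 2 : ℝ) : ℂ) * (Δ (lift f)) (φ z) at h1
  rw [hcomp, hφz, deriv_smul hdet z, hdet1] at h1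
  rw [h1, ← mul_assoc]
  congr 1
  rw [ModularGroup.im_smul_eq_div_normSq, Complex.normSq_eq_norm_sq]
  have hd : ‖denom (γ : GL (Fin 2) ℝ) z‖ ≠ 0 := norm_ne_zero_iff.mpr (denom_ne_zero _ _)
  norm_cast
  simp
  field_simp

theorem isSmooth_hypLaplacian {f : ModularCurve → ℂ} (hf : IsSmooth f) :
    IsSmooth (hypLaplacian f) := by
  have h : ContDiffOn ℝ ∞ (fun w : ℂ => ((w.im : ℝ) : ℂ) ^ 2 * (Δ (lift f)) w)
      {w : ℂ | 0 < w.im} := by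
    refine ContDiffOn.mul ?_ ?_
    · have : ContDiff ℝ ∞ fun w : ℂ => ((w.im : ℝ) : ℂ) ^ 2 :=
        (Complex.ofRealCLM.contDiff.comp Complex.imCLM.contDiff).pow 2
      exact this.contDiffOn
    · rw [InnerProductSpace.laplacian_eq_iteratedFDeriv_complexPlane]
      have h2 : ContDiffOn ℝ ∞ (iteratedFDeriv ℝ 2 (lift f)) {w : ℂ | 0 < w.im} := by
        intro w hw
        exact ((hf.contDiffAt ⟨w, hw⟩).iteratedFDeriv_right (m := ∞) (i := 2)
          (WithTop.coe_le_coe.mpr (le_top : (⊤ + 2 : ℕ∞) ≤ ⊤))).contDiffWithinAt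
      exact ContDiffOn.add
        ((ContinuousMultilinearMap.apply ℝ (fun _ : Fin 2 => ℂ) ℂ ![1, 1]).contDiff.comp_contDiffOn
          h2)
        ((ContinuousMultilinearMap.apply ℝ (fun _ : Fin 2 => ℂ) ℂ
          ![Complex.I, Complex.I]).contDiff.comp_contDiffOn h2)
  refine h.congr fun w hw => ?_
  have := hypLaplacian_proj hf ⟨w, hw⟩
  rw [← lift_coe (hypLaplacian f)] at this
  exact this

theorem hypLaplacian_add {f g : ModularCurve → ℂ} (hf : IsSmooth f) (hg : IsSmooth g) :
    hypLaplacian (f + g) = hypLaplacian f + hypLaplacian g := by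
  funext p
  have h := ((hf.contDiffAt (Quotient.out p)).of_le two_le_infty).laplacian_add
    ((hg.contDiffAt (Quotient.out p)).of_le two_le_infty)
  change (Δ (lift (f + g))) _ = _ at h
  simp only [hypLaplacian, Pi.add_apply]
  rw [h]
  ring

theorem hypLaplacian_smul {f : ModularCurve → ℂ} (hf : IsSmooth f) (k : ℂ) :
    hypLaplacian (k • f) = k • hypLaplacian f := by
  funext p
  have h := InnerProductSpace.laplacian_smul k
    ((hf.contDiffAt (Quotient.out p)).of_le two_le_infty)
  change (Δ (lift (k • f))) _ = _ at h
  simp only [hypLaplacian, Pi.smul_apply]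
  rw [h]
  simp only [smul_eq_mul]
  ring

theorem continuous_proj : Continuous proj := continuous_quotient_mk'

theorem IsSmooth.continuous {F : Type} [NormedAddCommGroup F] [NormedSpace ℝ F]
    {f : ModularCurve → F} (hf : IsSmooth f) : Continuous f := by
  have hq : IsQuotientMap proj := isQuotientMap_quotient_mk'
  rw [hq.continuous_iff]
  have h : Continuous fun z : ℍ => lift f z :=
    ContDiffOn.continuousOn hf |>.comp_continuous continuous_coe fun z => z.im_pos
  exact h.congr fun z => lift_coe f z

theorem tsupport_hypLaplacian (f : ModularCurve → ℂ) :
    tsupport (hypLaplacian f) ⊆ tsupport f := by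
  refine closure_minimal (fun p hp => ?_) (isClosed_tsupport f)
  by_contra hn
  refine hp ?_
  have h0 : f =ᶠ[𝓝 p] 0 := notMem_tsupport_iff_eventuallyEq.mp hn
  set z : ℍ := Quotient.out p with hz
  have hzp : proj z = p := Quotient.out_eq p
  have h1 : lift f =ᶠ[𝓝 (z : ℂ)] fun _ => 0 := by
    have hc : ContinuousAt (fun w : ℂ => proj (ofComplex w)) (z : ℂ) :=
      continuous_proj.continuousAt.comp
        (contMDiffAt_ofComplex (n := 0) z.im_pos).continuousAt
    have : Tendsto (fun w : ℂ => proj (ofComplex w)) (𝓝 (z : ℂ)) (𝓝 p) := by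
      have h := hc.tendsto
      simpa [hzp] using h
    exact this.eventually h0
  have h2 := InnerProductSpace.laplacian_congr_nhds h1
  have h3 := h2.self_of_nhds
  simp only [hypLaplacian]
  rw [← hz, h3]
  simp

/-! ### The Hamiltonian -/

/-- The Hamiltonian `S = -Δ + q` on test functions, for a smooth real potential `q`. -/
def hamiltonian (q : ModularCurve → ℝ) (hq : IsSmooth q) : TestFn →ₗ[ℂ] TestFn where
  toFun f := ⟨fun p => -hypLaplacian f p + (q p : ℂ) * (f : ModularCurve → ℂ) p, by
    refine ⟨?_, ?_⟩
    · refine ContDiffOn.add (ContDiffOn.neg (isSmooth_hypLaplacian f.2.1)) (ContDiffOn.mul ?_ f.2.1)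
      exact Complex.ofRealCLM.contDiff.comp_contDiffOn hq
    · refine HasCompactSupport.add (f := fun p => -hypLaplacian f p)
        (HasCompactSupport.neg ?_) (HasCompactSupport.mul_left f.2.2)
      exact f.2.2.of_isClosed_subset (isClosed_tsupport _) (tsupport_hypLaplacian _)⟩
  map_add' f g := by
    ext p
    simp only [Submodule.coe_add, hypLaplacian_add f.2.1 g.2.1, Pi.add_apply]
    ring
  map_smul' k f := by
    ext p
    simp only [Submodule.coe_smul, hypLaplacian_smul f.2.1 k, Pi.smul_apply, smul_eq_mul,
      RingHom.id_apply]
    ring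

theorem volume_fd_lt_top : volume (𝒟 : Set ℍ) < ⊤ := by
  rw [volume_eq_lintegral]
  have hsub : UpperHalfPlane.coe '' 𝒟 ⊆
      Complex.measurableEquivRealProd ⁻¹' (Set.Icc (-1 / 2 : ℝ) (1 / 2) ×ˢ Set.Ioi (1 / 2 : ℝ)) := by
    rintro _ ⟨z, hz, rfl⟩
    have h1 := ModularGroup.three_le_four_mul_im_sq_of_mem_fd hz
    have h2 := abs_le.mp hz.2
    have h3 := z.im_pos
    refine ⟨⟨?_, ?_⟩, ?_⟩
    · simpa [neg_div] using h2.1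
    · simpa using h2.2
    · change (1 / 2 : ℝ) < z.im
      nlinarith
  refine (lintegral_mono_set hsub).trans_lt ?_
  have h := (Complex.volume_preserving_equiv_real_prod).setLIntegral_comp_preimage_emb
    Complex.measurableEquivRealProd.measurableEmbedding
    (fun p : ℝ × ℝ => (((1 / ‖p.2‖₊) ^ 2 : NNReal) : ENNReal))
    (Set.Icc (-1 / 2 : ℝ) (1 / 2) ×ˢ Set.Ioi (1 / 2 : ℝ))
  refine h.trans_lt ?_
  rw [Measure.volume_eq_prod, ← Measure.prod_restrict, lintegral_prod _ (by fun_prop)]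
  simp only [lintegral_const]
  refine ENNReal.mul_lt_top ?_ (by simp)
  have hint : IntegrableOn (fun t : ℝ => t ^ (-2 : ℝ)) (Set.Ioi (1 / 2 : ℝ)) :=
    integrableOn_Ioi_rpow_of_lt (by norm_num) (by norm_num)
  have h5 := hint.2
  rw [hasFiniteIntegral_iff_enorm] at h5
  refine lt_of_le_of_lt (setLIntegral_mono' measurableSet_Ioi fun t ht => ?_) h5
  have ht0 : (0 : ℝ) < t := lt_trans (by norm_num) ht
  rw [Real.rpow_neg ht0.le, enorm_eq_nnnorm, ENNReal.coe_le_coe, ← NNReal.coe_le_coe]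
  simp

theorem measurable_proj : Measurable proj := measurable_quotient_mk''

instance : IsFiniteMeasure modularMeasure where
  measure_univ_lt_top := by
    unfold modularMeasure
    rw [Measure.map_apply measurable_proj MeasurableSet.univ]
    simpa using volume_fd_lt_top

theorem TestFn.memLp (f : TestFn) : MemLp (f : ModularCurve → ℂ) 2 modularMeasure := by
  have hc : Continuous (f : ModularCurve → ℂ) := IsSmooth.continuous f.2.1
  have hm : Measurable (f : ModularCurve → ℂ) :=
    measurable_from_quotient.mpr (hc.comp continuous_proj).measurable
  obtain ⟨C, hC⟩ := hc.bounded_above_of_compact_support f.2.2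
  exact MemLp.of_bound hm.aestronglyMeasurable C (ae_of_all _ hC)

/-- The inclusion of test functions in `L²`. -/
def toL2 : TestFn →ₗ[ℂ] L2 where
  toFun f := (TestFn.memLp f).toLp _
  map_add' f g := MemLp.toLp_add (TestFn.memLp f) (TestFn.memLp g)
  map_smul' k f := MemLp.toLp_const_smul k (TestFn.memLp f)

theorem isOpenPos : (volume : Measure ℍ).IsOpenPosMeasure := by
  have h1 : ((volume : Measure ℂ).comap UpperHalfPlane.coe).IsOpenPosMeasure :=
    Measure.IsOpenPosMeasure.comap _ isOpenEmbedding_coe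
  rw [UpperHalfPlane.volume_def]
  refine Measure.AbsolutelyContinuous.isOpenPosMeasure
    (withDensity_absolutelyContinuous' ?_ (ae_of_all _ fun z => ?_))
  · refine Measurable.aemeasurable (measurable_coe_nnreal_ennreal.comp ?_)
    have h3 : Measurable fun z : ℍ => NNReal.mk z.im z.im_pos.le :=
      continuous_im.measurable.subtype_mk
    have h4 : Measurable fun z : ℍ => (1 / NNReal.mk z.im z.im_pos.le : NNReal) :=
      measurable_const.div h3
    exact h4.pow_const 2
  · have h2 : (NNReal.mk z.im z.im_pos.le) ≠ 0 :=
      fun h => z.im_pos.ne' (congrArg NNReal.toReal h)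
    exact ENNReal.coe_ne_zero.mpr (pow_ne_zero 2 (div_ne_zero one_ne_zero h2))

theorem toL2_injective : Function.Injective toL2 := by
  rw [← LinearMap.ker_eq_bot, LinearMap.ker_eq_bot']
  intro f hf
  have hc : Continuous fun z => (f : ModularCurve → ℂ) (proj z) :=
    (IsSmooth.continuous f.2.1).comp continuous_proj
  have h1 : (f : ModularCurve → ℂ) =ᵐ[modularMeasure] 0 :=
    (MemLp.toLp_eq_toLp_iff (TestFn.memLp f) (MemLp.zero)).mp hf
  have h2 : ∀ᵐ z ∂((volume : Measure ℍ).restrict 𝒟), (f : ModularCurve → ℂ) (proj z) = 0 :=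
    ae_of_ae_map measurable_proj.aemeasurable h1
  have h3 : ∀ᵐ z ∂((volume : Measure ℍ).restrict 𝒟ᵒ), (f : ModularCurve → ℂ) (proj z) = 0 :=
    ae_restrict_of_ae_restrict_of_subset ModularGroup.fdo_subset_fd h2
  have := isOpenPos
  have h4 : Set.EqOn (fun z => (f : ModularCurve → ℂ) (proj z)) (fun _ => 0) 𝒟ᵒ :=
    Measure.eqOn_open_of_ae_eq h3 ModularGroup.isOpen_fdo hc.continuousOn continuousOn_const
  have h5 : Set.EqOn (fun z => (f : ModularCurve → ℂ) (proj z)) (fun _ => 0) 𝒟 := by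
    rw [ModularGroup.fd_eq_closure_fdo]
    exact h4.closure hc continuous_const
  ext p
  obtain ⟨z, rfl⟩ : ∃ z, proj z = p := Quotient.exists_rep p
  obtain ⟨γ, hγ⟩ := ModularGroup.exists_smul_mem_fd z
  have h6 := h5 hγ
  simp only [proj_smul] at h6
  exact h6

/-- `S = -Δ + q` as an unbounded operator on `L²`, with domain the space of test functions. -/
def hamiltonianL2 (q : ModularCurve → ℝ) (hq : IsSmooth q) : L2 →ₗ.[ℂ] L2 where
  domain := LinearMap.range toL2
  toFun := toL2 ∘ₗ hamiltonian q hq ∘ₗ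
    (LinearEquiv.ofInjective toL2 toL2_injective).symm.toLinearMap

theorem hamiltonianL2_apply (q : ModularCurve → ℝ) (hq : IsSmooth q) (f : TestFn) :
    hamiltonianL2 q hq ⟨toL2 f, ⟨f, rfl⟩⟩ = toL2 (hamiltonian q hq f) := by
  have h : (LinearEquiv.ofInjective toL2 toL2_injective).symm ⟨toL2 f, ⟨f, rfl⟩⟩ = f :=
    (LinearEquiv.symm_apply_eq _).mpr rfl
  exact congrArg (fun g => toL2 (hamiltonian q hq g)) h

/-- `q(x + iy) ≫ y²` in the cusp. -/
def GrowsInCusp (q : ModularCurve → ℝ) : Prop :=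
  ∃ c : ℝ, 0 < c ∧ ∃ Y : ℝ, ∀ z : ℍ, Y ≤ z.im → c * z.im ^ 2 ≤ q (proj z)

/-! ### The spaces `Vⁿ` -/

/-- The sesquilinear form `⟨Sⁿ g, f⟩` on test functions (in Mathlib the inner product of `L²` is
conjugate-linear in its first argument). -/
def sobolevForm (q : ModularCurve → ℝ) (hq : IsSmooth q) (n : ℕ) (f g : TestFn) : ℂ :=
  ⟪toL2 f, toL2 ((hamiltonian q hq ^ n) g)⟫_ℂ

/-- The form `⟨Sⁿ g, f⟩` is Hermitian and positive definite, that is, an inner product. -/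
structure IsInnerForm (q : ModularCurve → ℝ) (hq : IsSmooth q) (n : ℕ) : Prop where
  hermitian : ∀ f g, conj (sobolevForm q hq n g f) = sobolevForm q hq n f g
  pos : ∀ f, f ≠ 0 → 0 < (sobolevForm q hq n f f).re

theorem sobolevForm_add_left (q : ModularCurve → ℝ) (hq : IsSmooth q) (n : ℕ) (f g k : TestFn) :
    sobolevForm q hq n (f + g) k = sobolevForm q hq n f k + sobolevForm q hq n g k := by
  simp only [sobolevForm, map_add, inner_add_left]

theorem sobolevForm_smul_left (q : ModularCurve → ℝ) (hq : IsSmooth q) (n : ℕ) (f g : TestFn)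
    (k : ℂ) : sobolevForm q hq n (k • f) g = conj k * sobolevForm q hq n f g := by
  simp only [sobolevForm, map_smul, inner_smul_left]

theorem sobolevForm_self_nonneg (q : ModularCurve → ℝ) (hq : IsSmooth q) (n : ℕ)
    (h : IsInnerForm q hq n) (f : TestFn) : 0 ≤ (sobolevForm q hq n f f).re := by
  by_cases hf : f = 0
  · subst hf
    simp [sobolevForm]
  · exact (h.pos f hf).le

/-- The space of test functions with the norm `|f|² = ⟨Sⁿ f, f⟩`. -/
def PreSobolev (q : ModularCurve → ℝ) (hq : IsSmooth q) (n : ℕ) (_ : IsInnerForm q hq n) : Type :=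
  TestFn

variable (q : ModularCurve → ℝ) (hq : IsSmooth q) (n : ℕ) (h : IsInnerForm q hq n)

instance : AddCommGroup (PreSobolev q hq n h) := inferInstanceAs (AddCommGroup TestFn)

instance : Module ℂ (PreSobolev q hq n h) := inferInstanceAs (Module ℂ TestFn)

/-- The inner product `⟨Sⁿ g, f⟩`. -/
abbrev sobolevCore : InnerProductSpace.Core ℂ (PreSobolev q hq n h) where
  inner f g := sobolevForm q hq n f g
  conj_inner_symm f g := h.hermitian f g
  re_inner_nonneg f := sobolevForm_self_nonneg q hq n h f
  add_left f g k := sobolevForm_add_left q hq n f g k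
  smul_left f g k := sobolevForm_smul_left q hq n f g k
  definite f hf := by
    by_contra hne
    have h1 := h.pos f hne
    rw [show sobolevForm q hq n f f = 0 from hf] at h1
    simp at h1

instance : NormedAddCommGroup (PreSobolev q hq n h) :=
  (sobolevCore q hq n h).toNormedAddCommGroup

instance : InnerProductSpace ℂ (PreSobolev q hq n h) :=
  InnerProductSpace.ofCore (sobolevCore q hq n h).toCore

/-- The Hilbert space `Vⁿ`: the completion of test functions for the norm `|f|² = ⟨Sⁿ f, f⟩`. -/
abbrev SobolevSpace : Type := UniformSpace.Completion (PreSobolev q hq n h)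

/-- A test function, as an element of `Vⁿ`. -/
def toSobolev (f : TestFn) : SobolevSpace q hq n h :=
  UniformSpace.Completion.coe' (α := PreSobolev q hq n h) f

end AutomorphicHamiltonian

end

open AutomorphicHamiltonian

/-! In the coordinates z = x + i(√(1 - x²) + t) the fundamental domain is the half-strip |x| ≤ 1/2,
t ≥ 0 with measure y⁻² dx dt. The factor y² of the Laplacian cancels this density, so Green's
formula (`inner_hamiltonian`) turns ⟨g, S f⟩ into the flat Dirichlet form plus the integral of y⁻² q
times conj(g) f; the boundary terms cancel by invariance under z + 1 and -1/z. As q ≥ c y² in the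
cusp, y⁻² (q + C) ≥ c on the whole strip for a suitable C, so the form of S + C dominates the flat
H¹ norm `energy` (`energy_le`). In particular S is bounded below.

Let V be the completion of the test functions for a positive form of this kind and J : V → L² its
natural map. By abstract form theory (`IsFormCompletion`) J J* is the resolvent of the Friedrichs
extension at a real point, and self-adjointness follows. In dimension two one cannot expect J to be
Hilbert-Schmidt, but J* J gains twice as much, and its Hilbert-Schmidt property passes to J J*
through a square root (`summable_norm_sq_self_comp_adjoint`).

For J* J, the norm of J* J f is that of the functional g ↦ ⟨f, g⟩ on V. Integrating by parts in x
replaces f by its primitive along horizontal lines and puts a derivative on g, which the energy of g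
absorbs. The value of the primitive at a point is a functional of f bounded by the energy, with
squared norm at most 16/(1 + t)². By duality the squares of these values over a normalized family
sum to at most that bound, which is integrable in t (`exists_pairing_bound`,
`IsFormSpace.summable_adjoint_comp_self`).

If q ≥ 0, a Poincaré inequality on vertical lines carries the control of f from high in the cusp
down to the arc (`exists_norm_sq_le`). Finally, a power of S makes Vⁿ isometric to a subspace of L²
or of V¹, according to the parity of n, and the transition map becomes the restriction of J J* or J*
J to a subspace (`exists_transition`). -/

namespace AutomorphicHamiltonian

/-! ### Hilbert-Schmidt sums of bounded operators. -/

section HilbertSchmidt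

variable {E F V : Type*} [NormedAddCommGroup E] [InnerProductSpace ℂ E]
  [NormedAddCommGroup F] [InnerProductSpace ℂ F] [NormedAddCommGroup V] [InnerProductSpace ℂ V]
  {ι κ : Type*}

theorem tsum_enorm_inner_sq (b : HilbertBasis ι ℂ E) (x : E) :
    ∑' i, ‖⟪b i, x⟫_ℂ‖ₑ ^ 2 = ‖x‖ₑ ^ 2 := by
  have h := b.hasSum_inner_mul_inner x x
  have h1 : HasSum (fun i => ‖⟪b i, x⟫_ℂ‖ ^ 2) (‖x‖ ^ 2) := by
    have h2 := Complex.hasSum_re h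
    have e2 : (⟪x, x⟫_ℂ).re = ‖x‖ ^ 2 := by
      rw [inner_self_eq_norm_sq_to_K]; norm_cast
    rw [e2] at h2
    refine h2.congr_fun fun i => ?_
    rw [← inner_conj_symm x (b i), ← Complex.normSq_eq_conj_mul_self, Complex.normSq_eq_norm_sq]
    norm_cast
  have h3 := ENNReal.ofReal_tsum_of_nonneg (fun i => sq_nonneg ‖⟪b i, x⟫_ℂ‖) h1.summable
  rw [h1.tsum_eq] at h3
  simpa only [ENNReal.ofReal_pow (norm_nonneg _), ofReal_norm] using h3.symm

theorem summable_norm_sq_iff {G : Type*} [NormedAddCommGroup G] (f : ι → G) :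
    (Summable fun i => ‖f i‖ ^ 2) ↔ ∑' i, ‖f i‖ₑ ^ 2 ≠ ⊤ := by
  have h : ∀ i, ‖f i‖ₑ ^ 2 = ENNReal.ofNNReal (‖f i‖₊ ^ 2) := fun i => by
    rw [enorm_eq_nnnorm, ENNReal.coe_pow]
  simp only [h]
  rw [ENNReal.tsum_coe_ne_top_iff_summable, ← NNReal.summable_coe]
  simp

/-- Both sides are the double sum of |⟨cₖ, T bᵢ⟩|². In the extended nonnegative reals the order of
summation may be exchanged without any summability. -/
theorem tsum_enorm_sq_adjoint [CompleteSpace E] [CompleteSpace F] (T : E →L[ℂ] F)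
    (b : HilbertBasis ι ℂ E) (c : HilbertBasis κ ℂ F) :
    ∑' k, ‖T.adjoint (c k)‖ₑ ^ 2 = ∑' i, ‖T (b i)‖ₑ ^ 2 := by
  simp only [← tsum_enorm_inner_sq b (T.adjoint _), ← tsum_enorm_inner_sq c (T _)]
  rw [ENNReal.tsum_comm]
  refine tsum_congr fun i => tsum_congr fun k => ?_
  rw [ContinuousLinearMap.adjoint_inner_right, ← inner_conj_symm, ← ofReal_norm,
    RCLike.norm_conj, ofReal_norm]

/-- This reduces the Hilbert-Schmidt property on a completion to finite families in the dense
subspace, orthonormality being relaxed to a contraction condition on linear combinations. Basis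
vectors are only limits of such vectors, and the relaxed condition survives the approximation. -/
theorem summable_norm_sq_of_dense {X : Type*} [AddCommGroup X] [Module ℂ X]
    (T : V →L[ℂ] F) (e : X →ₗ[ℂ] V) (he : DenseRange e) (K : ℝ)
    (h : ∀ (s : Finset ι) (f : ι → X),
      (∀ c : ι → ℂ, ‖e (∑ i ∈ s, c i • f i)‖ ^ 2 ≤ ∑ i ∈ s, ‖c i‖ ^ 2) →
        ∑ i ∈ s, ‖T (e (f i))‖ ^ 2 ≤ K) (b : HilbertBasis ι ℂ V) :
    Summable fun i => ‖T (b i)‖ ^ 2 := by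
  refine summable_of_sum_le (c := 4 * K) (fun i => sq_nonneg _) fun s => ?_
  -- The factor `s.card + 1` keeps the total error of a combination below the ℓ² norm of its
  -- coefficients; the factor `m + 1` gives convergence.
  have hx : ∀ (m : ℕ) (i : ι), ∃ x : X, ‖e x - b i‖ < 1 / ((s.card + 1) * ((m : ℝ) + 1)) := by
    intro m i
    obtain ⟨x, hx⟩ := he.exists_dist_lt (b i)
      (ε := 1 / ((s.card + 1) * ((m : ℝ) + 1))) (by positivity)
    exact ⟨x, by rwa [dist_comm, dist_eq_norm] at hx⟩
  choose x hx using hx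
  have hlim : ∀ i, Tendsto (fun m => e (x m i)) atTop (𝓝 (b i)) := by
    intro i
    rw [tendsto_iff_norm_sub_tendsto_zero]
    refine squeeze_zero (fun m => norm_nonneg _) (fun m => (hx m i).le.trans ?_)
      tendsto_one_div_add_atTop_nhds_zero_nat
    refine one_div_le_one_div_of_le (by positivity) ?_
    nlinarith [Nat.cast_nonneg (α := ℝ) m, Nat.cast_nonneg (α := ℝ) s.card]
  have hlim2 : Tendsto (fun m => ∑ i ∈ s, ‖T (e (x m i))‖ ^ 2) atTop
      (𝓝 (∑ i ∈ s, ‖T (b i)‖ ^ 2)) :=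
    tendsto_finsetSum _ fun i _ => (((T.continuous.tendsto _).comp (hlim i)).norm).pow 2
  refine le_of_tendsto' hlim2 fun m => ?_
  -- A combination of the approximants has norm at most twice that of its coefficients, so halving
  -- them gives a contraction. This costs the factor 4 in `4 * K`.
  have h1 := h s (fun i => (1 / 2 : ℂ) • x m i) ?_
  · simp only [map_smul, norm_smul, mul_pow, ← Finset.mul_sum] at h1
    norm_num at h1
    linarith
  · intro c
    set A := Real.sqrt (∑ i ∈ s, ‖c i‖ ^ 2) with hA
    have hA0 : 0 ≤ ∑ i ∈ s, ‖c i‖ ^ 2 := Finset.sum_nonneg fun i _ => sq_nonneg _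
    have hA2 : A ^ 2 = ∑ i ∈ s, ‖c i‖ ^ 2 := Real.sq_sqrt hA0
    have hAn : 0 ≤ A := Real.sqrt_nonneg _
    have hb : ‖∑ i ∈ s, c i • b i‖ = A := by
      rw [← sq_eq_sq₀ (norm_nonneg _) hAn, hA2]
      have h3 : ⟪∑ i ∈ s, c i • b i, ∑ i ∈ s, c i • b i⟫_ℂ = ∑ i ∈ s, conj (c i) * c i :=
        b.orthonormal.inner_sum c c s
      have h4 := congrArg Complex.re h3
      rw [inner_self_eq_norm_sq_to_K] at h4
      simp only [← Complex.normSq_eq_conj_mul_self, Complex.normSq_eq_norm_sq] at h4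
      norm_cast at h4
    have hd : ‖∑ i ∈ s, c i • (e (x m i) - b i)‖ ≤ A := by
      refine (norm_sum_le _ _).trans ?_
      have h5 : ∀ i ∈ s, ‖c i • (e (x m i) - b i)‖ ≤ A * (1 / (s.card + 1)) := by
        intro i hi
        rw [norm_smul]
        refine mul_le_mul ?_ ((hx m i).le.trans ?_) (norm_nonneg _) hAn
        · refine Real.le_sqrt_of_sq_le ?_
          exact Finset.single_le_sum (f := fun i => ‖c i‖ ^ 2) (fun i _ => sq_nonneg _) hi
        · refine one_div_le_one_div_of_le (by positivity) ?_
          nlinarith [Nat.cast_nonneg (α := ℝ) m, Nat.cast_nonneg (α := ℝ) s.card]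
      refine (Finset.sum_le_sum h5).trans ?_
      rw [Finset.sum_const, nsmul_eq_mul]
      have : (s.card : ℝ) * (1 / (s.card + 1)) ≤ 1 := by
        rw [mul_one_div, div_le_one (by positivity)]; linarith
      nlinarith
    have h6 : e (∑ i ∈ s, c i • (1 / 2 : ℂ) • x m i) =
        (1 / 2 : ℂ) • (∑ i ∈ s, c i • b i + ∑ i ∈ s, c i • (e (x m i) - b i)) := by
      rw [← Finset.sum_add_distrib, map_sum, Finset.smul_sum]
      refine Finset.sum_congr rfl fun i _ => ?_
      rw [map_smul, map_smul, ← smul_add, smul_comm]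
      congr 2
      abel
    rw [h6, norm_smul, ← hA2]
    have h7 : ‖(1 / 2 : ℂ)‖ = 1 / 2 := by norm_num
    rw [h7]
    have h8 := norm_add_le (∑ i ∈ s, c i • b i) (∑ i ∈ s, c i • (e (x m i) - b i))
    rw [hb] at h8
    refine pow_le_pow_left₀ (by positivity) ?_ 2
    linarith

/-- If `J* J` is Hilbert-Schmidt, then so is `J J*`. -/
theorem summable_norm_sq_self_comp_adjoint [CompleteSpace E] [CompleteSpace V] (J : V →L[ℂ] E)
    (b : HilbertBasis ι ℂ V) (c : HilbertBasis κ ℂ E)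
    (h : Summable fun i => ‖J.adjoint (J (b i))‖ ^ 2) :
    Summable fun k => ‖J (J.adjoint (c k))‖ ^ 2 := by
  set R : E →L[ℂ] E := J ∘L J.adjoint with hR
  have h0 : 0 ≤ R := (ContinuousLinearMap.nonneg_iff_isPositive R).2
    (ContinuousLinearMap.isPositive_self_comp_adjoint J)
  -- Since ‖P x‖ = ‖J* x‖, the two sums are the Hilbert-Schmidt sums of P J and of its adjoint J* P.
  set P : E →L[ℂ] E := CFC.sqrt R with hP
  have hPP : ∀ x, P (P x) = J (J.adjoint x) := fun x =>
    congrArg (fun A : E →L[ℂ] E => A x) (CFC.sqrt_mul_sqrt_self R h0)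
  have hPs : P.adjoint = P := (CFC.sqrt_nonneg R).isSelfAdjoint.adjoint_eq
  have hnorm : ∀ x, ‖P x‖ = ‖J.adjoint x‖ := by
    intro x
    have h1 : ⟪P x, P x⟫_ℂ = ⟪J.adjoint x, J.adjoint x⟫_ℂ := by
      conv_lhs => rw [← hPs, ContinuousLinearMap.adjoint_inner_left, hPs, hPP]
      rw [ContinuousLinearMap.adjoint_inner_left]
    rw [inner_self_eq_norm_sq_to_K, inner_self_eq_norm_sq_to_K] at h1
    norm_cast at h1
    exact (sq_eq_sq₀ (norm_nonneg _) (norm_nonneg _)).1 h1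
  rw [summable_norm_sq_iff] at h ⊢
  have e1 : ∀ k, ‖J (J.adjoint (c k))‖ₑ = ‖(P ∘L J).adjoint (c k)‖ₑ := by
    intro k
    rw [ContinuousLinearMap.adjoint_comp, hPs, ContinuousLinearMap.comp_apply, ← hPP,
      ← ofReal_norm, ← ofReal_norm, hnorm]
  have e2 : ∀ i, ‖J.adjoint (J (b i))‖ₑ = ‖(P ∘L J) (b i)‖ₑ := by
    intro i
    rw [ContinuousLinearMap.comp_apply, ← ofReal_norm, ← ofReal_norm, hnorm]
  simp only [e2] at h
  simp only [e1]
  rwa [tsum_enorm_sq_adjoint _ b c]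

/-- `∑ ‖T uᵢ‖²` is finite for every orthonormal family if it is so for one Hilbert basis. -/
theorem summable_norm_sq_of_orthonormal [CompleteSpace E] [CompleteSpace F] (T : E →L[ℂ] F)
    (b : HilbertBasis ι ℂ E) (h : Summable fun i => ‖T (b i)‖ ^ 2) {u : κ → E}
    (hu : Orthonormal ℂ u) : Summable fun k => ‖T (u k)‖ ^ 2 := by
  obtain ⟨w, c, -⟩ := exists_hilbertBasis ℂ F
  have h1 := (summable_norm_sq_iff _).1 h
  rw [← tsum_enorm_sq_adjoint T b c] at h1
  rw [summable_norm_sq_iff]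
  refine ne_top_of_le_ne_top h1 ?_
  -- After expanding in the basis `c` and exchanging the sums, Bessel's inequality for `u` applies
  -- to each T* cⱼ.
  simp only [← tsum_enorm_inner_sq c (T _)]
  rw [ENNReal.tsum_comm]
  refine ENNReal.tsum_le_tsum fun j => ?_
  have h2 := hu.tsum_inner_products_le (T.adjoint (c j))
  have h3 := ENNReal.ofReal_le_ofReal h2
  rw [ENNReal.ofReal_tsum_of_nonneg (fun _ => sq_nonneg _) (hu.inner_products_summable _)] at h3
  simp only [ENNReal.ofReal_pow (norm_nonneg _), ofReal_norm] at h3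
  refine le_trans (le_of_eq (tsum_congr fun k => ?_)) h3
  rw [ContinuousLinearMap.adjoint_inner_right, ← inner_conj_symm, ← ofReal_norm,
    RCLike.norm_conj, ofReal_norm]

end HilbertSchmidt

/-! ### The Friedrichs extension through the form completion. -/

section Friedrichs

variable {E V : Type*} [NormedAddCommGroup E] [InnerProductSpace ℂ E]
  [NormedAddCommGroup V] [InnerProductSpace ℂ V]

/-- `V` is the completion of the domain of `T` for the form `⟨x, T y⟩ + C ⟨x, y⟩`, and `J` is its
natural map to `E`. -/
structure IsFormCompletion (T : E →ₗ.[ℂ] E) (C : ℝ) (J : V →L[ℂ] E) (e : T.domain →ₗ[ℂ] V) :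
    Prop where
  dense : DenseRange e
  map_eq : ∀ x, J (e x) = x
  inner_eq : ∀ x y, ⟪e x, e y⟫_ℂ = ⟪(x : E), T y⟫_ℂ + C * ⟪(x : E), y⟫_ℂ

namespace IsFormCompletion

variable {T : E →ₗ.[ℂ] E} {C : ℝ} {J : V →L[ℂ] E} {e : T.domain →ₗ[ℂ] V}
  (h : IsFormCompletion T C J e)

include h

theorem inner_map (v : V) (y : T.domain) :
    ⟪v, e y⟫_ℂ = ⟪J v, T y⟫_ℂ + C * ⟪J v, (y : E)⟫_ℂ := by
  refine h.dense.induction_on v (isClosed_eq (by fun_prop) (by fun_prop)) fun x => ?_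
  rw [h.map_eq, h.inner_eq]

theorem norm_sq (x : T.domain) :
    ‖e x‖ ^ 2 = (⟪T x, (x : E)⟫_ℂ).re + C * ‖(x : E)‖ ^ 2 := by
  have h1 := congrArg Complex.re (h.inner_eq x x)
  rw [inner_self_eq_norm_sq_to_K, inner_self_eq_norm_sq_to_K, ← inner_conj_symm] at h1
  simp only [Complex.add_re, Complex.conj_re, Complex.re_ofReal_mul] at h1
  norm_cast at h1

variable [CompleteSpace V]

/-- The squared norm of `e x` exceeds the form by C ‖x‖², so a sequence convergent in E is Cauchy
for the form exactly when its image is Cauchy in V. The form domain is thus the range of J. -/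
theorem isFormLimit_iff (u : E) : IsFormLimit T u ↔ ∃ v, J v = u := by
  constructor
  · rintro ⟨x, hx, hx2⟩
    have hc : CauchySeq fun n => e (x n) := by
      rw [cauchySeq_iff_tendsto_dist_atTop_0]
      have h1 : Tendsto (fun p : ℕ × ℕ => ‖((x p.1 - x p.2 : T.domain) : E)‖ ^ 2) atTop (𝓝 0) := by
        have h2 := (cauchySeq_iff_tendsto_dist_atTop_0.1 hx.cauchySeq).pow 2
        simpa [dist_eq_norm] using h2
      have h3 := hx2.add (h1.const_mul C)
      simp only [← h.norm_sq, mul_zero, add_zero] at h3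
      have h4 := h3.sqrt
      simpa [dist_eq_norm, Real.sqrt_sq (norm_nonneg _)] using h4
    obtain ⟨v, hv⟩ := cauchySeq_tendsto_of_complete hc
    refine ⟨v, tendsto_nhds_unique ((J.continuous.tendsto v).comp hv) ?_⟩
    simpa [Function.comp_def, h.map_eq] using hx
  · rintro ⟨v, rfl⟩
    obtain ⟨y, hy, hlim⟩ := mem_closure_iff_seq_limit.1 (h.dense v)
    choose x hx using hy
    have hxv : Tendsto (fun n => e (x n)) atTop (𝓝 v) := by simpa only [hx] using hlim
    have hxu : Tendsto (fun n => (x n : E)) atTop (𝓝 (J v)) := by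
      simpa [Function.comp_def, h.map_eq] using (J.continuous.tendsto v).comp hxv
    refine ⟨x, hxu, ?_⟩
    have h1 := (cauchySeq_iff_tendsto_dist_atTop_0.1 hxu.cauchySeq).pow 2
    have h2 := (cauchySeq_iff_tendsto_dist_atTop_0.1 hxv.cauchySeq).pow 2
    have h3 := h2.sub (h1.const_mul C)
    simp only [dist_eq_norm] at h3
    norm_num at h3
    refine h3.congr fun p => ?_
    rw [← map_sub, h.norm_sq, ← Submodule.coe_sub]
    ring

variable [CompleteSpace E]

theorem inner_adjoint (w : E) (x : T.domain) : ⟪J.adjoint w, e x⟫_ℂ = ⟪w, (x : E)⟫_ℂ := by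
  rw [ContinuousLinearMap.adjoint_inner_left, h.map_eq]

variable (hd : Dense (T.domain : Set E)) (hT : IsSemibounded T)

include hd

/-- With `exists_friedrichs_eq` this identifies J J* with (A + C)⁻¹, A the Friedrichs extension. If
u = J v, then ⟨v, e y⟩ = ⟨u, (T + C) y⟩ = ⟨(A + C) u, y⟩ for all y, hence v = J* (A + C) u by
density. -/
theorem eq_of_mem_friedrichs (u : (friedrichs T hT).domain) :
    J (J.adjoint (friedrichs T hT u + C • (u : E))) = u := by
  obtain ⟨v, hv⟩ := (h.isFormLimit_iff u).1 u.2.1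
  have h2 : friedrichs T hT u = T.adjoint ⟨u, u.2.2⟩ := rfl
  have h1 : v = J.adjoint (friedrichs T hT u + C • (u : E)) := by
    refine h.dense.eq_of_inner_left ℂ ?_
    intro y
    rw [h.inner_map, h.inner_adjoint, inner_add_left, hv, h2]
    congr 1
    · exact (LinearPMap.adjoint_isFormalAdjoint hd ⟨u, u.2.2⟩ y).symm
    · rw [← Complex.coe_smul, inner_smul_left, Complex.conj_ofReal]
  rw [← h1, hv]

/-- The vector v = J* w satisfies ⟨J v, (T + C) y⟩ = ⟨v, e y⟩ = ⟨w, y⟩. This says that J v lies in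
the domain of T† with T† J v = w - C J v. -/
theorem exists_friedrichs_eq (w : E) : ∃ hu : J (J.adjoint w) ∈ (friedrichs T hT).domain,
    friedrichs T hT ⟨J (J.adjoint w), hu⟩ + C • J (J.adjoint w) = w := by
  have key : ∀ y : T.domain,
      ⟪w - (C : ℂ) • J (J.adjoint w), (y : E)⟫_ℂ = ⟪J (J.adjoint w), T y⟫_ℂ := by
    intro y
    have h1 := h.inner_map (J.adjoint w) y
    rw [h.inner_adjoint] at h1
    rw [inner_sub_left, h1, inner_smul_left, Complex.conj_ofReal]
    ring
  have h2 : J (J.adjoint w) ∈ T.adjoint.domain :=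
    LinearPMap.mem_adjoint_domain_of_exists _ ⟨_, key⟩
  refine ⟨⟨(h.isFormLimit_iff _).2 ⟨_, rfl⟩, h2⟩, ?_⟩
  have h3 := LinearPMap.adjoint_apply_eq hd ⟨_, h2⟩ key
  have h4 : friedrichs T hT ⟨J (J.adjoint w), ⟨(h.isFormLimit_iff _).2 ⟨_, rfl⟩, h2⟩⟩ =
    T.adjoint ⟨J (J.adjoint w), h2⟩ := rfl
  rw [h4, h3, ← Complex.coe_smul]
  abel

theorem isResolvent : IsResolvent (friedrichs T hT) (-C : ℂ) (J ∘L J.adjoint) := by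
  refine ⟨fun x => ?_, fun y => ?_⟩
  · rw [_root_.neg_smul, sub_neg_eq_add, Complex.coe_smul]
    exact h.eq_of_mem_friedrichs hd hT x
  · obtain ⟨hu, h1⟩ := h.exists_friedrichs_eq hd hT y
    refine ⟨hu, ?_⟩
    rw [_root_.neg_smul, sub_neg_eq_add, Complex.coe_smul]
    exact h1

theorem friedrichs_eq (u : (friedrichs T hT).domain) :
    ∃ w, J (J.adjoint w) = u ∧ friedrichs T hT u = w - (C : ℂ) • (u : E) := by
  refine ⟨friedrichs T hT u + C • (u : E), h.eq_of_mem_friedrichs hd hT u, ?_⟩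
  rw [Complex.coe_smul]
  abel

/-- A is symmetric because A + C inverts the symmetric operator J J*. Since A + C is also onto,
pairing y in the domain of A† with all (A + C) u gives y = J J* (A† + C) y, which lies in the domain
of A. -/
theorem isSelfAdjoint (hsymm : T.IsFormalAdjoint T) : IsSelfAdjoint (friedrichs T hT) := by
  set A := friedrichs T hT with hA
  have hR : ∀ x y : E, ⟪J (J.adjoint x), y⟫_ℂ = ⟪x, J (J.adjoint y)⟫_ℂ := fun x y => by
    rw [← ContinuousLinearMap.adjoint_inner_right, ContinuousLinearMap.adjoint_inner_left]
  have hAsymm : A.IsFormalAdjoint A := by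
    intro x y
    obtain ⟨w, hw, hw2⟩ := h.friedrichs_eq hd hT x
    obtain ⟨z, hz, hz2⟩ := h.friedrichs_eq hd hT y
    rw [hw2, hz2, inner_sub_left, inner_sub_right, inner_smul_left, inner_smul_right,
      Complex.conj_ofReal, ← hw, ← hz, hR, hR]
  have hTA : T.domain ≤ A.domain := by
    intro x hx
    exact ⟨(h.isFormLimit_iff x).2 ⟨e ⟨x, hx⟩, h.map_eq _⟩,
      LinearPMap.mem_adjoint_domain_of_exists _ ⟨T ⟨x, hx⟩, fun y => hsymm ⟨x, hx⟩ y⟩⟩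
  have hAd : Dense (A.domain : Set E) := hd.mono hTA
  rw [LinearPMap.isSelfAdjoint_def]
  refine le_antisymm ?_ (hAsymm.le_adjoint hAd)
  have hle := hAsymm.le_adjoint hAd
  have hmem : ∀ y : A.adjoint.domain, (y : E) =
      J (J.adjoint (A.adjoint y + (C : ℂ) • (y : E))) := by
    intro y
    set w := A.adjoint y + (C : ℂ) • (y : E) with hw
    refine ext_inner_right ℂ fun z => ?_
    obtain ⟨hu, h1⟩ := h.exists_friedrichs_eq hd hT z
    have h2 := LinearPMap.adjoint_isFormalAdjoint hAd y ⟨_, hu⟩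
    rw [hR, hw, inner_add_left, h2, inner_smul_left, Complex.conj_ofReal]
    conv_lhs => rw [← h1]
    rw [inner_add_right, ← Complex.coe_smul, inner_smul_right]
  have hdom : A.adjoint.domain ≤ A.domain := by
    intro y hy
    obtain ⟨hu, -⟩ := h.exists_friedrichs_eq hd hT (A.adjoint ⟨y, hy⟩ + (C : ℂ) • y)
    have := hmem ⟨y, hy⟩
    rw [← this] at hu
    exact hu
  refine ⟨hdom, fun x y hxy => ?_⟩
  exact (hle.2 hxy.symm).symm

theorem hasHilbertSchmidtResolvent {ι : Type*} (b : HilbertBasis ι ℂ V)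
    (hb : Summable fun i => ‖J.adjoint (J (b i))‖ ^ 2) :
    HasHilbertSchmidtResolvent (friedrichs T hT) := by
  refine ⟨⟨_, _, h.isResolvent hd hT⟩, fun z R hR κ c => ?_⟩
  have h1 := summable_norm_sq_self_comp_adjoint J b c hb
  -- The resolvent identity R = (1 + (z + C) R) J J*: every resolvent is a bounded operator composed
  -- with a Hilbert-Schmidt one.
  set B : E →L[ℂ] E := ContinuousLinearMap.id ℂ E + (z + C) • R with hB
  have h2 : ∀ y, R y = B (J (J.adjoint y)) := by
    intro y
    obtain ⟨hu, h3⟩ := h.exists_friedrichs_eq hd hT y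
    have h4 := hR.1 ⟨_, hu⟩
    have h5 : friedrichs T hT ⟨J (J.adjoint y), hu⟩ - z • J (J.adjoint y) =
        y - (z + C) • J (J.adjoint y) := by
      rw [eq_sub_of_add_eq h3, add_smul, Complex.coe_smul]
      abel
    simp only at h4
    rw [h5, map_sub, map_smul] at h4
    rw [hB]
    simp only [add_apply, ContinuousLinearMap.id_apply, smul_apply]
    exact sub_eq_iff_eq_add.1 h4
  refine Summable.of_nonneg_of_le (fun i => sq_nonneg _) (fun i => ?_) (h1.mul_left (‖B‖ ^ 2))
  rw [h2, ← mul_pow]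
  exact pow_le_pow_left₀ (norm_nonneg _) (B.le_opNorm _) 2

end IsFormCompletion

end Friedrichs

end AutomorphicHamiltonian

namespace AutomorphicHamiltonian

/-! ### Coordinates on the fundamental domain -/

/-- The lower boundary of the standard fundamental domain. -/
noncomputable def arcHeight (x : ℝ) : ℝ := Real.sqrt (1 - x ^ 2)

/-- The half-strip `[-1/2, 1/2] × [0, ∞)`, which parametrizes the fundamental domain. -/
def strip : Set (ℝ × ℝ) := Set.Icc (-(1 / 2)) (1 / 2) ×ˢ Set.Ici 0

/-- The parametrization `(x, t) ↦ x + i (√(1 - x²) + t)` of the fundamental domain. -/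
noncomputable def chart (p : ℝ × ℝ) : ℂ := ⟨p.1, arcHeight p.1 + p.2⟩

@[simp] theorem chart_re (p : ℝ × ℝ) : (chart p).re = p.1 := rfl

theorem chart_im (p : ℝ × ℝ) : (chart p).im = arcHeight p.1 + p.2 := rfl

theorem continuous_arcHeight : Continuous arcHeight := by
  unfold arcHeight; fun_prop

theorem continuous_chart : Continuous chart := by
  have h : chart = fun p => ((p.1 : ℝ) : ℂ) + ((arcHeight p.1 + p.2 : ℝ) : ℂ) * Complex.I := by
    funext p
    apply Complex.ext <;> simp [chart]
  rw [h]
  have := continuous_arcHeight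
  fun_prop

theorem arcHeight_nonneg (x : ℝ) : 0 ≤ arcHeight x := Real.sqrt_nonneg _

theorem arcHeight_le_one (x : ℝ) : arcHeight x ≤ 1 := by
  exact Real.sqrt_le_one.2 (by nlinarith [sq_nonneg x])

theorem half_lt_arcHeight {x : ℝ} (hx : x ∈ Set.Icc (-(1 / 2) : ℝ) (1 / 2)) :
    1 / 2 < arcHeight x := by
  refine Real.lt_sqrt_of_sq_lt ?_
  nlinarith [hx.1, hx.2]

theorem arcHeight_sq {x : ℝ} (hx : x ∈ Set.Icc (-(1 / 2) : ℝ) (1 / 2)) :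
    arcHeight x ^ 2 = 1 - x ^ 2 := by
  refine Real.sq_sqrt ?_
  nlinarith [hx.1, hx.2]

theorem half_add_lt_chart_im {p : ℝ × ℝ} (hp : p ∈ strip) : 1 / 2 + p.2 < (chart p).im := by
  rw [chart_im]
  linarith [half_lt_arcHeight hp.1]

theorem chart_im_pos {p : ℝ × ℝ} (hp : p ∈ strip) : 0 < (chart p).im := by
  have h1 := half_add_lt_chart_im hp
  have h2 : 0 ≤ p.2 := hp.2
  linarith

theorem chart_im_le {p : ℝ × ℝ} : (chart p).im ≤ 1 + p.2 := by
  rw [chart_im]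
  linarith [arcHeight_le_one p.1]

theorem le_chart_im {p : ℝ × ℝ} : p.2 ≤ (chart p).im := by
  rw [chart_im]
  linarith [arcHeight_nonneg p.1]

/-- `chart` as a measurable equivalence. -/
noncomputable def chartEquiv : ℝ × ℝ ≃ᵐ ℂ where
  toFun := chart
  invFun z := (z.re, z.im - arcHeight z.re)
  left_inv p := by simp [chart]
  right_inv z := by apply Complex.ext <;> simp [chart]
  measurable_toFun := continuous_chart.measurable
  measurable_invFun := by
    have := continuous_arcHeight.comp Complex.continuous_re
    have h : Continuous fun z : ℂ => (z.re, z.im - arcHeight z.re) := by fun_prop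
    exact h.measurable

/-- A shear: on each vertical line the chart is a translation. -/
theorem measurePreserving_chart : MeasurePreserving chart volume volume := by
  have h1 : MeasurePreserving (fun p : ℝ × ℝ => (p.1, arcHeight p.1 + p.2)) volume volume := by
    have hm : Measurable (Function.uncurry fun x t : ℝ => arcHeight x + t) := by
      have : Continuous (Function.uncurry fun x t : ℝ => arcHeight x + t) :=
        (continuous_arcHeight.comp continuous_fst).add continuous_snd
      exact this.measurable
    exact (MeasurePreserving.id volume).skew_product hm
      (ae_of_all _ fun x => (measurePreserving_add_left volume (arcHeight x)).map_eq)
  exact (Complex.volume_preserving_equiv_real_prod.symm _).comp h1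

theorem chart_preimage_fd : chart ⁻¹' (UpperHalfPlane.coe '' 𝒟) = strip := by
  ext p
  rw [ModularGroup.coe_fd, Set.mem_preimage, Set.mem_ofPred_eq]
  constructor
  · rintro ⟨h1, h2, h3⟩
    have hx : p.1 ∈ Set.Icc (-(1 / 2) : ℝ) (1 / 2) := abs_le.1 h3
    refine ⟨hx, ?_⟩
    have h4 : 1 ≤ ‖chart p‖ ^ 2 := by nlinarith
    rw [← Complex.normSq_eq_norm_sq, Complex.normSq_apply, chart_re] at h4
    have h5 : arcHeight p.1 ≤ (chart p).im := by
      refine Real.sqrt_le_iff.2 ⟨h1.le, ?_⟩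
      linarith
    rw [chart_im] at h5
    exact (by linarith : (0 : ℝ) ≤ p.2)
  · intro hp
    refine ⟨chart_im_pos hp, ?_, abs_le.2 hp.1⟩
    have h1 : (0 : ℝ) ≤ p.2 := hp.2
    have h2 := arcHeight_sq hp.1
    have h3 := arcHeight_nonneg p.1
    have h4 : 1 ≤ ‖chart p‖ ^ 2 := by
      rw [← Complex.normSq_eq_norm_sq, Complex.normSq_apply, chart_re, chart_im]
      nlinarith
    exact (one_le_sq_iff₀ (norm_nonneg _)).1 h4

theorem continuousOn_proj_ofComplex :
    ContinuousOn (fun w : ℂ => proj (ofComplex w)) {w : ℂ | 0 < w.im} := fun _ hw =>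
  (continuous_proj.continuousAt.comp
    (contMDiffAt_ofComplex (n := 0) hw).continuousAt).continuousWithinAt

instance : ContinuousConstSMul SL(2, ℤ) ℍ where
  continuous_const_smul γ := continuous_const_smul (γ : GL (Fin 2) ℝ)

theorem measurable_ofComplex : Measurable (fun w : ℂ => ofComplex w) := by
  classical
  have hs : MeasurableSet {w : ℂ | 0 < w.im} := isOpen_upperHalfPlaneSet.measurableSet
  refine measurable_of_restrict_of_restrict_compl hs ?_ ?_
  · have h1 : Continuous (Set.domRestrict {w : ℂ | 0 < w.im} fun w : ℂ => ofComplex w) :=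
      continuousOn_iff_continuous_domRestrict.1 fun w hw =>
        (contMDiffAt_ofComplex (n := 0) hw).continuousAt.continuousWithinAt
    exact h1.measurable
  · have h2 : (Set.domRestrict {w : ℂ | 0 < w.im}ᶜ fun w : ℂ => ofComplex w) =
        fun _ => Classical.choice inferInstance := by
      funext w
      exact ofComplex_apply_of_im_nonpos (not_lt.1 w.2)
    rw [h2]
    exact measurable_const

theorem measurable_proj_chart : Measurable fun p : ℝ × ℝ => proj (ofComplex (chart p)) :=
  measurable_proj.comp (measurable_ofComplex.comp continuous_chart.measurable)

theorem isClosed_strip : IsClosed strip := isClosed_Icc.prod isClosed_Ici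

theorem measurableSet_strip : MeasurableSet strip := isClosed_strip.measurableSet

/-- The curved fundamental domain becomes a product set with measure y⁻² dx dt, so that integrals
over the modular curve reduce to iterated one-dimensional ones. -/
theorem modularMeasure_eq :
    modularMeasure = ((volume.restrict strip).withDensity fun p : ℝ × ℝ =>
      (((1 / ‖(chart p).im‖₊) ^ 2 : NNReal) : ENNReal)).map
        fun p => proj (ofComplex (chart p)) := by
  ext A hA
  have h1 : MeasurableSet (proj ⁻¹' A) := measurable_proj hA
  rw [Measure.map_apply measurable_proj_chart hA,
    withDensity_apply _ (measurable_proj_chart hA), modularMeasure,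
    Measure.map_apply measurable_proj hA, Measure.restrict_apply h1, volume_eq_lintegral,
    Measure.restrict_restrict (measurable_proj_chart hA),
    ← measurePreserving_chart.setLIntegral_comp_preimage_emb chartEquiv.measurableEmbedding]
  congr 2
  ext p
  rw [← chart_preimage_fd]
  constructor
  · rintro ⟨z, ⟨hz1, hz2⟩, hz3⟩
    refine ⟨?_, z, hz2, hz3⟩
    rw [Set.mem_preimage, ← hz3, ofComplex_apply]
    exact hz1
  · rintro ⟨h2, z, hz, hz3⟩
    refine ⟨z, ⟨?_, hz⟩, hz3⟩
    rwa [Set.mem_preimage, ← hz3, ofComplex_apply] at h2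

/-- Integrals over the modular curve in the coordinates `(x, t)`. -/
theorem integral_modularMeasure {G : Type} [NormedAddCommGroup G] [NormedSpace ℝ G]
    {F : ModularCurve → G} (hF : AEStronglyMeasurable F modularMeasure) :
    ∫ p, F p ∂modularMeasure = ∫ p in strip, ((chart p).im ^ 2)⁻¹ • lift F (chart p) := by
  have hm : Measurable fun p : ℝ × ℝ => (1 / ‖(chart p).im‖₊) ^ 2 :=
    (measurable_const.div
      (Complex.continuous_im.comp continuous_chart).measurable.nnnorm).pow_const 2
  rw [modularMeasure_eq] at hF ⊢
  rw [integral_map measurable_proj_chart.aemeasurable hF, integral_withDensity_eq_integral_smul hm]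
  refine integral_congr_ae (ae_of_all _ fun p => ?_)
  simp only [NNReal.smul_def, lift]
  congr 1
  simp

theorem integrableOn_strip {G : Type*} [NormedAddCommGroup G] {Φ : ℝ × ℝ → G}
    (hc : ContinuousOn Φ strip) {M : ℝ} (hM : ∀ p ∈ strip, M ≤ p.2 → Φ p = 0) :
    IntegrableOn Φ strip := by
  have h1 : IntegrableOn Φ (Set.Icc (-(1 / 2)) (1 / 2) ×ˢ Set.Icc 0 M) :=
    (hc.mono (Set.prod_mono_right Set.Icc_subset_Ici_self)).integrableOn_compact
      (isCompact_Icc.prod isCompact_Icc)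
  refine h1.of_forall_sdiff_eq_zero measurableSet_strip fun p hp => hM p hp.1 ?_
  by_contra hn
  exact hp.2 ⟨hp.1.1, hp.1.2, (not_le.1 hn).le⟩

theorem setIntegral_strip {G : Type*} [NormedAddCommGroup G] [NormedSpace ℝ G] {Φ : ℝ × ℝ → G}
    (hc : ContinuousOn Φ strip) {M : ℝ} (hM0 : 0 ≤ M) (hM : ∀ p ∈ strip, M ≤ p.2 → Φ p = 0) :
    ∫ p in strip, Φ p = ∫ x in (-(1 / 2) : ℝ)..(1 / 2), ∫ t in (0 : ℝ)..M, Φ (x, t) := by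
  have hsub : Set.Icc (-(1 / 2) : ℝ) (1 / 2) ×ˢ Set.Icc 0 M ⊆ strip :=
    Set.prod_mono_right Set.Icc_subset_Ici_self
  have h1 : IntegrableOn Φ (Set.Icc (-(1 / 2)) (1 / 2) ×ˢ Set.Icc 0 M) :=
    (hc.mono hsub).integrableOn_compact (isCompact_Icc.prod isCompact_Icc)
  rw [setIntegral_eq_of_subset_of_forall_sdiff_eq_zero measurableSet_strip hsub
    (fun p hp => hM p hp.1 ?_)]
  · rw [Measure.volume_eq_prod, setIntegral_prod _ h1, intervalIntegral.integral_of_le (by norm_num),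
      integral_Icc_eq_integral_Ioc]
    refine integral_congr_ae (ae_of_all _ fun x => ?_)
    simp only
    rw [intervalIntegral.integral_of_le hM0, integral_Icc_eq_integral_Ioc]
  · by_contra hn
    exact hp.2 ⟨hp.1.1, hp.1.2, (not_le.1 hn).le⟩

/-! ### Test functions vanish high in the cusp -/

/-- By compactness the support is covered by the image of one band 1/(n + 1) < y < n + 1. An element
of SL₂(ℤ) with c = 0 preserves heights and one with c ≠ 0 sends height y to at most 1/y, so no point
of height at least n + 1 is equivalent to a point of the band. -/
theorem TestFn.exists_height (f : TestFn) :
    ∃ M : ℝ, 0 < M ∧ ∀ z : ℍ, M ≤ z.im → (f : ModularCurve → ℂ) (proj z) = 0 := by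
  -- The lower cut-off is essential: points of small height can be equivalent to points arbitrarily
  -- high in the cusp.
  set U : ℕ → Set ModularCurve := fun n =>
    proj '' {z : ℍ | 1 / ((n : ℝ) + 1) < z.im ∧ z.im < n + 1} with hU
  have hopen : ∀ n, IsOpen (U n) := fun n => by
    refine (isOpenMap_quotient_mk'_mul (Γ := SL(2, ℤ)) (T := ℍ)) _ ?_
    exact (isOpen_lt continuous_const continuous_im).inter (isOpen_lt continuous_im continuous_const)
  have hmono : Monotone U := by
    intro m n hmn
    refine Set.image_mono fun z hz => ⟨lt_of_le_of_lt ?_ hz.1, lt_of_lt_of_le hz.2 ?_⟩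
    · have : (m : ℝ) ≤ n := by exact_mod_cast hmn
      exact one_div_le_one_div_of_le (by positivity) (by linarith)
    · have : (m : ℝ) ≤ n := by exact_mod_cast hmn
      linarith
  have hcover : tsupport (f : ModularCurve → ℂ) ⊆ ⋃ n, U n := by
    intro p _
    obtain ⟨z, rfl⟩ : ∃ z, proj z = p := Quotient.exists_rep p
    obtain ⟨a, ha⟩ := exists_nat_one_div_lt z.im_pos
    obtain ⟨b, hb⟩ := exists_nat_gt z.im
    refine Set.mem_iUnion.2 ⟨max a b, z, ⟨lt_of_le_of_lt ?_ ha, hb.trans ?_⟩, rfl⟩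
    · have : (a : ℝ) ≤ (max a b : ℕ) := by exact_mod_cast le_max_left a b
      exact one_div_le_one_div_of_le (by positivity) (by linarith)
    · have : (b : ℝ) ≤ (max a b : ℕ) := by exact_mod_cast le_max_right a b
      linarith
  obtain ⟨n, hn⟩ := f.2.2.isCompact.elim_directed_cover U hopen hcover hmono.directed_le
  refine ⟨n + 1, by positivity, fun z hz => ?_⟩
  by_contra hne
  obtain ⟨w, ⟨hw1, hw2⟩, hw⟩ := hn (subset_tsupport _ hne)
  obtain ⟨γ, rfl⟩ := exists_smul_of_proj_eq hw.symm
  rw [ModularGroup.im_smul_eq_div_normSq, ModularGroup.denom_apply] at hz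
  have hwp := w.im_pos
  by_cases hc : γ 1 0 = 0
  · have hdet := γ.det_coe
    rw [Matrix.det_fin_two, hc, mul_zero, sub_zero] at hdet
    have hd : γ 1 1 = 1 ∨ γ 1 1 = -1 :=
      Int.isUnit_iff.1 (IsUnit.of_mul_eq_one_right _ hdet)
    rcases hd with hd | hd <;> simp [hc, hd] at hz <;> linarith
  · have h1 : w.im ^ 2 ≤ Complex.normSq ((γ 1 0 : ℂ) * w + (γ 1 1 : ℂ)) := by
      have h2 : (1 : ℝ) ≤ (γ 1 0 : ℝ) ^ 2 := by
        have : 1 ≤ (γ 1 0) ^ 2 := (one_le_sq_iff_one_le_abs _).2 (Int.one_le_abs hc)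
        exact_mod_cast this
      rw [Complex.normSq_apply]
      simp
      nlinarith [sq_nonneg ((γ 1 0 : ℝ) * w.re + (γ 1 1 : ℝ)), sq_nonneg w.im]
    have h3 : w.im / Complex.normSq ((γ 1 0 : ℂ) * w + (γ 1 1 : ℂ)) ≤ w.im / w.im ^ 2 :=
      div_le_div_of_nonneg_left hwp.le (by positivity) h1
    have h4 : w.im / w.im ^ 2 = 1 / w.im := by field_simp
    have h5 : 1 / w.im < n + 1 := by
      rw [div_lt_iff₀ hwp]
      rw [div_lt_iff₀ (by positivity)] at hw1
      linarith
    linarith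

end AutomorphicHamiltonian

namespace AutomorphicHamiltonian

/-! ### The divergence theorem on the fundamental domain -/

theorem hasDerivAt_arcHeight {x : ℝ} (hx : x ∈ Set.Ioo (-1 : ℝ) 1) :
    HasDerivAt arcHeight (-(x / arcHeight x)) x := by
  have h0 : 0 < 1 - x ^ 2 := by nlinarith [hx.1, hx.2]
  have h1 : HasDerivAt (fun x : ℝ => 1 - x ^ 2) (-(2 * x)) x := by
    simpa using (hasDerivAt_pow 2 x).const_sub 1
  refine (h1.sqrt h0.ne').congr_deriv ?_
  have : √(1 - x ^ 2) ≠ 0 := (Real.sqrt_pos.2 h0).ne'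
  simp only [arcHeight]
  field_simp

theorem differentiableAt_slope {x : ℝ} (hx : x ∈ Set.Ioo (-1 : ℝ) 1) :
    DifferentiableAt ℝ (fun x => x / arcHeight x) x := by
  have h0 : 0 < 1 - x ^ 2 := by nlinarith [hx.1, hx.2]
  exact differentiableAt_id.div (hasDerivAt_arcHeight hx).differentiableAt
    (Real.sqrt_pos.2 h0).ne'

/-- The derivative of `chart`. -/
noncomputable def chartDeriv (p : ℝ × ℝ) : ℝ × ℝ →L[ℝ] ℂ :=
  (ContinuousLinearMap.fst ℝ ℝ ℝ).smulRight (1 - ((p.1 / arcHeight p.1 : ℝ) : ℂ) * Complex.I) +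
    (ContinuousLinearMap.snd ℝ ℝ ℝ).smulRight Complex.I

theorem hasFDerivAt_chart {p : ℝ × ℝ} (hp : p.1 ∈ Set.Ioo (-1 : ℝ) 1) :
    HasFDerivAt chart (chartDeriv p) p := by
  have h1 : HasFDerivAt (fun p : ℝ × ℝ => arcHeight p.1) _ p :=
    (hasDerivAt_arcHeight hp).hasFDerivAt.comp p hasFDerivAt_fst
  have h2 := (hasFDerivAt_fst (𝕜 := ℝ) (p := p)).smul_const (1 : ℂ)
  have h3 := (h1.add (hasFDerivAt_snd (𝕜 := ℝ) (p := p))).smul_const Complex.I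
  have h4 := h2.add h3
  refine (h4.congr_of_eventuallyEq (Eventually.of_forall fun p => ?_)).congr_fderiv ?_
  · apply Complex.ext <;> simp [chart]
  · ext <;> simp [chartDeriv, sub_eq_add_neg]

theorem chartDeriv_one_zero (p : ℝ × ℝ) :
    chartDeriv p (1, 0) = 1 - ((p.1 / arcHeight p.1 : ℝ) : ℂ) * Complex.I := by
  simp [chartDeriv]

theorem chartDeriv_zero_one (p : ℝ × ℝ) : chartDeriv p (0, 1) = Complex.I := by
  simp [chartDeriv]

theorem continuousOn_comp_chart {G : Type*} [TopologicalSpace G] {W : ℂ → G}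
    (hW : ContinuousOn W {w : ℂ | 0 < w.im}) : ContinuousOn (fun p => W (chart p)) strip :=
  hW.comp continuous_chart.continuousOn fun _ hp => chart_im_pos hp

theorem norm_chart_arc {x : ℝ} (hx : x ∈ Set.Icc (-(1 / 2) : ℝ) (1 / 2)) :
    ‖chart (x, 0)‖ = 1 := by
  have h1 : ‖chart (x, 0)‖ ^ 2 = 1 := by
    rw [← Complex.normSq_eq_norm_sq, Complex.normSq_apply, chart_re, chart_im]
    have := arcHeight_sq hx
    simp only
    nlinarith
  exact (pow_eq_one_iff_of_nonneg (norm_nonneg _) two_ne_zero).1 h1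

/-- The divergence theorem on the fundamental domain, for a vector field which is compatible with
the identifications of its sides. -/
theorem setIntegral_divergence_eq_zero {W₁ W₂ : ℂ → ℂ}
    (h₁ : ContDiffOn ℝ 1 W₁ {w : ℂ | 0 < w.im}) (h₂ : ContDiffOn ℝ 1 W₂ {w : ℂ | 0 < w.im})
    {M : ℝ} (hM0 : 0 ≤ M) (hM₁ : ∀ w : ℂ, M ≤ w.im → W₁ w = 0)
    (hM₂ : ∀ w : ℂ, M ≤ w.im → W₂ w = 0)
    (hper : ∀ w : ℂ, W₁ (w + 1) = W₁ w)
    (harc : ∀ w : ℂ, 0 < w.im → ‖w‖ = 1 →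
      -(w.re : ℂ) * W₁ (-conj w) + w.im * W₂ (-conj w) = -(w.re * W₁ w + w.im * W₂ w)) :
    ∫ p in strip, (fderiv ℝ W₁ (chart p) 1 + fderiv ℝ W₂ (chart p) Complex.I) = 0 := by
  have hopen : IsOpen {w : ℂ | 0 < w.im} := isOpen_upperHalfPlaneSet
  have hd₁ := h₁.continuousOn_fderiv_of_isOpen hopen le_rfl
  have hd₂ := h₂.continuousOn_fderiv_of_isOpen hopen le_rfl
  have hdiv : ContinuousOn
      (fun p => fderiv ℝ W₁ (chart p) 1 + fderiv ℝ W₂ (chart p) Complex.I) strip :=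
    continuousOn_comp_chart (W := fun w => fderiv ℝ W₁ w 1 + fderiv ℝ W₂ w Complex.I)
      ((hd₁.clm_apply continuousOn_const).add (hd₂.clm_apply continuousOn_const))
  have hfd0 : ∀ {W : ℂ → ℂ}, (∀ w : ℂ, M ≤ w.im → W w = 0) → ∀ w : ℂ, M + 1 ≤ w.im →
      fderiv ℝ W w = 0 := by
    intro W hW w hw
    have : W =ᶠ[𝓝 w] fun _ => 0 := by
      have h : ∀ᶠ z in 𝓝 w, M < z.im :=
        Complex.continuous_im.continuousAt.eventually_const_lt (by linarith)
      filter_upwards [h] with z hz using hW z hz.le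
    rw [this.fderiv_eq]
    simp
  -- At height `M + 1` a whole neighbourhood lies where the field vanishes, so its derivatives
  -- vanish too.
  rw [setIntegral_strip hdiv (M := M + 1) (by linarith)]
  swap
  · intro p _ hp
    have h3 : M + 1 ≤ (chart p).im := hp.trans le_chart_im
    rw [hfd0 hM₁ _ h3, hfd0 hM₂ _ h3]
    simp
  set k : ℝ → ℝ := fun x => x / arcHeight x with hk
  set f : ℝ × ℝ → ℂ := fun p => W₁ (chart p) with hf
  -- The chart maps ∂/∂x to 1 - k i and ∂/∂t to i. Adding k W₁ to the second component compensates
  -- the tilt, so the divergence of (f, g) in (x, t) is the divergence of (W₁, W₂) in the plane.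
  set g : ℝ × ℝ → ℂ := fun p => W₂ (chart p) + k p.1 • W₁ (chart p) with hg
  set f' : ℝ × ℝ → ℝ × ℝ →L[ℝ] ℂ := fun p => (fderiv ℝ W₁ (chart p)).comp (chartDeriv p) with hf'
  set g' : ℝ × ℝ → ℝ × ℝ →L[ℝ] ℂ := fun p => (fderiv ℝ W₂ (chart p)).comp (chartDeriv p) +
    (k p.1 • (fderiv ℝ W₁ (chart p)).comp (chartDeriv p) +
      ((fderiv ℝ k p.1).comp (ContinuousLinearMap.fst ℝ ℝ ℝ)).smulRight (W₁ (chart p))) with hg'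
  have hsub : Set.uIcc (-(1 / 2) : ℝ) (1 / 2) ×ˢ Set.uIcc 0 (M + 1) ⊆ strip := by
    rw [Set.uIcc_of_le (by norm_num), Set.uIcc_of_le (by linarith)]
    exact Set.prod_mono_right Set.Icc_subset_Ici_self
  have hsum : ∀ p, f' p (1, 0) + g' p (0, 1) =
      fderiv ℝ W₁ (chart p) 1 + fderiv ℝ W₂ (chart p) Complex.I := by
    intro p
    simp only [hf', hg', ContinuousLinearMap.comp_apply, add_apply, smul_apply,
      ContinuousLinearMap.smulRight_apply, chartDeriv_one_zero, chartDeriv_zero_one,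
      ContinuousLinearMap.coe_fst', map_zero, zero_smul, add_zero]
    rw [← Complex.real_smul, map_sub, map_smul]
    ring
  have hcf : ContinuousOn f strip := continuousOn_comp_chart h₁.continuousOn
  have hcg : ContinuousOn g strip := by
    refine (continuousOn_comp_chart h₂.continuousOn).add
      (ContinuousOn.smul (f := fun p : ℝ × ℝ => k p.1) ?_ hcf)
    intro p hp
    have hx : p.1 ∈ Set.Ioo (-1 : ℝ) 1 := ⟨by linarith [hp.1.1], by linarith [hp.1.2]⟩
    exact ((differentiableAt_slope hx).continuousAt.comp
      (f := Prod.fst) continuous_fst.continuousAt).continuousWithinAt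
  have hint : ∀ p ∈ Set.Ioo (min (-(1 / 2) : ℝ) (1 / 2)) (max (-(1 / 2) : ℝ) (1 / 2)) ×ˢ
      Set.Ioo (min 0 (M + 1)) (max 0 (M + 1)), p.1 ∈ Set.Ioo (-1 : ℝ) 1 ∧ 0 < (chart p).im := by
    rintro p ⟨hp1, hp2⟩
    rw [min_eq_left (by norm_num), max_eq_right (by norm_num)] at hp1
    rw [min_eq_left (by linarith), max_eq_right (by linarith)] at hp2
    exact ⟨⟨by linarith [hp1.1], by linarith [hp1.2]⟩,
      chart_im_pos ⟨⟨hp1.1.le, hp1.2.le⟩, hp2.1.le⟩⟩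
  have hW : ∀ {W : ℂ → ℂ}, ContDiffOn ℝ 1 W {w : ℂ | 0 < w.im} → ∀ {p : ℝ × ℝ},
      p.1 ∈ Set.Ioo (-1 : ℝ) 1 → 0 < (chart p).im →
      HasFDerivAt (fun p => W (chart p)) ((fderiv ℝ W (chart p)).comp (chartDeriv p)) p := by
    intro W hW p hp1 hp2
    exact (((hW.contDiffAt (hopen.mem_nhds hp2)).differentiableAt
      one_ne_zero).hasFDerivAt).comp p (hasFDerivAt_chart hp1)
  have key := integral2_divergence_prod_of_hasFDerivAt f g f' g' (-(1 / 2)) 0 (1 / 2) (M + 1)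
    (hcf.mono hsub) (hcg.mono hsub)
    (fun p hp => hW h₁ (hint p hp).1 (hint p hp).2)
    (fun p hp => by
      have h5 := hint p hp
      have h6 : HasFDerivAt (fun p : ℝ × ℝ => k p.1)
          ((fderiv ℝ k p.1).comp (ContinuousLinearMap.fst ℝ ℝ ℝ)) p :=
        (differentiableAt_slope h5.1).hasFDerivAt.comp p hasFDerivAt_fst
      exact (hW h₂ h5.1 h5.2).add (h6.smul (hW h₁ h5.1 h5.2)))
    (by
      simp only [hsum]
      exact (hdiv.mono hsub).integrableOn_compact (isCompact_uIcc.prod isCompact_uIcc))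
  simp only [hsum] at key
  rw [key]
  have b1 : ∀ x, g (x, M + 1) = 0 := by
    intro x
    have : M ≤ (chart (x, M + 1)).im :=
      le_trans (by simp) (le_chart_im (p := (x, M + 1)))
    simp only [hg]
    rw [hM₁ _ this, hM₂ _ this]
    simp
  have b2 : ∀ t, f (1 / 2, t) = f (-(1 / 2), t) := by
    intro t
    simp only [hf]
    rw [← hper (chart (-(1 / 2), t))]
    congr 1
    apply Complex.ext
    · simp [chart]; norm_num
    · simp [chart, arcHeight]
  have b3 : ∫ x in (-(1 / 2) : ℝ)..(1 / 2), g (x, 0) = 0 := by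
    -- The flux density through the arc is (x W₁ + y W₂)/y. The reflection x ↦ -x is the side
    -- pairing w ↦ -1/w on the unit circle, under which `harc` makes this density odd.
    have h7 : ∀ x ∈ Set.uIcc (-(1 / 2) : ℝ) (1 / 2), g (-x, 0) = -g (x, 0) := by
      intro x hx
      rw [Set.uIcc_of_le (by norm_num)] at hx
      have h8 := harc (chart (x, 0)) (chart_im_pos ⟨hx, le_refl (0 : ℝ)⟩) (norm_chart_arc hx)
      have h9 : chart (-x, 0) = -conj (chart (x, 0)) := by
        apply Complex.ext <;> simp [chart, arcHeight]
      have h10 : arcHeight (-x) = arcHeight x := by simp [arcHeight]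
      have h11 : (arcHeight x : ℂ) ≠ 0 := by
        have := half_lt_arcHeight hx
        exact_mod_cast (by linarith : (0 : ℝ) < arcHeight x).ne'
      simp only [hg, hk, h9, h10, Complex.real_smul]
      rw [chart_im] at h8
      simp only [chart_re, add_zero] at h8
      push_cast
      field_simp
      linear_combination h8
    have h12 := intervalIntegral.integral_comp_neg (fun x => g (x, 0)) (a := -(1 / 2))
      (b := (1 / 2 : ℝ))
    rw [intervalIntegral.integral_congr h7, intervalIntegral.integral_neg, neg_neg] at h12
    exact self_eq_neg.1 h12.symm
  simp only [b1, b2, b3, intervalIntegral.integral_zero]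
  simp

end AutomorphicHamiltonian

namespace AutomorphicHamiltonian

/-! ### Green's formula -/

theorem lift_add_one {F : Type} (f : ModularCurve → F) (w : ℂ) : lift f (w + 1) = lift f w := by
  by_cases hw : 0 < w.im
  · set z : ℍ := ⟨w, hw⟩ with hz
    have h1 : w + 1 = ((ModularGroup.T • z : ℍ) : ℂ) := by
      have := ModularGroup.coe_T_zpow_smul_eq (z := z) (n := 1)
      simpa using this.symm
    have h2 : w = (z : ℂ) := rfl
    rw [h1, h2, lift_coe, lift_coe, proj_smul]
  · have h1 : ofComplex w = _ := ofComplex_apply_of_im_nonpos (not_lt.1 hw)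
    have h2 : ofComplex (w + 1) = _ := ofComplex_apply_of_im_nonpos (by simpa using hw)
    simp only [lift, h1, h2]

theorem lift_neg_inv {F : Type} (f : ModularCurve → F) {w : ℂ} (hw : 0 < w.im) :
    lift f (-w⁻¹) = lift f w := by
  set z : ℍ := ⟨w, hw⟩ with hz
  have h1 : -w⁻¹ = ((ModularGroup.S • z : ℍ) : ℂ) := by
    rw [modular_S_smul]
    simp [hz]
  have h2 : w = (z : ℂ) := rfl
  rw [h1, h2, lift_coe, lift_coe, proj_smul]

theorem fderiv_lift_add_one (f : ModularCurve → ℂ) (w : ℂ) :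
    fderiv ℝ (lift f) (w + 1) = fderiv ℝ (lift f) w := by
  rw [← fderiv_comp_add_right]
  congr 1
  funext z
  exact lift_add_one f z

theorem isOpen_im_pos : IsOpen {w : ℂ | 0 < w.im} := isOpen_upperHalfPlaneSet

theorem IsSmooth.differentiableAt {f : ModularCurve → ℂ} (hf : IsSmooth f) {w : ℂ}
    (hw : 0 < w.im) : DifferentiableAt ℝ (lift f) w :=
  (ContDiffOn.contDiffAt hf (isOpen_im_pos.mem_nhds hw)).differentiableAt (by simp)

theorem IsSmooth.contDiffOn_fderiv {f : ModularCurve → ℂ} (hf : IsSmooth f) :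
    ContDiffOn ℝ 1 (fderiv ℝ (lift f)) {w : ℂ | 0 < w.im} :=
  (ContDiffOn.of_le hf two_le_infty).fderiv_of_isOpen isOpen_im_pos (by norm_num)

theorem neg_inv_of_norm_one {w : ℂ} (hw : ‖w‖ = 1) : -w⁻¹ = -conj w := by
  rw [Complex.inv_def, Complex.normSq_eq_norm_sq, hw]
  simp

/-- On the unit circle, the radial derivative of an invariant function is odd. -/
theorem fderiv_lift_radial {f : ModularCurve → ℂ} (hf : IsSmooth f) {w : ℂ} (hw : 0 < w.im)
    (hw1 : ‖w‖ = 1) :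
    fderiv ℝ (lift f) (-conj w) (-conj w) = -fderiv ℝ (lift f) w w := by
  have hw0 : w ≠ 0 := by
    rintro rfl
    simp at hw
  have h1 : HasFDerivAt (fun w : ℂ => -w⁻¹)
      ((ContinuousLinearMap.toSpanSingleton ℂ ((w ^ 2)⁻¹)).restrictScalars ℝ) w := by
    have := (hasDerivAt_inv hw0).neg
    rw [neg_neg] at this
    exact this.hasFDerivAt.restrictScalars ℝ
  have hpos : 0 < (-conj w).im := by simpa using hw
  have h2 : HasFDerivAt (lift f) (fderiv ℝ (lift f) (-conj w)) (-w⁻¹) := by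
    rw [neg_inv_of_norm_one hw1]
    exact (hf.differentiableAt hpos).hasFDerivAt
  have h3 := h2.comp w h1
  have h4 : lift f ∘ (fun w : ℂ => -w⁻¹) =ᶠ[𝓝 w] lift f := by
    filter_upwards [isOpen_im_pos.mem_nhds hw] with z hz using lift_neg_inv f hz
  have h5 := h3.congr_of_eventuallyEq h4.symm
  rw [h5.fderiv]
  -- The map -1/w has derivative w⁻², which sends the radial vector w to conj w, the opposite of the
  -- radial vector at the image point -conj w.
  have h6 : w * (w ^ 2)⁻¹ = conj w := by
    have := neg_inv_of_norm_one hw1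
    rw [neg_inj] at this
    rw [← this]
    field_simp
  simp [h6]

/-- The hermitian product of the gradients of the lifts of two functions. -/
noncomputable def gradInner (g f : ModularCurve → ℂ) (w : ℂ) : ℂ :=
  conj (fderiv ℝ (lift g) w 1) * fderiv ℝ (lift f) w 1 +
    conj (fderiv ℝ (lift g) w Complex.I) * fderiv ℝ (lift f) w Complex.I

theorem lift_eq_zero_of_height {f : ModularCurve → ℂ} {M : ℝ} (hM0 : 0 < M)
    (hM : ∀ z : ℍ, M ≤ z.im → f (proj z) = 0) {w : ℂ} (hw : M ≤ w.im) : lift f w = 0 :=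
  (lift_coe f ⟨w, hM0.trans_le hw⟩).trans (hM _ hw)

/-- The integrand is the divergence of conj(g) ∇f. This field has period 1, and its flux through the
arc is odd because g is invariant and the radial derivative of f is odd. It vanishes high in the
cusp because g does. -/
theorem setIntegral_green {f g : ModularCurve → ℂ} (hf : IsSmooth f) (hg : IsSmooth g) {M : ℝ}
    (hM0 : 0 < M) (hM : ∀ z : ℍ, M ≤ z.im → g (proj z) = 0) :
    ∫ p in strip, (conj (lift g (chart p)) * (Δ (lift f)) (chart p) + gradInner g f (chart p))
      = 0 := by
  have hG : ∀ w : ℂ, M ≤ w.im → lift g w = 0 := fun w hw => lift_eq_zero_of_height hM0 hM hw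
  have hW : ∀ v : ℂ, ContDiffOn ℝ 1 (fun w => conj (lift g w) * fderiv ℝ (lift f) w v)
      {w : ℂ | 0 < w.im} := fun v => by
    refine ContDiffOn.mul ?_ (hf.contDiffOn_fderiv.clm_apply contDiffOn_const)
    exact Complex.conjCLE.contDiff.comp_contDiffOn
      (ContDiffOn.of_le hg (one_le_two.trans two_le_infty))
  have key := setIntegral_divergence_eq_zero (hW 1) (hW Complex.I) hM0.le
    (fun w hw => by simp [hG w hw]) (fun w hw => by simp [hG w hw])
    (fun w => by rw [lift_add_one, fderiv_lift_add_one])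
    (fun w hw hw1 => by
      have h1 := fderiv_lift_radial hf hw hw1
      have h2 : lift g (-conj w) = lift g w := by
        rw [← neg_inv_of_norm_one hw1, lift_neg_inv g hw]
      have h3 : ∀ z v : ℂ, fderiv ℝ (lift f) z v =
          v.re * fderiv ℝ (lift f) z 1 + v.im * fderiv ℝ (lift f) z Complex.I := by
        intro z v
        conv_lhs => rw [show v = v.re • (1 : ℂ) + v.im • Complex.I by
          apply Complex.ext <;> simp]
        rw [map_add, map_smul, map_smul, Complex.real_smul, Complex.real_smul]
      rw [h3 _ (-conj w), h3 _ w] at h1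
      simp only [Complex.neg_re, Complex.conj_re, Complex.neg_im, Complex.conj_im, neg_neg,
        Complex.ofReal_neg] at h1
      rw [h2]
      linear_combination conj (lift g w) * h1)
  rw [← key]
  refine setIntegral_congr_fun measurableSet_strip fun p hp => ?_
  have hp' := chart_im_pos hp
  set w := chart p with hw
  have hd : DifferentiableAt ℝ (fderiv ℝ (lift f)) w :=
    (hf.contDiffOn_fderiv.contDiffAt (isOpen_im_pos.mem_nhds hp')).differentiableAt one_ne_zero
  have hgd := hg.differentiableAt hp'
  have h4 : ∀ v : ℂ, fderiv ℝ (fun w => conj (lift g w) * fderiv ℝ (lift f) w v) w v =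
      conj (lift g w) * fderiv ℝ (fderiv ℝ (lift f)) w v v +
        conj (fderiv ℝ (lift g) w v) * fderiv ℝ (lift f) w v := by
    intro v
    have h5 : HasFDerivAt (fun w => conj (lift g w)) _ w :=
      Complex.conjCLE.toContinuousLinearMap.hasFDerivAt.comp w hgd.hasFDerivAt
    have h6 := hd.hasFDerivAt.clm_apply (hasFDerivAt_const v w)
    rw [HasFDerivAt.fderiv (f := fun w => conj (lift g w) * fderiv ℝ (lift f) w v) (h5.mul h6)]
    simp
    ring
  simp only [h4, InnerProductSpace.laplacian_eq_iteratedFDeriv_complexPlane, gradInner,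
    iteratedFDeriv_two_apply, Matrix.cons_val_zero, Matrix.cons_val_one]
  ring

/-! ### The form of the Hamiltonian on test functions -/

theorem TestFn.continuousOn_lift (f : TestFn) :
    ContinuousOn (lift (f : ModularCurve → ℂ)) {w : ℂ | 0 < w.im} := f.2.1.continuousOn

theorem TestFn.exists_lift_eq_zero (f : TestFn) : ∃ M : ℝ, 0 < M ∧
    ∀ w : ℂ, M ≤ w.im → lift (f : ModularCurve → ℂ) w = 0 := by
  obtain ⟨M, hM0, hM⟩ := TestFn.exists_height f
  exact ⟨M, hM0, fun w hw => lift_eq_zero_of_height hM0 hM hw⟩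

theorem continuousOn_inv_chart_im_sq :
    ContinuousOn (fun p : ℝ × ℝ => ((chart p).im ^ 2)⁻¹) strip := by
  refine ContinuousOn.inv₀ ?_ fun p hp => (pow_pos (chart_im_pos hp) 2).ne'
  exact ((Complex.continuous_im.comp continuous_chart).pow 2).continuousOn

theorem inner_toL2 (g h : TestFn) : ⟪toL2 g, toL2 h⟫_ℂ =
    ∫ p in strip, ((chart p).im ^ 2)⁻¹ • (conj (lift (g : ModularCurve → ℂ) (chart p)) *
      lift (h : ModularCurve → ℂ) (chart p)) := by
  have h1 : ⟪toL2 g, toL2 h⟫_ℂ = ∫ p, conj ((g : ModularCurve → ℂ) p) *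
      (h : ModularCurve → ℂ) p ∂modularMeasure := by
    rw [L2.inner_def]
    refine integral_congr_ae ?_
    filter_upwards [(TestFn.memLp g).coeFn_toLp, (TestFn.memLp h).coeFn_toLp] with p hp1 hp2
    have e1 : (toL2 g : ModularCurve → ℂ) p = (g : ModularCurve → ℂ) p := hp1
    have e2 : (toL2 h : ModularCurve → ℂ) p = (h : ModularCurve → ℂ) p := hp2
    rw [e1, e2, RCLike.inner_apply, mul_comm]
  rw [h1, integral_modularMeasure]
  · rfl
  · exact (Complex.continuous_conj.comp_aestronglyMeasurable (TestFn.memLp g).1).mul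
      (TestFn.memLp h).1

theorem continuousOn_gradInner {f g : ModularCurve → ℂ} (hf : IsSmooth f) (hg : IsSmooth g) :
    ContinuousOn (gradInner g f) {w : ℂ | 0 < w.im} := by
  have h1 := hf.contDiffOn_fderiv.continuousOn
  have h2 := hg.contDiffOn_fderiv.continuousOn
  have h3 : ∀ v : ℂ, ContinuousOn
      (fun w => conj (fderiv ℝ (lift g) w v) * fderiv ℝ (lift f) w v) {w : ℂ | 0 < w.im} :=
    fun v => (Complex.continuous_conj.comp_continuousOn (h2.clm_apply continuousOn_const)).mul
      (h1.clm_apply continuousOn_const)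
  exact (h3 1).add (h3 Complex.I)

theorem fderiv_eq_zero_of_height {F : ℂ → ℂ} {M : ℝ} (hM : ∀ w : ℂ, M ≤ w.im → F w = 0) {w : ℂ}
    (hw : M < w.im) : fderiv ℝ F w = 0 := by
  have : F =ᶠ[𝓝 w] fun _ => 0 := by
    have h : ∀ᶠ z in 𝓝 w, M < z.im := Complex.continuous_im.continuousAt.eventually_const_lt hw
    filter_upwards [h] with z hz using hM z hz.le
  rw [this.fderiv_eq]
  simp

theorem integrableOn_gradInner {f g : ModularCurve → ℂ} (hf : IsSmooth f) (hg : IsSmooth g) {M : ℝ}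
    (hM : ∀ w : ℂ, M ≤ w.im → lift g w = 0) :
    IntegrableOn (fun p => gradInner g f (chart p)) strip := by
  refine integrableOn_strip (continuousOn_comp_chart (continuousOn_gradInner hf hg)) (M := M + 1)
    fun p _ hp => ?_
  have h3 : M < (chart p).im := by linarith [le_chart_im (p := p)]
  simp only [gradInner]
  rw [fderiv_eq_zero_of_height hM h3]
  simp

/-- The y² of the invariant Laplacian cancels the y⁻² of the measure, leaving an unweighted
Dirichlet form: the conformal invariance of the Dirichlet integral in dimension two. -/
theorem inner_hamiltonian (q : ModularCurve → ℝ) (hq : IsSmooth q) (g f : TestFn) :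
    ⟪toL2 g, toL2 (hamiltonian q hq f)⟫_ℂ =
    ∫ p in strip, (gradInner g f (chart p) + (((chart p).im ^ 2)⁻¹ * lift q (chart p)) •
      (conj (lift (g : ModularCurve → ℂ) (chart p)) * lift (f : ModularCurve → ℂ) (chart p))) := by
  obtain ⟨M, hM0, hM⟩ := TestFn.exists_height g
  have hG : ∀ w : ℂ, M ≤ w.im → lift (g : ModularCurve → ℂ) w = 0 :=
    fun w hw => lift_eq_zero_of_height hM0 hM hw
  have hgreen := setIntegral_green f.2.1 g.2.1 hM0 hM
  have hgc := TestFn.continuousOn_lift g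
  have hfc := TestFn.continuousOn_lift f
  have hqc : ContinuousOn (lift q) {w : ℂ | 0 < w.im} := ContDiffOn.continuousOn hq
  have hlap : ContinuousOn (Δ (lift (f : ModularCurve → ℂ))) {w : ℂ | 0 < w.im} := by
    have h1 := (isSmooth_hypLaplacian f.2.1).continuousOn
    have h2 : ContinuousOn (fun w : ℂ => (((w.im : ℝ) : ℂ) ^ 2)⁻¹ *
        lift (hypLaplacian (f : ModularCurve → ℂ)) w) {w : ℂ | 0 < w.im} := by
      refine ContinuousOn.mul (ContinuousOn.inv₀ ?_ ?_) h1
      · exact ((Complex.continuous_ofReal.comp Complex.continuous_im).pow 2).continuousOn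
      · intro w hw
        exact pow_ne_zero 2 (Complex.ofReal_ne_zero.2 (ne_of_gt hw))
    refine h2.congr fun w hw => ?_
    have h3 := hypLaplacian_proj f.2.1 ⟨w, hw⟩
    rw [← lift_coe (hypLaplacian (f : ModularCurve → ℂ))] at h3
    have h4 : (((w.im : ℝ) : ℂ) ^ 2) ≠ 0 := pow_ne_zero 2 (Complex.ofReal_ne_zero.2 (ne_of_gt hw))
    rw [eq_inv_mul_iff_mul_eq₀ h4]
    exact h3.symm
  have hi1 : IntegrableOn (fun p => conj (lift (g : ModularCurve → ℂ) (chart p)) *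
      (Δ (lift (f : ModularCurve → ℂ))) (chart p) + gradInner g f (chart p)) strip := by
    refine (integrableOn_strip (M := M) (continuousOn_comp_chart
      (W := fun w => conj (lift (g : ModularCurve → ℂ) w) *
        (Δ (lift (f : ModularCurve → ℂ))) w) ?_) ?_).add (integrableOn_gradInner f.2.1 g.2.1 hG)
    · exact (Complex.continuous_conj.comp_continuousOn hgc).mul hlap
    · intro p _ hp
      rw [hG _ (hp.trans le_chart_im)]
      simp
  have hi2 : IntegrableOn (fun p => ((chart p).im ^ 2)⁻¹ •
      (conj (lift (g : ModularCurve → ℂ) (chart p)) *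
        lift (hamiltonian q hq f : ModularCurve → ℂ) (chart p))) strip := by
    refine integrableOn_strip (M := M) (continuousOn_inv_chart_im_sq.smul (continuousOn_comp_chart
      (W := fun w => conj (lift (g : ModularCurve → ℂ) w) *
        lift (hamiltonian q hq f : ModularCurve → ℂ) w) ?_)) ?_
    · exact (Complex.continuous_conj.comp_continuousOn hgc).mul (TestFn.continuousOn_lift _)
    · intro p _ hp
      rw [hG _ (hp.trans le_chart_im)]
      simp
  rw [inner_toL2, ← add_zero (∫ p in strip, _), ← hgreen, ← integral_add hi2 hi1]
  refine setIntegral_congr_fun measurableSet_strip fun p hp => ?_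
  have hp' := chart_im_pos hp
  have h5 : lift (hamiltonian q hq f : ModularCurve → ℂ) (chart p) =
      -(((chart p).im : ℂ) ^ 2 * (Δ (lift (f : ModularCurve → ℂ))) (chart p)) +
        ((lift q (chart p) : ℝ) : ℂ) * lift (f : ModularCurve → ℂ) (chart p) := by
    have h3 := hypLaplacian_proj f.2.1 ⟨chart p, hp'⟩
    rw [← lift_coe (hypLaplacian (f : ModularCurve → ℂ))] at h3
    exact congrArg (fun u => -u + ((lift q (chart p) : ℝ) : ℂ) * lift (f : ModularCurve → ℂ) (chart p)) h3
  have h6 : ((chart p).im : ℂ) ≠ 0 := Complex.ofReal_ne_zero.2 hp'.ne'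
  simp only [h5, Complex.real_smul]
  push_cast
  field_simp
  ring

theorem gradInner_conj (g f : ModularCurve → ℂ) (w : ℂ) :
    conj (gradInner g f w) = gradInner f g w := by
  simp only [gradInner, map_add, map_mul, Complex.conj_conj]
  ring

theorem inner_hamiltonian_symm (q : ModularCurve → ℝ) (hq : IsSmooth q) (g f : TestFn) :
    ⟪toL2 (hamiltonian q hq g), toL2 f⟫_ℂ = ⟪toL2 g, toL2 (hamiltonian q hq f)⟫_ℂ := by
  rw [← inner_conj_symm, inner_hamiltonian, inner_hamiltonian, ← integral_conj]
  refine integral_congr_ae (ae_of_all _ fun p => ?_)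
  simp only [map_add, gradInner_conj, Complex.real_smul, map_mul, Complex.conj_ofReal,
    Complex.conj_conj]
  ring

/-- The square of the length of the gradient of the lift of a function. -/
noncomputable def gradSq (f : ModularCurve → ℂ) (w : ℂ) : ℝ :=
  ‖fderiv ℝ (lift f) w 1‖ ^ 2 + ‖fderiv ℝ (lift f) w Complex.I‖ ^ 2

theorem gradInner_self (f : ModularCurve → ℂ) (w : ℂ) : gradInner f f w = (gradSq f w : ℂ) := by
  simp only [gradInner, gradSq, ← Complex.normSq_eq_conj_mul_self, Complex.normSq_eq_norm_sq]
  push_cast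
  rfl

theorem norm_sq_toL2 (f : TestFn) : ‖toL2 f‖ ^ 2 =
    ∫ p in strip, ((chart p).im ^ 2)⁻¹ * ‖lift (f : ModularCurve → ℂ) (chart p)‖ ^ 2 := by
  have h1 := inner_toL2 f f
  rw [inner_self_eq_norm_sq_to_K] at h1
  have h2 : ∀ p, ((chart p).im ^ 2)⁻¹ • (conj (lift (f : ModularCurve → ℂ) (chart p)) *
      lift (f : ModularCurve → ℂ) (chart p)) =
      ((((chart p).im ^ 2)⁻¹ * ‖lift (f : ModularCurve → ℂ) (chart p)‖ ^ 2 : ℝ) : ℂ) := by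
    intro p
    rw [← Complex.normSq_eq_conj_mul_self, Complex.normSq_eq_norm_sq, Complex.real_smul,
      Complex.ofReal_mul]
  simp only [h2] at h1
  rw [integral_complex_ofReal] at h1
  exact Complex.ofReal_injective (by rw [← h1]; simp)

theorem re_inner_hamiltonian (q : ModularCurve → ℝ) (hq : IsSmooth q) (f : TestFn) :
    (⟪toL2 (hamiltonian q hq f), toL2 f⟫_ℂ).re =
    ∫ p in strip, (gradSq f (chart p) + ((chart p).im ^ 2)⁻¹ * lift q (chart p) *
      ‖lift (f : ModularCurve → ℂ) (chart p)‖ ^ 2) := by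
  rw [inner_hamiltonian_symm, inner_hamiltonian]
  have h2 : ∀ p, gradInner f f (chart p) + (((chart p).im ^ 2)⁻¹ * lift q (chart p)) •
      (conj (lift (f : ModularCurve → ℂ) (chart p)) * lift (f : ModularCurve → ℂ) (chart p)) =
      ((gradSq f (chart p) + ((chart p).im ^ 2)⁻¹ * lift q (chart p) *
      ‖lift (f : ModularCurve → ℂ) (chart p)‖ ^ 2 : ℝ) : ℂ) := by
    intro p
    rw [← Complex.normSq_eq_conj_mul_self, Complex.normSq_eq_norm_sq, Complex.real_smul,
      gradInner_self]
    push_cast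
    ring
  simp only [h2]
  rw [integral_complex_ofReal, Complex.ofReal_re]

end AutomorphicHamiltonian

namespace AutomorphicHamiltonian

/-! ### One-dimensional inequalities -/

section OneDim

variable {v v' : ℝ → ℂ} (hv : Continuous v) (hv' : Continuous v') {a b : ℝ} (hab : a ≤ b)
  (hd : ∀ t ∈ Set.Ioo a b, HasDerivAt v (v' t) t)

include hv hv' hab hd

/-- The derivative of ‖v‖² is integrated from `a` to `b`, and 2 ‖v‖ ‖v'‖ ≤ ‖v‖² + ‖v'‖². -/
theorem norm_sq_left_le (hb : v b = 0) :
    ‖v a‖ ^ 2 ≤ ∫ t in a..b, (‖v t‖ ^ 2 + ‖v' t‖ ^ 2) := by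
  have h1 := intervalIntegral.integral_eq_sub_of_hasDerivAt_of_le hab
    (f := fun t => ‖v t‖ ^ 2) (f' := fun t => 2 * inner ℝ (v t) (v' t))
    (by fun_prop) (fun t ht => (hd t ht).norm_sq) (Continuous.intervalIntegrable (by fun_prop) _ _)
  rw [hb] at h1
  have h2 : ‖v a‖ ^ 2 = ∫ t in a..b, -(2 * inner ℝ (v t) (v' t)) := by
    rw [intervalIntegral.integral_neg, h1]
    simp
  rw [h2]
  refine intervalIntegral.integral_mono_on hab (Continuous.intervalIntegrable (by fun_prop) _ _)
    (Continuous.intervalIntegrable (by fun_prop) _ _) fun t _ => ?_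
  have h3 := neg_le_of_abs_le (abs_real_inner_le_norm (v t) (v' t))
  nlinarith [sq_nonneg (‖v t‖ - ‖v' t‖)]

/-- The derivative of (t - a) ‖v‖² is integrated; the weight removes the boundary term at `a`. This
yields both the trace bound `norm_sq_right_le` and the Poincaré inequality `integral_norm_sq_le`. -/
theorem mul_norm_sq_right_eq : (b - a) * ‖v b‖ ^ 2 =
    ∫ t in a..b, (‖v t‖ ^ 2 + (t - a) * (2 * inner ℝ (v t) (v' t))) := by
  have h1 := intervalIntegral.integral_eq_sub_of_hasDerivAt_of_le hab
    (f := fun t => (t - a) * ‖v t‖ ^ 2)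
    (f' := fun t => 1 * ‖v t‖ ^ 2 + (t - a) * (2 * inner ℝ (v t) (v' t)))
    (by fun_prop) (fun t ht => ((hasDerivAt_id t).sub_const a).mul (hd t ht).norm_sq)
    (Continuous.intervalIntegrable (by fun_prop) _ _)
  simp only [one_mul, sub_self, zero_mul, sub_zero] at h1
  exact h1.symm

theorem norm_sq_right_le (h1 : b - a = 1) :
    ‖v b‖ ^ 2 ≤ ∫ t in a..b, (2 * ‖v t‖ ^ 2 + ‖v' t‖ ^ 2) := by
  have h2 := mul_norm_sq_right_eq hv hv' hab hd
  rw [h1, one_mul] at h2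
  rw [h2]
  refine intervalIntegral.integral_mono_on hab (Continuous.intervalIntegrable (by fun_prop) _ _)
    (Continuous.intervalIntegrable (by fun_prop) _ _) fun t ht => ?_
  have h3 := real_inner_le_norm (v t) (v' t)
  have h4 : 0 ≤ t - a := by linarith [ht.1]
  have h5 : t - a ≤ 1 := by linarith [ht.2]
  have h6 : (t - a) * (2 * inner ℝ (v t) (v' t)) ≤ 2 * (‖v t‖ * ‖v' t‖) := by
    have h7 : (t - a) * (2 * inner ℝ (v t) (v' t)) ≤ (t - a) * (2 * (‖v t‖ * ‖v' t‖)) :=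
      mul_le_mul_of_nonneg_left (by linarith) h4
    have h8 : 0 ≤ 2 * (‖v t‖ * ‖v' t‖) := by positivity
    nlinarith
  nlinarith [sq_nonneg (‖v t‖ - ‖v' t‖)]

theorem integral_norm_sq_le : ∫ t in a..b, ‖v t‖ ^ 2 ≤
    2 * (b - a) * ‖v b‖ ^ 2 + 4 * (b - a) ^ 2 * ∫ t in a..b, ‖v' t‖ ^ 2 := by
  have h2 := mul_norm_sq_right_eq hv hv' hab hd
  have h3 : ∫ t in a..b, ‖v t‖ ^ 2 ≤ ∫ t in a..b,
      (2 * (‖v t‖ ^ 2 + (t - a) * (2 * inner ℝ (v t) (v' t))) + 4 * (b - a) ^ 2 * ‖v' t‖ ^ 2) := by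
    refine intervalIntegral.integral_mono_on hab (Continuous.intervalIntegrable (by fun_prop) _ _)
      (Continuous.intervalIntegrable (by fun_prop) _ _) fun t ht => ?_
    have h3 := neg_le_of_abs_le (abs_real_inner_le_norm (v t) (v' t))
    have h4 : 0 ≤ t - a := by linarith [ht.1]
    have h5 : t - a ≤ b - a := by linarith [ht.2]
    have h6 : -((b - a) * (‖v t‖ * ‖v' t‖)) ≤ (t - a) * inner ℝ (v t) (v' t) := by
      have h7 : (t - a) * -(‖v t‖ * ‖v' t‖) ≤ (t - a) * inner ℝ (v t) (v' t) :=
        mul_le_mul_of_nonneg_left h3 h4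
      have h8 : 0 ≤ ‖v t‖ * ‖v' t‖ := by positivity
      nlinarith
    -- The constants 2 and 4 make the difference of the two sides at least this square.
    nlinarith [sq_nonneg (‖v t‖ - 2 * (b - a) * ‖v' t‖)]
  rw [intervalIntegral.integral_add (Continuous.intervalIntegrable (by fun_prop) _ _)
    (Continuous.intervalIntegrable (by fun_prop) _ _), intervalIntegral.integral_const_mul,
    intervalIntegral.integral_const_mul, ← h2] at h3
  linarith

end OneDim

/-- The Cauchy-Schwarz inequality for continuous functions on an interval. -/
theorem norm_integral_mul_sq_le {v w : ℝ → ℂ} (hv : Continuous v) (hw : Continuous w) {a b : ℝ}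
    (hab : a ≤ b) : ‖∫ t in a..b, v t * w t‖ ^ 2 ≤
      (∫ t in a..b, ‖v t‖ ^ 2) * ∫ t in a..b, ‖w t‖ ^ 2 := by
  have hquad : ∀ s : ℝ, 0 ≤ (∫ t in a..b, ‖v t‖ ^ 2) * (s * s) +
      (-2 * ∫ t in a..b, ‖v t‖ * ‖w t‖) * s + ∫ t in a..b, ‖w t‖ ^ 2 := by
    intro s
    have h1 : ∫ t in a..b, (s * ‖v t‖ - ‖w t‖) ^ 2 = (∫ t in a..b, ‖v t‖ ^ 2) * (s * s) +
      (-2 * ∫ t in a..b, ‖v t‖ * ‖w t‖) * s + ∫ t in a..b, ‖w t‖ ^ 2 := by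
      have h2 : ∀ t, (s * ‖v t‖ - ‖w t‖) ^ 2 =
          ((s * s) * ‖v t‖ ^ 2 + (-2 * s) * (‖v t‖ * ‖w t‖)) + ‖w t‖ ^ 2 := fun t => by ring
      simp only [h2]
      rw [intervalIntegral.integral_add (Continuous.intervalIntegrable (by fun_prop) _ _)
        (Continuous.intervalIntegrable (by fun_prop) _ _),
        intervalIntegral.integral_add (Continuous.intervalIntegrable (by fun_prop) _ _)
        (Continuous.intervalIntegrable (by fun_prop) _ _), intervalIntegral.integral_const_mul,
        intervalIntegral.integral_const_mul]
      ring
    rw [← h1]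
    exact intervalIntegral.integral_nonneg hab fun t _ => sq_nonneg _
  have h3 := discrim_le_zero hquad
  rw [discrim] at h3
  have h4 : ‖∫ t in a..b, v t * w t‖ ≤ ∫ t in a..b, ‖v t‖ * ‖w t‖ := by
    refine (intervalIntegral.norm_integral_le_integral_norm hab).trans (le_of_eq ?_)
    simp only [norm_mul]
  have h5 := pow_le_pow_left₀ (norm_nonneg _) h4 2
  linarith

/-! ### Functions on the half-strip -/

/-- The retraction of the plane onto the half-strip. -/
noncomputable def clamp (p : ℝ × ℝ) : ℝ × ℝ := (max (-(1 / 2)) (min p.1 (1 / 2)), max p.2 0)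

theorem continuous_clamp : Continuous clamp := by unfold clamp; fun_prop

theorem clamp_mem (p : ℝ × ℝ) : clamp p ∈ strip :=
  ⟨⟨le_max_left _ _, max_le (by norm_num) (min_le_right _ _)⟩, le_max_right p.2 0⟩

theorem clamp_eq {p : ℝ × ℝ} (hp : p ∈ strip) : clamp p = p := by
  have h1 : min p.1 (1 / 2) = p.1 := min_eq_left hp.1.2
  have h2 : max (-(1 / 2)) p.1 = p.1 := max_eq_right hp.1.1
  have h3 : max p.2 0 = p.2 := max_eq_left hp.2
  simp only [clamp, h1, h2, h3]

/-- Composition with the retraction makes every function in play continuous on the whole plane,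
which settles integrability on segments. Derivatives are only needed in the open strip, where
nothing changes. -/
theorem continuous_comp_clamp {G : Type*} [TopologicalSpace G] {Φ : ℝ × ℝ → G}
    (h : ContinuousOn Φ strip) : Continuous fun p => Φ (clamp p) :=
  h.comp_continuous continuous_clamp clamp_mem

/-- The value of the lift of `f` in the coordinates of the half-strip. -/
noncomputable def val (f : ModularCurve → ℂ) (p : ℝ × ℝ) : ℂ := lift f (chart (clamp p))

/-- The derivative of `val f` in the first coordinate. -/
noncomputable def valX (f : ModularCurve → ℂ) (p : ℝ × ℝ) : ℂ :=
  fderiv ℝ (lift f) (chart (clamp p)) (chartDeriv (clamp p) (1, 0))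

/-- The derivative of `val f` in the second coordinate. -/
noncomputable def valT (f : ModularCurve → ℂ) (p : ℝ × ℝ) : ℂ :=
  fderiv ℝ (lift f) (chart (clamp p)) (chartDeriv (clamp p) (0, 1))

/-- The density of the invariant measure in the coordinates of the half-strip. -/
noncomputable def density (p : ℝ × ℝ) : ℝ := ((chart (clamp p)).im ^ 2)⁻¹

theorem continuous_density : Continuous density :=
  continuous_comp_clamp (Φ := fun p => ((chart p).im ^ 2)⁻¹) continuousOn_inv_chart_im_sq

theorem density_nonneg (p : ℝ × ℝ) : 0 ≤ density p := inv_nonneg.2 (sq_nonneg _)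

theorem density_le {p : ℝ × ℝ} (hp : 0 ≤ p.2) : density p ≤ 4 / (1 + p.2) ^ 2 := by
  have h1 := half_add_lt_chart_im (clamp_mem p)
  have h2 : (clamp p).2 = p.2 := max_eq_left hp
  rw [h2] at h1
  have h3 : ((1 + p.2) / 2) ^ 2 ≤ (chart (clamp p)).im ^ 2 :=
    pow_le_pow_left₀ (by linarith) (by linarith) 2
  calc density p ≤ (((1 + p.2) / 2) ^ 2)⁻¹ := inv_anti₀ (by positivity) h3
    _ = 4 / (1 + p.2) ^ 2 := by field_simp; norm_num

theorem interior_strip_eq : interior strip = Set.Ioo (-(1 / 2)) (1 / 2) ×ˢ Set.Ioi 0 := by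
  rw [strip, interior_prod_eq, interior_Icc, interior_Ici]

section Val

variable {f : ModularCurve → ℂ} (hf : IsSmooth f)

include hf

theorem continuous_val : Continuous (val f) :=
  continuous_comp_clamp (Φ := fun p => lift f (chart p)) (continuousOn_comp_chart hf.continuousOn)

theorem continuous_valX : Continuous (valX f) := by
  refine continuous_comp_clamp
    (Φ := fun p => fderiv ℝ (lift f) (chart p) (chartDeriv p (1, 0))) ?_
  refine (continuousOn_comp_chart hf.contDiffOn_fderiv.continuousOn).clm_apply ?_
  simp only [chartDeriv_one_zero]
  intro p hp
  have hx : p.1 ∈ Set.Ioo (-1 : ℝ) 1 := ⟨by linarith [hp.1.1], by linarith [hp.1.2]⟩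
  have h1 : ContinuousAt (fun p : ℝ × ℝ => p.1 / arcHeight p.1) p :=
    (differentiableAt_slope hx).continuousAt.comp (f := Prod.fst) continuous_fst.continuousAt
  exact (continuousAt_const.sub ((Complex.continuous_ofReal.continuousAt.comp h1).mul
    continuousAt_const)).continuousWithinAt

theorem continuous_valT : Continuous (valT f) := by
  refine continuous_comp_clamp
    (Φ := fun p => fderiv ℝ (lift f) (chart p) (chartDeriv p (0, 1))) ?_
  refine (continuousOn_comp_chart hf.contDiffOn_fderiv.continuousOn).clm_apply ?_
  simp only [chartDeriv_zero_one]
  exact continuousOn_const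

theorem hasFDerivAt_val {p : ℝ × ℝ} (hp : p ∈ interior strip) :
    HasFDerivAt (val f) ((fderiv ℝ (lift f) (chart p)).comp (chartDeriv p)) p := by
  have hps := interior_subset hp
  have hx : p.1 ∈ Set.Ioo (-1 : ℝ) 1 := ⟨by linarith [hps.1.1], by linarith [hps.1.2]⟩
  have h1 : HasFDerivAt (fun p => lift f (chart p)) _ p :=
    (hf.differentiableAt (chart_im_pos hps)).hasFDerivAt.comp p (hasFDerivAt_chart hx)
  refine h1.congr_of_eventuallyEq ?_
  filter_upwards [mem_interior_iff_mem_nhds.1 hp] with y hy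
  rw [val, clamp_eq hy]

theorem hasDerivAt_valX {x t : ℝ} (hx : x ∈ Set.Ioo (-(1 / 2) : ℝ) (1 / 2)) (ht : 0 < t) :
    HasDerivAt (fun x => val f (x, t)) (valX f (x, t)) x := by
  have hp : (x, t) ∈ interior strip := by rw [interior_strip_eq]; exact ⟨hx, ht⟩
  have h1 := (hasFDerivAt_val hf hp).comp_hasDerivAt x
    ((hasDerivAt_id x).prodMk (hasDerivAt_const x t))
  rw [valX, clamp_eq (interior_subset hp)]
  exact h1

theorem hasDerivAt_valT {x t : ℝ} (hx : x ∈ Set.Ioo (-(1 / 2) : ℝ) (1 / 2)) (ht : 0 < t) :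
    HasDerivAt (fun t => val f (x, t)) (valT f (x, t)) t := by
  have hp : (x, t) ∈ interior strip := by rw [interior_strip_eq]; exact ⟨hx, ht⟩
  have h1 := (hasFDerivAt_val hf hp).comp_hasDerivAt t
    ((hasDerivAt_const t x).prodMk (hasDerivAt_id t))
  rw [valT, clamp_eq (interior_subset hp)]
  exact h1

end Val

theorem norm_sq_valT_le (f : ModularCurve → ℂ) {p : ℝ × ℝ} (hp : p ∈ strip) :
    ‖valT f p‖ ^ 2 ≤ gradSq f (chart p) := by
  rw [valT, clamp_eq hp, chartDeriv_zero_one, gradSq]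
  linarith [sq_nonneg ‖fderiv ℝ (lift f) (chart p) 1‖]

/-- The slope x/√(1 - x²) of the arc is at most 1 in absolute value for |x| ≤ 1/2; the factor 2
comes from (a + b)² ≤ 2 (a² + b²). -/
theorem norm_sq_valX_le (f : ModularCurve → ℂ) {p : ℝ × ℝ} (hp : p ∈ strip) :
    ‖valX f p‖ ^ 2 ≤ 2 * gradSq f (chart p) := by
  rw [valX, clamp_eq hp, chartDeriv_one_zero, gradSq, ← Complex.real_smul, map_sub, map_smul]
  set a := fderiv ℝ (lift f) (chart p) 1
  set b := fderiv ℝ (lift f) (chart p) Complex.I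
  have h1 : |p.1 / arcHeight p.1| ≤ 1 := by
    have h2 := half_lt_arcHeight hp.1
    rw [abs_div, abs_of_pos (by linarith : 0 < arcHeight p.1), div_le_one (by linarith)]
    exact (abs_le.2 hp.1).trans h2.le
  have h3 : ‖a - (p.1 / arcHeight p.1) • b‖ ≤ ‖a‖ + ‖b‖ := by
    refine (norm_sub_le _ _).trans ?_
    rw [norm_smul, Real.norm_eq_abs]
    have := mul_le_mul_of_nonneg_right h1 (norm_nonneg b)
    linarith
  have h4 := pow_le_pow_left₀ (norm_nonneg _) h3 2
  nlinarith [sq_nonneg (‖a‖ - ‖b‖)]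

end AutomorphicHamiltonian

namespace AutomorphicHamiltonian

/-! ### Energy estimates -/

/-- The square of the Sobolev norm of `f` in the coordinates of the half-strip. -/
noncomputable def energy (f : ModularCurve → ℂ) : ℝ :=
  ∫ p in strip, (‖val f p‖ ^ 2 + ‖valX f p‖ ^ 2 + ‖valT f p‖ ^ 2)

theorem intervalIntegral_swap_of_continuous {G : Type*} [NormedAddCommGroup G] [NormedSpace ℝ G]
    {Φ : ℝ × ℝ → G} (hΦ : Continuous Φ) (a b c d : ℝ) :
    ∫ x in a..b, ∫ t in c..d, Φ (x, t) = ∫ t in c..d, ∫ x in a..b, Φ (x, t) := by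
  refine intervalIntegral_intervalIntegral_swap (F := fun x t => Φ (x, t)) ?_
  refine (hΦ.continuousOn.integrableOn_compact (isCompact_uIcc.prod isCompact_uIcc)).mono_set
    (Set.prod_mono Set.uIoc_subset_uIcc Set.uIoc_subset_uIcc)

theorem continuous_inner_integral {G : Type*} [NormedAddCommGroup G] [NormedSpace ℝ G]
    {Φ : ℝ × ℝ → G} (hΦ : Continuous Φ) (a b : ℝ) :
    Continuous fun t => ∫ x in a..b, Φ (x, t) :=
  intervalIntegral.continuous_parametric_intervalIntegral_of_continuous'
    (f := fun t x => Φ (x, t)) (hΦ.comp continuous_swap) a b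

theorem continuous_inner_integral' {G : Type*} [NormedAddCommGroup G] [NormedSpace ℝ G]
    {Φ : ℝ × ℝ → G} (hΦ : Continuous Φ) (a b : ℝ) :
    Continuous fun x => ∫ t in a..b, Φ (x, t) :=
  intervalIntegral.continuous_parametric_intervalIntegral_of_continuous'
    (f := fun x t => Φ (x, t)) hΦ a b

/-- An integral over a box is at most the integral over the half-strip. -/
theorem integral_box_le {Φ : ℝ × ℝ → ℝ} (hΦ : Continuous Φ) (h0 : ∀ p, 0 ≤ Φ p)
    (hi : IntegrableOn Φ strip) {M : ℝ} (hM : 0 ≤ M) :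
    ∫ x in (-(1 / 2) : ℝ)..(1 / 2), ∫ t in (0 : ℝ)..M, Φ (x, t) ≤ ∫ p in strip, Φ p := by
  have h1 : IntegrableOn Φ (Set.Icc (-(1 / 2)) (1 / 2) ×ˢ Set.Icc 0 M) :=
    hΦ.continuousOn.integrableOn_compact (isCompact_Icc.prod isCompact_Icc)
  have h2 : ∫ x in (-(1 / 2) : ℝ)..(1 / 2), ∫ t in (0 : ℝ)..M, Φ (x, t) =
      ∫ p in Set.Icc (-(1 / 2) : ℝ) (1 / 2) ×ˢ Set.Icc 0 M, Φ p := by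
    rw [Measure.volume_eq_prod, setIntegral_prod _ h1, intervalIntegral.integral_of_le (by norm_num),
      integral_Icc_eq_integral_Ioc]
    refine integral_congr_ae (ae_of_all _ fun x => ?_)
    simp only
    rw [intervalIntegral.integral_of_le hM, integral_Icc_eq_integral_Ioc]
  rw [h2]
  exact setIntegral_mono_set hi (ae_of_all _ h0)
    (Set.prod_mono_right Set.Icc_subset_Ici_self).eventuallyLE

/-- The Cauchy-Schwarz inequality in the plane for (a, √P) and (b, √Q). -/
theorem mul_add_sq_le {a b c P Q R : ℝ} (ha : 0 ≤ a) (hb : 0 ≤ b) (hc : 0 ≤ c) (hP : 0 ≤ P)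
    (hQ : 0 ≤ Q) (h : c ^ 2 ≤ P * Q) (hR : b ^ 2 ≤ R) :
    (a * b + c) ^ 2 ≤ (a ^ 2 + P) * (R + Q) := by
  have h8 : c ≤ √P * √Q := by
    rw [← Real.sqrt_mul hP]
    exact Real.le_sqrt_of_sq_le h
  have e1 := Real.sq_sqrt hP
  have e2 := Real.sq_sqrt hQ
  calc (a * b + c) ^ 2 ≤ (a * b + √P * √Q) ^ 2 :=
        pow_le_pow_left₀ (by positivity) (by linarith) 2
    _ ≤ (a ^ 2 + √P ^ 2) * (b ^ 2 + √Q ^ 2) := by nlinarith [sq_nonneg (a * √Q - b * √P)]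
    _ ≤ (a ^ 2 + P) * (R + Q) := by
      rw [e1, e2]
      exact mul_le_mul_of_nonneg_left (by linarith) (by positivity)

section Energy

variable (f : TestFn)

theorem TestFn.smooth : IsSmooth (f : ModularCurve → ℂ) := f.2.1

theorem TestFn.exists_val_eq_zero : ∃ M : ℝ, 0 < M ∧ ∀ p : ℝ × ℝ, M ≤ p.2 →
    val f p = 0 ∧ valX f p = 0 ∧ valT f p = 0 := by
  obtain ⟨M, hM0, hM⟩ := TestFn.exists_lift_eq_zero f
  refine ⟨M + 1, by positivity, fun p hp => ?_⟩
  have h1 : M < (chart (clamp p)).im := by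
    have h2 : p.2 ≤ (clamp p).2 := le_max_left _ _
    linarith [le_chart_im (p := clamp p)]
  refine ⟨hM _ h1.le, ?_, ?_⟩
  · rw [valX, fderiv_eq_zero_of_height hM h1]
    simp
  · rw [valT, fderiv_eq_zero_of_height hM h1]
    simp

theorem integrableOn_energy {Φ : ℂ → ℂ → ℂ → ℝ}
    (hΦ : Continuous fun p : ℂ × ℂ × ℂ => Φ p.1 p.2.1 p.2.2) (h0 : Φ 0 0 0 = 0) :
    IntegrableOn (fun p => Φ (val f p) (valX f p) (valT f p)) strip := by
  obtain ⟨M, hM0, hM⟩ := TestFn.exists_val_eq_zero f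
  refine integrableOn_strip (M := M) ?_ fun p _ hp => ?_
  · exact (hΦ.comp ((continuous_val (TestFn.smooth f)).prodMk
      ((continuous_valX (TestFn.smooth f)).prodMk
        (continuous_valT (TestFn.smooth f))))).continuousOn
  · obtain ⟨h1, h2, h3⟩ := hM p hp
    rw [h1, h2, h3, h0]

/-- A trace inequality on horizontal lines: `norm_sq_left_le` is applied on the vertical segment
from t to a height where f vanishes, then integrated over x. -/
theorem integral_norm_sq_val_le {t : ℝ} (ht : 0 ≤ t) :
    ∫ x in (-(1 / 2) : ℝ)..(1 / 2), ‖val f (x, t)‖ ^ 2 ≤ energy f := by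
  obtain ⟨M, hM0, hM⟩ := TestFn.exists_val_eq_zero f
  have hc1 := continuous_val (TestFn.smooth f)
  have hc2 := continuous_valX (TestFn.smooth f)
  have hc3 := continuous_valT (TestFn.smooth f)
  have h1 := integral_box_le
    (Φ := fun p => ‖val f p‖ ^ 2 + ‖valX f p‖ ^ 2 + ‖valT f p‖ ^ 2) (by fun_prop)
    (fun p => by positivity) (integrableOn_energy f
      (Φ := fun a b c => ‖a‖ ^ 2 + ‖b‖ ^ 2 + ‖c‖ ^ 2) (by fun_prop) (by simp))
    (le_max_of_le_left hM0.le : 0 ≤ max M t)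
  refine le_trans ?_ h1
  refine intervalIntegral.integral_mono_on_of_le_Ioo (by norm_num)
    (Continuous.intervalIntegrable (by fun_prop) _ _)
    ((continuous_inner_integral' (Φ := fun p => ‖val f p‖ ^ 2 + ‖valX f p‖ ^ 2 + ‖valT f p‖ ^ 2)
      (by fun_prop) _ _).intervalIntegrable _ _) fun x hx => ?_
  have h2 := norm_sq_left_le (v := fun t => val f (x, t)) (v' := fun t => valT f (x, t))
    (a := t) (b := max M t) (by fun_prop) (by fun_prop) (le_max_right _ _)
    (fun τ hτ => hasDerivAt_valT (TestFn.smooth f) hx (ht.trans_lt hτ.1))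
    (hM (x, max M t) (le_max_left _ _)).1
  refine h2.trans ?_
  have h3 : ∀ a b : ℝ, IntervalIntegrable
      (fun t => ‖val f (x, t)‖ ^ 2 + ‖valX f (x, t)‖ ^ 2 + ‖valT f (x, t)‖ ^ 2) volume a b :=
    fun a b => Continuous.intervalIntegrable (by fun_prop) _ _
  refine (intervalIntegral.integral_mono_on (le_max_right _ _)
    (Continuous.intervalIntegrable (by fun_prop) _ _) (h3 t (max M t)) fun τ _ => ?_).trans ?_
  · linarith [sq_nonneg ‖valX f (x, τ)‖]
  · exact intervalIntegral.integral_mono_interval ht (le_max_right _ _) le_rfl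
      (ae_of_all _ fun τ => by positivity) (h3 0 (max M t))

/-- The primitive in the first variable of the conjugate of `f`, times the density. -/
noncomputable def primitive (f : ModularCurve → ℂ) (t x : ℝ) : ℂ :=
  ∫ s in (-(1 / 2) : ℝ)..x, density (s, t) • conj (val f (s, t))

theorem continuous_integrand {f : ModularCurve → ℂ} (hf : IsSmooth f) :
    Continuous fun p : ℝ × ℝ => density p • conj (val f p) :=
  continuous_density.smul (Complex.continuous_conj.comp (continuous_val hf))

theorem continuous_primitive {f : ModularCurve → ℂ} (hf : IsSmooth f) :
    Continuous fun p : ℝ × ℝ => primitive f p.1 p.2 :=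
  intervalIntegral.continuous_parametric_primitive_of_continuous
    (f := fun t s => density (s, t) • conj (val f (s, t)))
    ((continuous_integrand hf).comp continuous_swap)

/-- Point values of f need not be bounded by the energy in dimension two, but those of its
horizontal primitive are: by Cauchy-Schwarz they only involve the L² norm of f on a horizontal line.
The decay in t comes from the density and is what makes the final sum finite. -/
theorem norm_sq_primitive_le {x t : ℝ} (hx : x ∈ Set.Icc (-(1 / 2) : ℝ) (1 / 2)) (ht : 0 ≤ t) :
    ‖primitive f t x‖ ^ 2 ≤ 16 / (1 + t) ^ 2 * energy f := by
  have hc1 := continuous_val (TestFn.smooth f)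
  have hc2 := continuous_density
  have h1 := norm_integral_mul_sq_le (v := fun s => (density (s, t) : ℂ))
    (w := fun s => conj (val f (s, t))) (by fun_prop) (by fun_prop) hx.1
  have h2 : primitive f t x =
      ∫ s in (-(1 / 2) : ℝ)..x, (density (s, t) : ℂ) * conj (val f (s, t)) := by
    simp only [primitive, Complex.real_smul]
  rw [h2]
  refine h1.trans ?_
  have h3 : ∫ s in (-(1 / 2) : ℝ)..x, ‖(density (s, t) : ℂ)‖ ^ 2 ≤ 16 / (1 + t) ^ 2 := by
    have h4 : ∫ s in (-(1 / 2) : ℝ)..x, ‖(density (s, t) : ℂ)‖ ^ 2 ≤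
        ∫ s in (-(1 / 2) : ℝ)..x, 16 / (1 + t) ^ 2 := by
      refine intervalIntegral.integral_mono_on hx.1 (Continuous.intervalIntegrable (by fun_prop) _ _)
        (Continuous.intervalIntegrable (by fun_prop) _ _) fun s _ => ?_
      have h5 := density_le (p := (s, t)) ht
      have h6 := density_nonneg (s, t)
      rw [Complex.norm_real, Real.norm_eq_abs, abs_of_nonneg h6]
      refine (pow_le_pow_left₀ h6 h5 2).trans ?_
      rw [div_pow]
      norm_num
      refine div_le_div_of_nonneg_left (by norm_num) (by positivity) ?_
      exact le_self_pow₀ (one_le_pow₀ (by linarith)) two_ne_zero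
    refine h4.trans ?_
    rw [intervalIntegral.integral_const, smul_eq_mul]
    have h7 : 0 ≤ 16 / (1 + t) ^ 2 := by positivity
    have h8 : x - -(1 / 2) ≤ 1 := by linarith [hx.2]
    nlinarith
  have h9 : ∫ s in (-(1 / 2) : ℝ)..x, ‖conj (val f (s, t))‖ ^ 2 ≤ energy f := by
    refine le_trans ?_ (integral_norm_sq_val_le f ht)
    simp only [RCLike.norm_conj]
    exact intervalIntegral.integral_mono_interval le_rfl hx.1 hx.2
      (ae_of_all _ fun τ => by positivity) (Continuous.intervalIntegrable (by fun_prop) _ _)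
  exact mul_le_mul h3 h9 (intervalIntegral.integral_nonneg hx.1 fun _ _ => by positivity)
    (by positivity)

/-- The local contribution to the bound for the pairing with `f`. -/
noncomputable def primitiveSq (f : ModularCurve → ℂ) (t : ℝ) : ℝ :=
  ‖primitive f t (1 / 2)‖ ^ 2 + ∫ x in (-(1 / 2) : ℝ)..(1 / 2), ‖primitive f t x‖ ^ 2

theorem continuous_primitiveSq {f : ModularCurve → ℂ} (hf : IsSmooth f) :
    Continuous (primitiveSq f) := by
  have h1 := continuous_primitive hf
  have h2 : Continuous fun t => primitive f t (1 / 2) :=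
    h1.comp (continuous_id.prodMk continuous_const)
  refine (h2.norm.pow 2).add ?_
  exact continuous_inner_integral (Φ := fun p => ‖primitive f p.2 p.1‖ ^ 2)
    ((h1.comp continuous_swap).norm.pow 2) _ _

theorem primitiveSq_nonneg (f : ModularCurve → ℂ) (t : ℝ) : 0 ≤ primitiveSq f t :=
  add_nonneg (sq_nonneg _) (intervalIntegral.integral_nonneg (by norm_num) fun _ _ => sq_nonneg _)

variable (g : TestFn)

/-- Integration by parts in x. The primitive vanishes at -1/2, and the boundary value of g at 1/2 is
bounded by `norm_sq_right_le`. -/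
theorem norm_sq_slice_le {t : ℝ} (ht : 0 < t) :
    ‖∫ x in (-(1 / 2) : ℝ)..(1 / 2), density (x, t) • (conj (val f (x, t)) * val g (x, t))‖ ^ 2 ≤
      primitiveSq f t * ∫ x in (-(1 / 2) : ℝ)..(1 / 2), 2 * (‖val g (x, t)‖ ^ 2 +
        ‖valX g (x, t)‖ ^ 2) := by
  have hle : (-(1 / 2) : ℝ) ≤ 1 / 2 := by norm_num
  have hc1 := continuous_val (TestFn.smooth g)
  have hc2 := continuous_valX (TestFn.smooth g)
  have hc3 := continuous_integrand (TestFn.smooth f)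
  have hc4 : Continuous fun x => primitive f t x :=
    (continuous_primitive (TestFn.smooth f)).comp (continuous_const.prodMk continuous_id)
  have h1 : ∫ x in (-(1 / 2) : ℝ)..(1 / 2),
      density (x, t) • (conj (val f (x, t)) * val g (x, t)) =
      primitive f t (1 / 2) * val g (1 / 2, t) -
        ∫ x in (-(1 / 2) : ℝ)..(1 / 2), primitive f t x * valX g (x, t) := by
    have hc5 : Continuous fun x => density (x, t) • conj (val f (x, t)) :=
      hc3.comp (continuous_id.prodMk continuous_const)
    have h2 := intervalIntegral.integral_eq_sub_of_hasDerivAt_of_le hle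
      (f := fun x => primitive f t x * val g (x, t))
      (f' := fun x => (density (x, t) • conj (val f (x, t))) * val g (x, t) +
        primitive f t x * valX g (x, t)) (by fun_prop)
      (fun x hx => ((hc5.integral_hasStrictDerivAt _ x).hasDerivAt).mul
        (hasDerivAt_valX (TestFn.smooth g) hx ht)) (Continuous.intervalIntegrable (by fun_prop) _ _)
    rw [intervalIntegral.integral_add (Continuous.intervalIntegrable (by fun_prop) _ _)
      (Continuous.intervalIntegrable (by fun_prop) _ _)] at h2
    have h3 : primitive f t (-(1 / 2)) = 0 := by simp [primitive]
    rw [h3, zero_mul, sub_zero] at h2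
    simp only [smul_mul_assoc] at h2
    exact eq_sub_of_add_eq h2
  have h4 := norm_integral_mul_sq_le (v := fun x => primitive f t x)
    (w := fun x => valX g (x, t)) hc4 (by fun_prop) hle
  have h5 : ‖val g (1 / 2, t)‖ ^ 2 ≤
      ∫ x in (-(1 / 2) : ℝ)..(1 / 2), (2 * ‖val g (x, t)‖ ^ 2 + ‖valX g (x, t)‖ ^ 2) :=
    norm_sq_right_le (v := fun x => val g (x, t)) (v' := fun x => valX g (x, t)) (by fun_prop)
      (by fun_prop) hle (fun x hx => hasDerivAt_valX (TestFn.smooth g) hx ht) (by norm_num)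
  have h6 : ∫ x in (-(1 / 2) : ℝ)..(1 / 2), 2 * (‖val g (x, t)‖ ^ 2 + ‖valX g (x, t)‖ ^ 2) =
      (∫ x in (-(1 / 2) : ℝ)..(1 / 2), (2 * ‖val g (x, t)‖ ^ 2 + ‖valX g (x, t)‖ ^ 2)) +
        ∫ x in (-(1 / 2) : ℝ)..(1 / 2), ‖valX g (x, t)‖ ^ 2 := by
    rw [← intervalIntegral.integral_add (Continuous.intervalIntegrable (by fun_prop) _ _)
      (Continuous.intervalIntegrable (by fun_prop) _ _)]
    exact intervalIntegral.integral_congr fun x _ => by ring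
  rw [h1, h6, primitiveSq]
  have h7 : ‖primitive f t (1 / 2) * val g (1 / 2, t) -
      ∫ x in (-(1 / 2) : ℝ)..(1 / 2), primitive f t x * valX g (x, t)‖ ≤
      ‖primitive f t (1 / 2)‖ * ‖val g (1 / 2, t)‖ +
        ‖∫ x in (-(1 / 2) : ℝ)..(1 / 2), primitive f t x * valX g (x, t)‖ := by
    refine (norm_sub_le _ _).trans ?_
    rw [norm_mul]
  refine (pow_le_pow_left₀ (norm_nonneg _) h7 2).trans ?_
  exact mul_add_sq_le (norm_nonneg _) (norm_nonneg _) (norm_nonneg _)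
    (intervalIntegral.integral_nonneg hle fun _ _ => sq_nonneg _)
    (intervalIntegral.integral_nonneg hle fun _ _ => sq_nonneg _) h4 h5

/-- The slice estimates are combined by Cauchy-Schwarz in t. The right side separates f from g, so
it bounds the norm of the functional defined by f. -/
theorem norm_sq_inner_le {M : ℝ} (hM0 : 0 ≤ M) (hM : ∀ p : ℝ × ℝ, M ≤ p.2 → val f p = 0) :
    ‖⟪toL2 f, toL2 g⟫_ℂ‖ ^ 2 ≤ 2 * (∫ t in (0 : ℝ)..M, primitiveSq f t) * energy g := by
  have hle : (-(1 / 2) : ℝ) ≤ 1 / 2 := by norm_num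
  have hc0 := continuous_val (TestFn.smooth f)
  have hc1 := continuous_val (TestFn.smooth g)
  have hc2 := continuous_valX (TestFn.smooth g)
  have hc3 := continuous_valT (TestFn.smooth g)
  have hc4 := continuous_density
  have hc5 := continuous_primitiveSq (TestFn.smooth f)
  set w : ℝ × ℝ → ℂ := fun p => density p • (conj (val f p) * val g p) with hw
  have hwc : Continuous w := hc4.smul ((Complex.continuous_conj.comp hc0).mul hc1)
  have h1 : ⟪toL2 f, toL2 g⟫_ℂ =
      ∫ t in (0 : ℝ)..M, ∫ x in (-(1 / 2) : ℝ)..(1 / 2), w (x, t) := by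
    rw [← intervalIntegral_swap_of_continuous hwc, ← setIntegral_strip hwc.continuousOn hM0, inner_toL2]
    · refine setIntegral_congr_fun measurableSet_strip fun p hp => ?_
      simp only [hw, density, val, clamp_eq hp]
    · intro p _ hp
      simp only [hw]
      rw [hM p hp]
      simp
  set Q : ℝ → ℝ := fun t => ∫ x in (-(1 / 2) : ℝ)..(1 / 2), 2 * (‖val g (x, t)‖ ^ 2 +
        ‖valX g (x, t)‖ ^ 2) with hQ
  have hQc : Continuous Q :=
    continuous_inner_integral (Φ := fun p => 2 * (‖val g p‖ ^ 2 + ‖valX g p‖ ^ 2)) (by fun_prop) _ _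
  have hQ0 : ∀ t, 0 ≤ Q t := fun t => intervalIntegral.integral_nonneg hle fun _ _ => by positivity
  have h2 : ‖⟪toL2 f, toL2 g⟫_ℂ‖ ≤ ‖∫ t in (0 : ℝ)..M, (√(primitiveSq f t) : ℂ) * (√(Q t) : ℂ)‖ := by
    rw [h1]
    have h3 : ∫ t in (0 : ℝ)..M, (√(primitiveSq f t) : ℂ) * (√(Q t) : ℂ) =
        ((∫ t in (0 : ℝ)..M, √(primitiveSq f t) * √(Q t) : ℝ) : ℂ) := by
      rw [← intervalIntegral.integral_ofReal]
      simp only [Complex.ofReal_mul]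
    rw [h3, Complex.norm_real]
    refine le_trans ?_ (le_abs_self _)
    refine (intervalIntegral.norm_integral_le_integral_norm hM0).trans ?_
    refine intervalIntegral.integral_mono_on_of_le_Ioo hM0
      ((continuous_inner_integral hwc _ _).norm.intervalIntegrable _ _)
      (Continuous.intervalIntegrable (by fun_prop) _ _) fun t ht => ?_
    rw [← Real.sqrt_mul (primitiveSq_nonneg _ _)]
    exact Real.le_sqrt_of_sq_le (norm_sq_slice_le f g ht.1)
  have h3 := norm_integral_mul_sq_le (v := fun t => (√(primitiveSq f t) : ℂ))
    (w := fun t => (√(Q t) : ℂ)) (by fun_prop) (by fun_prop) hM0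
  have e1 : ∀ t, ‖(√(primitiveSq f t) : ℂ)‖ ^ 2 = primitiveSq f t := fun t => by
    rw [Complex.norm_real, Real.norm_eq_abs, sq_abs, Real.sq_sqrt (primitiveSq_nonneg _ _)]
  have e2 : ∀ t, ‖(√(Q t) : ℂ)‖ ^ 2 = Q t := fun t => by
    rw [Complex.norm_real, Real.norm_eq_abs, sq_abs, Real.sq_sqrt (hQ0 t)]
  simp only [e1, e2] at h3
  have h4 : ∫ t in (0 : ℝ)..M, Q t ≤ 2 * energy g := by
    have h5 : ∫ t in (0 : ℝ)..M, Q t = 2 * ∫ x in (-(1 / 2) : ℝ)..(1 / 2), ∫ t in (0 : ℝ)..M,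
        (‖val g (x, t)‖ ^ 2 + ‖valX g (x, t)‖ ^ 2) := by
      rw [intervalIntegral_swap_of_continuous
        (Φ := fun p => ‖val g p‖ ^ 2 + ‖valX g p‖ ^ 2) (by fun_prop),
        ← intervalIntegral.integral_const_mul]
      simp only [hQ, intervalIntegral.integral_const_mul]
    rw [h5]
    refine mul_le_mul_of_nonneg_left ?_ (by norm_num)
    refine (integral_box_le (Φ := fun p => ‖val g p‖ ^ 2 + ‖valX g p‖ ^ 2) (by fun_prop)
      (fun p => by positivity) (integrableOn_energy g
      (Φ := fun a b c => ‖a‖ ^ 2 + ‖b‖ ^ 2) (by fun_prop) (by simp)) hM0).trans ?_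
    refine setIntegral_mono (integrableOn_energy g
      (Φ := fun a b c => ‖a‖ ^ 2 + ‖b‖ ^ 2) (by fun_prop) (by simp)) (integrableOn_energy g
      (Φ := fun a b c => ‖a‖ ^ 2 + ‖b‖ ^ 2 + ‖c‖ ^ 2) (by fun_prop) (by simp)) fun p => ?_
    simp only
    linarith [sq_nonneg ‖valT g p‖]
  have h6 : 0 ≤ ∫ t in (0 : ℝ)..M, primitiveSq f t :=
    intervalIntegral.integral_nonneg hM0 fun t _ => primitiveSq_nonneg _ _
  calc _ ≤ _ := pow_le_pow_left₀ (norm_nonneg _) h2 2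
    _ ≤ _ := h3
    _ ≤ _ := mul_le_mul_of_nonneg_left h4 h6
    _ = _ := by ring

end Energy

end AutomorphicHamiltonian

namespace AutomorphicHamiltonian

/-! ### The pairing with finite families -/

/-- A duality argument. The coefficients cᵢ are chosen as the values of the primitives at (t, x)
themselves; the primitive being conjugate-linear in f, its value for the combination is the sum N.
The bound for a single function then reads N² ≤ 16/(1 + t)² · B N. -/
theorem sum_norm_sq_primitive_le {ι : Type*} {B : ℝ} (hB0 : 0 ≤ B) (s : Finset ι) (f : ι → TestFn)
    (hB : ∀ c : ι → ℂ, energy (∑ i ∈ s, c i • f i : TestFn) ≤ B * ∑ i ∈ s, ‖c i‖ ^ 2)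
    {x t : ℝ} (hx : x ∈ Set.Icc (-(1 / 2) : ℝ) (1 / 2)) (ht : 0 ≤ t) :
    ∑ i ∈ s, ‖primitive (f i) t x‖ ^ 2 ≤ 16 / (1 + t) ^ 2 * B := by
  set N := ∑ i ∈ s, ‖primitive (f i) t x‖ ^ 2 with hN
  have hN0 : 0 ≤ N := Finset.sum_nonneg fun i _ => sq_nonneg _
  have h1 : primitive (∑ i ∈ s, primitive (f i) t x • f i : TestFn) t x = (N : ℂ) := by
    have h2 : ∀ y, density (y, t) • conj (val (∑ i ∈ s, primitive (f i) t x • f i : TestFn) (y, t))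
        = ∑ i ∈ s, conj (primitive (f i) t x) * (density (y, t) • conj (val (f i) (y, t))) := by
      intro y
      have h3 : val (∑ i ∈ s, primitive (f i) t x • f i : TestFn) (y, t) =
          ∑ i ∈ s, primitive (f i) t x * val (f i) (y, t) := by
        simp [val, lift, Finset.sum_apply]
      rw [h3, map_sum, Finset.smul_sum]
      refine Finset.sum_congr rfl fun i _ => ?_
      rw [map_mul, mul_smul_comm]
    refine (intervalIntegral.integral_congr fun y _ => h2 y).trans ?_
    rw [intervalIntegral.integral_finsetSum]
    · simp only [intervalIntegral.integral_const_mul]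
      rw [hN]
      push_cast
      refine Finset.sum_congr rfl fun i _ => ?_
      change conj (primitive (f i) t x) * primitive (f i) t x = _
      rw [← Complex.normSq_eq_conj_mul_self, Complex.normSq_eq_norm_sq]
      push_cast
      rfl
    · intro i _
      exact (((continuous_integrand (TestFn.smooth (f i))).comp
        (continuous_id.prodMk continuous_const)).const_smul
          (conj (primitive (f i) t x))).intervalIntegrable _ _
  have h2 := norm_sq_primitive_le (∑ i ∈ s, primitive (f i) t x • f i : TestFn) hx ht
  rw [h1, Complex.norm_real, Real.norm_eq_abs, sq_abs] at h2
  have h3 : N ^ 2 ≤ (16 / (1 + t) ^ 2 * B) * N := by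
    refine h2.trans ?_
    rw [mul_assoc]
    exact mul_le_mul_of_nonneg_left (hB _) (by positivity)
  rcases hN0.eq_or_lt with h0 | h0
  · rw [← h0]
    positivity
  · exact le_of_mul_le_mul_right (by rw [← sq]; exact h3) h0

/-- The pairings of the members of a family which is bounded in energy are square summable,
relative to the energy. -/
theorem exists_pairing_bound {ι : Type*} {B : ℝ} (hB0 : 0 ≤ B) (s : Finset ι) (f : ι → TestFn)
    (hB : ∀ c : ι → ℂ, energy (∑ i ∈ s, c i • f i : TestFn) ≤ B * ∑ i ∈ s, ‖c i‖ ^ 2) :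
    ∃ A : ι → ℝ, ∑ i ∈ s, A i ≤ 64 * B ∧
      ∀ i ∈ s, 0 ≤ A i ∧ ∀ g : TestFn, ‖⟪toL2 (f i), toL2 g⟫_ℂ‖ ^ 2 ≤ A i * energy g := by
  choose m hm0 hm using fun i => TestFn.exists_val_eq_zero (f i)
  -- One height above which all the members of the finite family vanish.
  set M := ∑ i ∈ s, m i with hM
  have hM0 : 0 ≤ M := Finset.sum_nonneg fun i _ => (hm0 i).le
  have hP : ∀ i, Continuous (primitiveSq (f i)) := fun i => continuous_primitiveSq (TestFn.smooth _)
  refine ⟨fun i => 2 * ∫ t in (0 : ℝ)..M, primitiveSq (f i) t, ?_, fun i hi => ⟨?_, fun g => ?_⟩⟩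
  · rw [← Finset.mul_sum, ← intervalIntegral.integral_finsetSum
      fun i _ => (hP i).intervalIntegrable _ _]
    -- 32 = 16 + 16, for the endpoint term and for the integral over an interval of length one. With
    -- the factor 2 in `A` and an integral of (1 + t)⁻² at most 1, this gives 64.
    have hbound : ∀ t ∈ Set.Icc 0 M, ∑ i ∈ s, primitiveSq (f i) t ≤ ((1 + t) ^ 2)⁻¹ * (32 * B) := by
      intro t ht
      have h1 := sum_norm_sq_primitive_le hB0 s f hB (x := 1 / 2) ⟨by norm_num, le_rfl⟩ ht.1
      have hc : ∀ i, Continuous fun x => ‖primitive (f i) t x‖ ^ 2 := fun i =>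
        ((continuous_primitive (TestFn.smooth (f i))).comp
          (continuous_const.prodMk continuous_id)).norm.pow 2
      have h2 : ∑ i ∈ s, ∫ x in (-(1 / 2) : ℝ)..(1 / 2), ‖primitive (f i) t x‖ ^ 2 ≤
          16 / (1 + t) ^ 2 * B := by
        rw [← intervalIntegral.integral_finsetSum fun i _ => (hc i).intervalIntegrable _ _]
        have h3 := intervalIntegral.integral_mono_on (μ := volume) (a := -(1 / 2)) (b := (1 / 2 : ℝ)) (by norm_num)
          (Continuous.intervalIntegrable (continuous_finsetSum s fun i _ => hc i) _ _)
          (intervalIntegrable_const (c := 16 / (1 + t) ^ 2 * B))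
          (fun x hx => sum_norm_sq_primitive_le hB0 s f hB hx ht.1)
        refine h3.trans (le_of_eq ?_)
        rw [intervalIntegral.integral_const]
        norm_num
      simp only [primitiveSq, Finset.sum_add_distrib]
      refine (add_le_add h1 h2).trans (le_of_eq ?_)
      rw [div_eq_mul_inv]
      ring
    have hcont : ContinuousOn (fun t : ℝ => ((1 + t) ^ 2)⁻¹ * (32 * B)) (Set.uIcc 0 M) := by
      intro t ht
      rw [Set.uIcc_of_le hM0] at ht
      have : (1 + t) ≠ 0 := by linarith [ht.1]
      exact (ContinuousAt.mul (ContinuousAt.inv₀ (f := fun t : ℝ => (1 + t) ^ 2) (by fun_prop) (pow_ne_zero 2 this))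
        continuousAt_const).continuousWithinAt
    have h5 := intervalIntegral.integral_mono_on (μ := volume) hM0
      (Continuous.intervalIntegrable (continuous_finsetSum s fun i _ => hP i) 0 M)
      hcont.intervalIntegrable hbound
    have h6 : ∫ t in (0 : ℝ)..M, ((1 + t) ^ 2)⁻¹ ≤ 1 := by
      have hd : ∀ t ∈ Set.uIcc 0 M, HasDerivAt (fun t : ℝ => -(1 + t)⁻¹) (((1 + t) ^ 2)⁻¹) t := by
        intro t ht
        rw [Set.uIcc_of_le hM0] at ht
        have h7 : (1 + t) ≠ 0 := by linarith [ht.1]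
        refine (((hasDerivAt_id t).const_add 1).inv h7).neg.congr_deriv ?_
        simp [neg_div]
      rw [intervalIntegral.integral_eq_sub_of_hasDerivAt hd]
      · have : 0 ≤ (1 + M)⁻¹ := by positivity
        norm_num
        linarith
      · refine ContinuousOn.intervalIntegrable fun t ht => ?_
        rw [Set.uIcc_of_le hM0] at ht
        have h7 : (1 + t) ≠ 0 := by linarith [ht.1]
        exact (ContinuousAt.inv₀ (f := fun t : ℝ => (1 + t) ^ 2) (by fun_prop) (pow_ne_zero 2 h7)).continuousWithinAt
    rw [intervalIntegral.integral_mul_const] at h5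
    nlinarith
  · have := intervalIntegral.integral_nonneg (μ := volume) hM0
      fun t _ => primitiveSq_nonneg (f i) t
    linarith
  · refine norm_sq_inner_le (f i) g hM0 fun p hp => (hm i p ?_).1
    exact (Finset.single_le_sum (fun j _ => (hm0 j).le) hi).trans hp

/-! ### Lower bounds for the form of the Hamiltonian -/

section Form

/-- The growth bound can only fail for t ≤ T, a compact box on which q is bounded below and y ≤ 1 +
T. -/
theorem GrowsInCusp.exists_add_ge {q : ModularCurve → ℝ} (hq : IsSmooth q) (h : GrowsInCusp q) :
    ∃ c : ℝ, 0 < c ∧ ∃ C : ℝ, ∀ p ∈ strip, c * (chart p).im ^ 2 ≤ lift q (chart p) + C := by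
  obtain ⟨c, hc, Y, hY⟩ := h
  have hcont : ContinuousOn (fun p => lift q (chart p)) strip :=
    continuousOn_comp_chart (ContDiffOn.continuousOn hq)
  set T := max Y 0 with hT
  have hT0 : 0 ≤ T := le_max_right _ _
  obtain ⟨m, hm⟩ := ((isCompact_Icc (a := (-(1 / 2) : ℝ)) (b := 1 / 2)).prod
    (isCompact_Icc (a := 0) (b := T))).bddBelow_image
      (hcont.mono (Set.prod_mono_right Set.Icc_subset_Ici_self))
  refine ⟨c, hc, |m| + c * (1 + T) ^ 2, fun p hp => ?_⟩
  have him := chart_im_pos hp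
  rcases le_total p.2 T with h1 | h1
  · have h2 : m ≤ lift q (chart p) := hm ⟨p, ⟨hp.1, hp.2, h1⟩, rfl⟩
    have h3 : (chart p).im ^ 2 ≤ (1 + T) ^ 2 :=
      pow_le_pow_left₀ him.le (chart_im_le.trans (by linarith)) 2
    have h4 := mul_le_mul_of_nonneg_left h3 hc.le
    linarith [neg_abs_le m]
  · have h2 := hY ⟨chart p, him⟩ (((le_max_left _ _).trans h1).trans le_chart_im)
    have h3 : lift q (chart p) = q (proj ⟨chart p, him⟩) := lift_coe q ⟨chart p, him⟩
    have h4 : 0 ≤ |m| + c * (1 + T) ^ 2 := by positivity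
    rw [h3]
    exact h2.trans (le_add_of_nonneg_right h4)

theorem continuousOn_gradSq {f : ModularCurve → ℂ} (hf : IsSmooth f) :
    ContinuousOn (fun p => gradSq f (chart p)) strip := by
  have h := continuousOn_comp_chart hf.contDiffOn_fderiv.continuousOn
  exact ((h.clm_apply continuousOn_const).norm.pow 2).add
    ((h.clm_apply continuousOn_const).norm.pow 2)

theorem integrableOn_form (q : ModularCurve → ℝ) (hq : IsSmooth q) (f : TestFn) : IntegrableOn (fun p => gradSq f (chart p) +
    ((chart p).im ^ 2)⁻¹ * lift q (chart p) * ‖lift (f : ModularCurve → ℂ) (chart p)‖ ^ 2)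
    strip := by
  have hf := TestFn.smooth f
  obtain ⟨M, hM0, hM⟩ := TestFn.exists_lift_eq_zero f
  have hc : ContinuousOn (fun p => lift q (chart p)) strip :=
    continuousOn_comp_chart (ContDiffOn.continuousOn hq)
  have hfc : ContinuousOn (fun p => lift (f : ModularCurve → ℂ) (chart p)) strip :=
    continuousOn_comp_chart hf.continuousOn
  refine integrableOn_strip (M := M + 1) ((continuousOn_gradSq hf).add
    ((continuousOn_inv_chart_im_sq.mul hc).mul (hfc.norm.pow 2))) fun p _ hp => ?_
  have h1 : M < (chart p).im := by linarith [le_chart_im (p := p)]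
  rw [hM _ h1.le, gradSq, fderiv_eq_zero_of_height hM h1]
  simp

theorem integrableOn_norm_sq (f : TestFn) : IntegrableOn (fun p =>
    ((chart p).im ^ 2)⁻¹ * ‖lift (f : ModularCurve → ℂ) (chart p)‖ ^ 2) strip := by
  have hfc : ContinuousOn (fun p => lift (f : ModularCurve → ℂ) (chart p)) strip :=
    continuousOn_comp_chart (TestFn.smooth f).continuousOn
  obtain ⟨M, hM0, hM⟩ := TestFn.exists_lift_eq_zero f
  refine integrableOn_strip (M := M) (continuousOn_inv_chart_im_sq.mul (hfc.norm.pow 2))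
    fun p _ hp => ?_
  rw [hM _ (hp.trans le_chart_im)]
  simp

/-- The quadratic growth of the potential is used here: it makes y⁻² (q + C) ≥ c, so the potential
term controls the unweighted integral of |f|². The constant 3 is 2 for `valX` plus 1 for `valT`, and
c⁻¹ pays for `val`. -/
theorem energy_le (q : ModularCurve → ℝ) (hq : IsSmooth q) {c C : ℝ} (hc : 0 < c)
    (h : ∀ p ∈ strip, c * (chart p).im ^ 2 ≤ lift q (chart p) + C) (f : TestFn) :
    energy f ≤ (3 + c⁻¹) *
      ((⟪toL2 (hamiltonian q hq f), toL2 f⟫_ℂ).re + C * ‖toL2 f‖ ^ 2) := by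
  have hi := (integrableOn_form q hq f).add ((integrableOn_norm_sq f).const_mul C)
  rw [re_inner_hamiltonian, norm_sq_toL2, ← integral_const_mul, ← integral_add
    (integrableOn_form q hq f) ((integrableOn_norm_sq f).const_mul C), ← integral_const_mul]
  refine setIntegral_mono_on (integrableOn_energy f
    (Φ := fun a b c => ‖a‖ ^ 2 + ‖b‖ ^ 2 + ‖c‖ ^ 2) (by fun_prop) (by simp)) (hi.const_mul _)
    measurableSet_strip fun p hp => ?_
  have h1 := norm_sq_valX_le f hp
  have h2 := norm_sq_valT_le f hp
  have h3 : val f p = lift (f : ModularCurve → ℂ) (chart p) := by rw [val, clamp_eq hp]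
  have him := chart_im_pos hp
  rw [h3]
  set N := ‖lift (f : ModularCurve → ℂ) (chart p)‖ ^ 2 with hN
  set G := gradSq f (chart p) with hG
  set r := ((chart p).im ^ 2)⁻¹ with hr
  have hN0 : 0 ≤ N := sq_nonneg _
  have hG0 : 0 ≤ G := (sq_nonneg _).trans h2
  have h4 : c ≤ r * (lift q (chart p) + C) := by
    have h5 := mul_le_mul_of_nonneg_left (h p hp) (inv_nonneg.2 (sq_nonneg (chart p).im))
    refine le_trans (le_of_eq ?_) h5
    field_simp
  have h6 : c * N ≤ r * (lift q (chart p) + C) * N := mul_le_mul_of_nonneg_right h4 hN0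
  have hci : 0 < c⁻¹ := inv_pos.2 hc
  have h7 : N ≤ c⁻¹ * (r * (lift q (chart p) + C) * N) := by
    rw [← div_le_iff₀' hci, div_inv_eq_mul, mul_comm]
    exact h6
  have h8 : 0 ≤ r * (lift q (chart p) + C) * N := (mul_nonneg hc.le hN0).trans h6
  have h9 : G + r * lift q (chart p) * N + C * (r * N) =
      G + r * (lift q (chart p) + C) * N := by ring
  have h10 : 0 ≤ c⁻¹ * G := mul_nonneg hci.le hG0
  change _ ≤ (3 + c⁻¹) * (G + r * lift q (chart p) * N + C * (r * N))
  rw [h9]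
  nlinarith

/-- Above t = T the potential controls |f|², but below it q may vanish. There f is recovered on each
vertical line from its value at T and its vertical derivative, by a Poincaré inequality. -/
theorem exists_norm_sq_le (q : ModularCurve → ℝ) (hq : IsSmooth q) (hgrowth : GrowsInCusp q) (h0 : ∀ p, 0 ≤ q p) :
    ∃ K : ℝ, 0 < K ∧ ∀ f : TestFn,
      ‖toL2 f‖ ^ 2 ≤ K * (⟪toL2 (hamiltonian q hq f), toL2 f⟫_ℂ).re := by
  obtain ⟨c, hc, Y, hY⟩ := hgrowth
  set T := max Y 0 with hT
  have hT0 : 0 ≤ T := le_max_right _ _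
  -- The summands are the cost of the value at T (bounded from the part above T), of the vertical
  -- derivative below T, and of |f|² above T. The later factor 4 bounds the density y⁻².
  set K := 2 * T * (c⁻¹ + 1) + 4 * T ^ 2 + c⁻¹ with hK
  have hci : 0 < c⁻¹ := inv_pos.2 hc
  have hK0 : 0 < K := by positivity
  refine ⟨4 * K, by positivity, fun f => ?_⟩
  have hf := TestFn.smooth f
  obtain ⟨M', hM0', hM'⟩ := TestFn.exists_val_eq_zero f
  obtain ⟨M'', hM0'', hM''⟩ := TestFn.exists_lift_eq_zero f
  set M := T + M' + M'' + 1 with hM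
  have hM0 : 0 ≤ M := by positivity
  have hTM : T ≤ M := by linarith
  have hc1 := continuous_val hf
  have hc3 := continuous_valT hf
  set Ψ : ℝ × ℝ → ℝ := fun p => gradSq f (chart p) +
    ((chart p).im ^ 2)⁻¹ * lift q (chart p) * ‖lift (f : ModularCurve → ℂ) (chart p)‖ ^ 2 with hΨ
  have hq0 : ∀ w, 0 ≤ lift q w := fun w => h0 _
  have hΨT : ∀ p ∈ strip, ‖valT f p‖ ^ 2 ≤ Ψ p := by
    intro p hp
    refine (norm_sq_valT_le f hp).trans (le_add_of_nonneg_right ?_)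
    have := hq0 (chart p)
    positivity
  have hΨ0 : ∀ p ∈ strip, 0 ≤ Ψ p := fun p hp => (sq_nonneg _).trans (hΨT p hp)
  have hΨV : ∀ p ∈ strip, T ≤ p.2 → ‖val f p‖ ^ 2 ≤ c⁻¹ * Ψ p := by
    intro p hp hpT
    have him := chart_im_pos hp
    have h2 := hY ⟨chart p, him⟩ (((le_max_left _ _).trans hpT).trans le_chart_im)
    have h3 : lift q (chart p) = q (proj ⟨chart p, him⟩) := lift_coe q ⟨chart p, him⟩
    rw [val, clamp_eq hp, ← div_le_iff₀' hci, div_inv_eq_mul, mul_comm]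
    have h4 : c ≤ ((chart p).im ^ 2)⁻¹ * lift q (chart p) := by
      rw [h3]
      have h5 := mul_le_mul_of_nonneg_left h2 (inv_nonneg.2 (sq_nonneg (chart p).im))
      refine le_trans (le_of_eq ?_) h5
      change c = ((chart p).im ^ 2)⁻¹ * (c * (chart p).im ^ 2)
      field_simp
    have h6 := mul_le_mul_of_nonneg_right h4 (sq_nonneg ‖lift (f : ModularCurve → ℂ) (chart p)‖)
    refine h6.trans (le_add_of_nonneg_left ?_)
    exact add_nonneg (sq_nonneg _) (sq_nonneg _)
  have hΨc : ContinuousOn Ψ strip := by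
    have hqc : ContinuousOn (fun p => lift q (chart p)) strip :=
      continuousOn_comp_chart (ContDiffOn.continuousOn hq)
    have hfc : ContinuousOn (fun p => lift (f : ModularCurve → ℂ) (chart p)) strip :=
      continuousOn_comp_chart hf.continuousOn
    exact (continuousOn_gradSq hf).add
      ((continuousOn_inv_chart_im_sq.mul hqc).mul (hfc.norm.pow 2))
  have hΨcc : Continuous fun p => Ψ (clamp p) := continuous_comp_clamp hΨc
  have hslice : ∀ x ∈ Set.Ioo (-(1 / 2) : ℝ) (1 / 2), ∫ t in (0 : ℝ)..M, ‖val f (x, t)‖ ^ 2 ≤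
      ∫ t in (0 : ℝ)..M, K * Ψ (clamp (x, t)) := by
    intro x hx
    have hmem : ∀ {t : ℝ}, 0 ≤ t → (x, t) ∈ strip := fun ht => ⟨⟨hx.1.le, hx.2.le⟩, ht⟩
    have hcl : ∀ {t : ℝ}, 0 ≤ t → clamp (x, t) = (x, t) := fun ht => clamp_eq (hmem ht)
    have i1 : ∀ a b, IntervalIntegrable (fun t => ‖val f (x, t)‖ ^ 2) volume a b :=
      fun a b => Continuous.intervalIntegrable (by fun_prop) _ _
    have i2 : ∀ a b, IntervalIntegrable (fun t => ‖valT f (x, t)‖ ^ 2) volume a b :=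
      fun a b => Continuous.intervalIntegrable (by fun_prop) _ _
    have i3 : ∀ a b, IntervalIntegrable (fun t => Ψ (clamp (x, t))) volume a b :=
      fun a b => (hΨcc.comp (continuous_const.prodMk continuous_id)).intervalIntegrable _ _
    set I := ∫ t in (0 : ℝ)..M, Ψ (clamp (x, t)) with hI
    have hd : ∀ t, 0 < t → HasDerivAt (fun t => val f (x, t)) (valT f (x, t)) t :=
      fun t ht => hasDerivAt_valT hf hx ht
    have hTI : ∫ t in T..M, Ψ (clamp (x, t)) ≤ I :=
      intervalIntegral.integral_mono_interval hT0 hTM le_rfl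
        (ae_of_all _ fun t => hΨ0 _ (clamp_mem _)) (i3 _ _)
    have b1 : ∫ t in T..M, ‖val f (x, t)‖ ^ 2 ≤ c⁻¹ * I := by
      refine le_trans ?_ (mul_le_mul_of_nonneg_left hTI hci.le)
      rw [← intervalIntegral.integral_const_mul]
      refine intervalIntegral.integral_mono_on hTM (i1 _ _) ((i3 _ _).const_mul _) fun t ht => ?_
      rw [hcl (hT0.trans ht.1)]
      exact hΨV _ (hmem (hT0.trans ht.1)) ht.1
    have b2 : ∫ t in T..M, ‖valT f (x, t)‖ ^ 2 ≤ I := by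
      refine le_trans ?_ hTI
      refine intervalIntegral.integral_mono_on hTM (i2 _ _) (i3 _ _) fun t ht => ?_
      rw [hcl (hT0.trans ht.1)]
      exact hΨT _ (hmem (hT0.trans ht.1))
    have b3 : ∫ t in (0 : ℝ)..T, ‖valT f (x, t)‖ ^ 2 ≤ I := by
      refine le_trans (intervalIntegral.integral_mono_on hT0 (i2 _ _) (i3 _ _) fun t ht => ?_)
        (intervalIntegral.integral_mono_interval le_rfl hT0 hTM
          (ae_of_all _ fun t => hΨ0 _ (clamp_mem _)) (i3 _ _))
      rw [hcl ht.1]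
      exact hΨT _ (hmem ht.1)
    have b4 := norm_sq_left_le (v := fun t => val f (x, t)) (v' := fun t => valT f (x, t))
      (by fun_prop) (by fun_prop) hTM (fun t ht => hd t (hT0.trans_lt ht.1))
      (hM' (x, M) (by simp only [hM]; linarith)).1
    rw [intervalIntegral.integral_add (i1 _ _) (i2 _ _)] at b4
    have b5 := integral_norm_sq_le (v := fun t => val f (x, t)) (v' := fun t => valT f (x, t))
      (by fun_prop) (by fun_prop) hT0 (fun t ht => hd t ht.1)
    rw [sub_zero] at b5
    rw [← intervalIntegral.integral_add_adjacent_intervals (i1 0 T) (i1 T M),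
      intervalIntegral.integral_const_mul, ← hI]
    have b6 : 2 * T * ‖val f (x, T)‖ ^ 2 ≤ 2 * T * (c⁻¹ * I + I) :=
      mul_le_mul_of_nonneg_left (by linarith) (by linarith)
    have b7 : 4 * T ^ 2 * ∫ t in (0 : ℝ)..T, ‖valT f (x, t)‖ ^ 2 ≤ 4 * T ^ 2 * I :=
      mul_le_mul_of_nonneg_left b3 (by positivity)
    have b8 : K * I = 2 * T * (c⁻¹ * I + I) + 4 * T ^ 2 * I + c⁻¹ * I := by rw [hK]; ring
    linarith
  have hform : ∫ p in strip, Ψ p =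
      ∫ x in (-(1 / 2) : ℝ)..(1 / 2), ∫ t in (0 : ℝ)..M, Ψ (clamp (x, t)) := by
    rw [← setIntegral_strip hΨcc.continuousOn hM0]
    · exact setIntegral_congr_fun measurableSet_strip fun p hp => by simp only [clamp_eq hp]
    · intro p hp hpM
      have h1 : M'' < (chart p).im := by linarith [le_chart_im (p := p)]
      rw [clamp_eq hp, hΨ]
      simp only
      rw [hM'' _ h1.le, gradSq, fderiv_eq_zero_of_height hM'' h1]
      simp
  have hval : ∫ p in strip, ‖val f p‖ ^ 2 =
      ∫ x in (-(1 / 2) : ℝ)..(1 / 2), ∫ t in (0 : ℝ)..M, ‖val f (x, t)‖ ^ 2 := by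
    rw [← setIntegral_strip (Φ := fun p => ‖val f p‖ ^ 2) (by fun_prop) hM0]
    intro p _ hpM
    rw [(hM' p (by linarith)).1]
    simp
  have hvK : ∫ p in strip, ‖val f p‖ ^ 2 ≤ K * ∫ p in strip, Ψ p := by
    rw [hval, hform, ← intervalIntegral.integral_const_mul]
    refine intervalIntegral.integral_mono_on_of_le_Ioo (by norm_num)
      ((continuous_inner_integral' (Φ := fun p => ‖val f p‖ ^ 2) (by fun_prop) _ _).intervalIntegrable
        _ _) (((continuous_inner_integral' hΨcc _ _).const_mul _).intervalIntegrable _ _)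
      fun x hx => ?_
    rw [← intervalIntegral.integral_const_mul]
    exact hslice x hx
  rw [re_inner_hamiltonian, norm_sq_toL2, mul_assoc]
  refine le_trans ?_ (mul_le_mul_of_nonneg_left hvK (by norm_num))
  rw [← integral_const_mul]
  refine setIntegral_mono_on (integrableOn_norm_sq f) ((integrableOn_energy f
    (Φ := fun a b c => ‖a‖ ^ 2) (by fun_prop) (by simp)).const_mul 4) measurableSet_strip
    fun p hp => ?_
  have h1 := density_le (p := p) hp.2
  rw [density, clamp_eq hp] at h1
  rw [val, clamp_eq hp]
  refine mul_le_mul_of_nonneg_right (h1.trans ?_) (sq_nonneg _)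
  have h2 : (0 : ℝ) ≤ p.2 := hp.2
  exact div_le_self (by norm_num) (one_le_pow₀ (by linarith))

end Form

end AutomorphicHamiltonian

namespace AutomorphicHamiltonian

/-! ### Density of the test functions -/

/-- The interior of the half-strip, which parametrizes the interior of the fundamental domain. -/
def openStrip : Set (ℝ × ℝ) := Set.Ioo (-(1 / 2)) (1 / 2) ×ˢ Set.Ioi 0

theorem isOpen_openStrip : IsOpen openStrip := isOpen_Ioo.prod isOpen_Ioi

theorem openStrip_subset_strip : openStrip ⊆ strip :=
  Set.prod_mono Set.Ioo_subset_Icc_self Set.Ioi_subset_Ici_self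

theorem openStrip_ae_eq_strip : openStrip =ᵐ[volume] strip :=
  Measure.set_prod_ae_eq Ioo_ae_eq_Icc Ioi_ae_eq_Ici

theorem ofComplex_chart_mem_fdo {p : ℝ × ℝ} (hp : p ∈ openStrip) : ofComplex (chart p) ∈ 𝒟ᵒ := by
  have hs := openStrip_subset_strip hp
  have him := chart_im_pos hs
  rw [ofComplex_apply_of_im_pos him]
  refine ⟨?_, abs_lt.2 ⟨hp.1.1, hp.1.2⟩⟩
  change 1 < Complex.normSq (chart p)
  rw [Complex.normSq_apply, chart_re, chart_im]
  have h1 := arcHeight_sq hs.1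
  have h2 := half_lt_arcHeight hs.1
  have h3 : 0 < p.2 := hp.2
  nlinarith

/-- One ε serves for all translates of K, since the group acts by isometries. -/
theorem exists_thickening_smul_mem_fdo {K : Set ℍ} (hK : IsCompact K) (hKD : K ⊆ 𝒟ᵒ) :
    ∃ ε : ℝ, 0 < ε ∧ ∀ z : ℍ, ∀ γ : SL(2, ℤ), ∀ w : ℍ, γ • w ∈ K → dist z w < ε → γ • z ∈ 𝒟ᵒ := by
  obtain ⟨ε, hε, h⟩ := hK.exists_thickening_subset_open ModularGroup.isOpen_fdo hKD
  refine ⟨ε, hε, fun z γ w hw hd => h (Metric.mem_thickening_iff.2 ⟨γ • w, hw, ?_⟩)⟩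
  exact (dist_smul (Matrix.SpecialLinearGroup.map (Int.castRingHom ℝ) γ) z w).trans_lt hd

/-- The complement of the orbit of K is open: near a point with a translate in 𝒟ᵒ, equivalent points
of 𝒟ᵒ coincide and it suffices that K is closed; a point with no such translate stays at a definite
distance from the orbit of K. Closedness is what makes extension by zero from 𝒟ᵒ smooth. -/
theorem isClosed_proj_image {K : Set ℍ} (hK : IsCompact K) (hKD : K ⊆ 𝒟ᵒ) :
    IsClosed (proj '' K) := by
  refine (isQuotientMap_quotient_mk'.isClosed_preimage (f := proj)).1 ?_
  rw [← isOpen_compl_iff, isOpen_iff_mem_nhds]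
  intro z hz
  by_cases h : ∃ γ : SL(2, ℤ), γ • z ∈ 𝒟ᵒ
  · obtain ⟨γ, hγ⟩ := h
    have h1 : 𝒟ᵒ \ K ∈ 𝓝 (γ • z) := by
      refine (ModularGroup.isOpen_fdo.sdiff hK.isClosed).mem_nhds ⟨hγ, fun hK' => hz ?_⟩
      exact ⟨γ • z, hK', proj_smul γ z⟩
    filter_upwards [(continuous_const_smul γ).continuousAt.preimage_mem_nhds h1] with w hw
    rintro ⟨k, hk, hkw⟩
    obtain ⟨g, hg⟩ := exists_smul_of_proj_eq (hkw.trans (proj_smul γ w).symm)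
    have := ModularGroup.eq_smul_self_of_mem_fdo_mem_fdo hw.1 (hg ▸ hKD hk)
    exact hw.2 (by rw [this, hg]; exact hk)
  · obtain ⟨ε, hε, hεK⟩ := exists_thickening_smul_mem_fdo hK hKD
    filter_upwards [Metric.ball_mem_nhds z hε] with w hw
    rintro ⟨k, hk, hkw⟩
    obtain ⟨g, hg⟩ := exists_smul_of_proj_eq hkw
    exact h ⟨g, hεK z g w (hg ▸ hk) (by rw [dist_comm]; exact hw)⟩

/-- The coordinates `(x, t)` of a point of the upper half-plane. -/
noncomputable def chartInv (z : ℂ) : ℝ × ℝ := (z.re, z.im - arcHeight z.re)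

theorem chartInv_chart (p : ℝ × ℝ) : chartInv (chart p) = p := by simp [chartInv, chart]

theorem chart_chartInv (z : ℂ) : chart (chartInv z) = z := by
  apply Complex.ext <;> simp [chartInv, chart]

theorem contDiffAt_chartInv {z : ℂ} (hz : |z.re| < 1 / 2) : ContDiffAt ℝ ∞ chartInv z := by
  have hre : ContDiffAt ℝ ∞ (fun z : ℂ => z.re) z := Complex.reCLM.contDiff.contDiffAt
  have him : ContDiffAt ℝ ∞ (fun z : ℂ => z.im) z := Complex.imCLM.contDiff.contDiffAt
  refine hre.prodMk (him.sub (ContDiffAt.sqrt (contDiffAt_const.sub (hre.pow 2)) ?_))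
  have h := abs_lt.1 hz
  have : 0 < 1 - z.re ^ 2 := by nlinarith [h.1, h.2]
  exact this.ne'

open Classical in
/-- The function on the modular curve which is `g` in the coordinates `(x, t)` on the interior of
the fundamental domain. -/
noncomputable def ofChart (g : ℝ × ℝ → ℝ) : ModularCurve → ℂ := fun p =>
  if h : ∃ z ∈ 𝒟ᵒ, proj z = p then ((g (chartInv (h.choose : ℍ)) : ℝ) : ℂ) else 0

/-- The representative chosen in the definition is irrelevant, since equivalent points of 𝒟ᵒ are
equal. -/
theorem ofChart_proj (g : ℝ × ℝ → ℝ) {z : ℍ} (hz : z ∈ 𝒟ᵒ) :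
    ofChart g (proj z) = (g (chartInv z) : ℝ) := by
  have h : ∃ w ∈ 𝒟ᵒ, proj w = proj z := ⟨z, hz, rfl⟩
  rw [ofChart, dif_pos h]
  obtain ⟨γ, hγ⟩ := exists_smul_of_proj_eq h.choose_spec.2
  have h1 := ModularGroup.eq_smul_self_of_mem_fdo_mem_fdo hz (hγ ▸ h.choose_spec.1)
  rw [← hγ, ← h1]

/-- The image in the upper half-plane of the support of `g`. -/
def chartSupport (g : ℝ × ℝ → ℝ) : Set ℍ := (fun p => ofComplex (chart p)) '' tsupport g

theorem chartSupport_subset {g : ℝ × ℝ → ℝ} (hU : tsupport g ⊆ openStrip) :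
    chartSupport g ⊆ 𝒟ᵒ := by
  rintro _ ⟨p, hp, rfl⟩
  exact ofComplex_chart_mem_fdo (hU hp)

theorem isCompact_chartSupport {g : ℝ × ℝ → ℝ} (hc : HasCompactSupport g)
    (hU : tsupport g ⊆ openStrip) : IsCompact (chartSupport g) := by
  refine IsCompact.image_of_continuousOn hc fun p hp => ?_
  have := (contMDiffAt_ofComplex (n := 0)
    (chart_im_pos (openStrip_subset_strip (hU hp)))).continuousAt
  exact (ContinuousAt.comp (f := chart) this continuous_chart.continuousAt).continuousWithinAt

theorem ofChart_eq_zero {g : ℝ × ℝ → ℝ} {p : ModularCurve} (hp : p ∉ proj '' chartSupport g) :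
    ofChart g p = 0 := by
  by_cases h : ∃ z ∈ 𝒟ᵒ, proj z = p
  · obtain ⟨z, hz, rfl⟩ := h
    rw [ofChart_proj g hz]
    by_contra h0
    have h1 : chartInv z ∈ tsupport g := subset_tsupport g fun h => h0 (by rw [h]; simp)
    exact hp ⟨z, ⟨chartInv z, h1, by simp [chart_chartInv]⟩, rfl⟩
  · rw [ofChart, dif_neg h]

/-- Near a point equivalent to the support, a fixed γ moves a neighbourhood into 𝒟ᵒ, where the lift
is g in smooth coordinates. Near any other point the function vanishes identically, the image of the
support being closed. -/
theorem isSmooth_ofChart {g : ℝ × ℝ → ℝ} (hg : ContDiff ℝ ∞ g) (hc : HasCompactSupport g)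
    (hU : tsupport g ⊆ openStrip) : IsSmooth (ofChart g) := by
  intro w hw
  refine ContDiffAt.contDiffWithinAt ?_
  obtain ⟨z, rfl⟩ : ∃ z : ℍ, (z : ℂ) = w := ⟨⟨w, hw⟩, rfl⟩
  by_cases hz : proj z ∈ proj '' chartSupport g
  · obtain ⟨k, hk, hkz⟩ := hz
    obtain ⟨γ, hγ⟩ := exists_smul_of_proj_eq hkz
    have hkD := chartSupport_subset hU hk
    have hdet1 : (γ : GL (Fin 2) ℝ).val.det = 1 :=
      (Matrix.SpecialLinearGroup.map (Int.castRingHom ℝ) γ).2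
    have hdet : (0 : ℝ) < (γ : GL (Fin 2) ℝ).val.det := by rw [hdet1]; exact one_pos
    have hφ := ((analyticAt_smul hdet z).contDiffAt (n := ∞)).restrict_scalars ℝ
    have hcont : ContinuousAt (fun w : ℂ => γ • ofComplex w) (z : ℂ) :=
      (continuous_const_smul γ).continuousAt.comp
        (contMDiffAt_ofComplex (n := 0) z.im_pos).continuousAt
    have hev : ∀ᶠ w : ℂ in 𝓝 (z : ℂ), γ • ofComplex w ∈ 𝒟ᵒ := by
      refine hcont.eventually (ModularGroup.isOpen_fdo.mem_nhds ?_)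
      simpa only [ofComplex_apply, hγ] using hkD
    have h2 : ContDiffAt ℝ ∞ (fun w : ℂ => ((g (chartInv w) : ℝ) : ℂ)) (k : ℂ) :=
      Complex.ofRealCLM.contDiff.contDiffAt.comp _
        (hg.contDiffAt.comp _ (contDiffAt_chartInv hkD.2))
    have h3 := ContDiffAt.comp (z : ℂ) (f := fun w : ℂ => ((γ • ofComplex w : ℍ) : ℂ))
      (by simp only [ofComplex_apply, hγ]; exact h2) hφ
    refine h3.congr_of_eventuallyEq ?_
    filter_upwards [hev] with w hw
    rw [lift, ← proj_smul γ, ofChart_proj g hw]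
    rfl
  · have h1 : (proj '' chartSupport g)ᶜ ∈ 𝓝 (proj z) :=
      (isClosed_proj_image (isCompact_chartSupport hc hU) (chartSupport_subset hU)).isOpen_compl.mem_nhds
        hz
    have h2 : ContinuousAt (fun w : ℂ => proj (ofComplex w)) (z : ℂ) :=
      continuousOn_proj_ofComplex.continuousAt (isOpen_upperHalfPlaneSet.mem_nhds z.im_pos)
    refine (contDiffAt_const (c := (0 : ℂ))).congr_of_eventuallyEq ?_
    filter_upwards [h2.preimage_mem_nhds (by simpa using h1)] with w hw
    exact ofChart_eq_zero hw

theorem hasCompactSupport_ofChart {g : ℝ × ℝ → ℝ} (hc : HasCompactSupport g)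
    (hU : tsupport g ⊆ openStrip) : HasCompactSupport (ofChart g) := by
  have hK := isCompact_chartSupport hc hU
  refine (hK.image continuous_proj).of_isClosed_subset (isClosed_tsupport _)
    (closure_minimal (fun p hp => ?_) (isClosed_proj_image hK (chartSupport_subset hU)))
  by_contra h
  exact hp (ofChart_eq_zero h)

theorem lift_ofChart (g : ℝ × ℝ → ℝ) {p : ℝ × ℝ} (hp : p ∈ openStrip) :
    lift (ofChart g) (chart p) = (g p : ℝ) := by
  rw [lift, ofChart_proj g (ofComplex_chart_mem_fdo hp),
    ofComplex_apply_of_im_pos (chart_im_pos (openStrip_subset_strip hp))]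
  change ((g (chartInv (chart p)) : ℝ) : ℂ) = _
  rw [chartInv_chart]

theorem integrableOn_of_integrable {F : ModularCurve → ℂ} (hF : Integrable F modularMeasure) :
    IntegrableOn (fun p => ((chart p).im ^ 2)⁻¹ • lift F (chart p)) strip := by
  have hm : Measurable fun p : ℝ × ℝ => (1 / ‖(chart p).im‖₊) ^ 2 :=
    (measurable_const.div
      (Complex.continuous_im.comp continuous_chart).measurable.nnnorm).pow_const 2
  have h1 := hF
  rw [modularMeasure_eq, integrable_map_measure (by rw [← modularMeasure_eq]; exact hF.1)
    measurable_proj_chart.aemeasurable, integrable_withDensity_iff_integrable_smul hm] at h1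
  refine h1.congr (ae_of_all _ fun p => ?_)
  simp only [NNReal.smul_def, lift, Function.comp]
  congr 1
  simp

theorem ae_eq_zero_of_lift {F : ModularCurve → ℂ} (hF : Measurable F)
    (h : ∀ᵐ p ∂volume, p ∈ openStrip → lift F (chart p) = 0) : F =ᵐ[modularMeasure] 0 := by
  rw [modularMeasure_eq]
  refine (ae_map_iff measurable_proj_chart.aemeasurable
    (hF (measurableSet_singleton (0 : ℂ)))).2 ?_
  refine (withDensity_absolutelyContinuous _ _) ?_
  change ∀ᵐ p ∂volume.restrict strip, lift F (chart p) = 0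
  rw [← Measure.restrict_congr_set openStrip_ae_eq_strip]
  exact (ae_restrict_iff' isOpen_openStrip.measurableSet).2 h

/-- Test functions are dense in `L²`. -/
theorem dense_range_toL2 : Dense (LinearMap.range toL2 : Set L2) := by
  rw [Submodule.dense_iff_topologicalClosure_eq_top, Submodule.topologicalClosure_eq_top_iff,
    Submodule.eq_bot_iff]
  intro h hh
  have hmeas : Measurable (h : ModularCurve → ℂ) := (Lp.stronglyMeasurable h).measurable
  have hint : Integrable (h : ModularCurve → ℂ) modularMeasure :=
    (Lp.memLp h).integrable one_le_two
  have hΦ := integrableOn_of_integrable hint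
  set Φ : ℝ × ℝ → ℂ := fun p => ((chart p).im ^ 2)⁻¹ • lift (h : ModularCurve → ℂ) (chart p)
    with hΦd
  -- The fundamental lemma of the calculus of variations: every smooth g supported in the open strip
  -- comes from a test function, to which h is orthogonal. The open strip has full measure in the
  -- strip.
  have key : ∀ᵐ p ∂(volume : Measure (ℝ × ℝ)), p ∈ openStrip → Φ p = 0 := by
    refine isOpen_openStrip.ae_eq_zero_of_integral_contDiff_smul_eq_zero
      (hΦ.mono_set openStrip_subset_strip).locallyIntegrableOn fun g hg hc hU => ?_
    set f : TestFn := ⟨ofChart g, isSmooth_ofChart hg hc hU, hasCompactSupport_ofChart hc hU⟩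
      with hf
    have h1 : ⟪toL2 f, h⟫_ℂ = 0 := hh _ ⟨f, rfl⟩
    have h2 : ⟪toL2 f, h⟫_ℂ =
        ∫ p, ⟪ofChart g p, (h : ModularCurve → ℂ) p⟫_ℂ ∂modularMeasure := by
      rw [L2.inner_def]
      refine integral_congr_ae ?_
      filter_upwards [MemLp.coeFn_toLp (TestFn.memLp f)] with p hp
      exact congrArg (fun a => ⟪a, (h : ModularCurve → ℂ) p⟫_ℂ) hp
    rw [h2, integral_modularMeasure, ← setIntegral_congr_set openStrip_ae_eq_strip] at h1
    · rw [← h1, ← setIntegral_eq_integral_of_forall_compl_eq_zero (s := openStrip)]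
      · refine setIntegral_congr_fun isOpen_openStrip.measurableSet fun p hp => ?_
        have h3 := lift_ofChart g hp
        rw [lift] at h3
        simp only [hΦd, lift, h3, RCLike.inner_apply, Complex.conj_ofReal, Complex.real_smul]
        ring
      · intro p hp
        rw [image_eq_zero_of_notMem_tsupport fun h => hp (hU h), zero_smul]
    · exact (TestFn.memLp f).1.inner (Lp.aestronglyMeasurable h)
  refine (Lp.eq_zero_iff_ae_eq_zero).2 (ae_eq_zero_of_lift hmeas ?_)
  filter_upwards [key] with p hp hpU
  have him := chart_im_pos (openStrip_subset_strip hpU)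
  exact (smul_eq_zero.1 (hp hpU)).resolve_left (by positivity)

end AutomorphicHamiltonian

namespace AutomorphicHamiltonian

/-! ### The Hamiltonian as an operator on `L²` -/

theorem isFormalAdjoint_hamiltonianL2 (q : ModularCurve → ℝ) (hq : IsSmooth q) :
    (hamiltonianL2 q hq).IsFormalAdjoint (hamiltonianL2 q hq) := by
  rintro ⟨_, f, rfl⟩ ⟨_, g, rfl⟩
  rw [hamiltonianL2_apply, hamiltonianL2_apply]
  exact inner_hamiltonian_symm q hq f g

theorem forall_domain_hamiltonianL2 (q : ModularCurve → ℝ) (hq : IsSmooth q) (c : ℝ) :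
    (∀ x : (hamiltonianL2 q hq).domain,
      c * ‖(x : L2)‖ ^ 2 ≤ (⟪hamiltonianL2 q hq x, (x : L2)⟫_ℂ).re) ↔
    ∀ f : TestFn, c * ‖toL2 f‖ ^ 2 ≤ (⟪toL2 (hamiltonian q hq f), toL2 f⟫_ℂ).re := by
  constructor
  · intro h f
    have := h ⟨toL2 f, ⟨f, rfl⟩⟩
    rwa [hamiltonianL2_apply] at this
  · rintro h ⟨_, f, rfl⟩
    rw [hamiltonianL2_apply]
    exact h f

theorem IsSmooth.add_const {q : ModularCurve → ℝ} (hq : IsSmooth q) (C : ℝ) :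
    IsSmooth fun p => q p + C :=
  ContDiffOn.add (f := lift q) hq contDiffOn_const

theorem hamiltonian_add_const (q : ModularCurve → ℝ) (hq : IsSmooth q) (C : ℝ) (f : TestFn) :
    hamiltonian (fun p => q p + C) (hq.add_const C) f = hamiltonian q hq f + (C : ℂ) • f := by
  ext p
  change -hypLaplacian f p + ((q p + C : ℝ) : ℂ) * (f : ModularCurve → ℂ) p =
    (-hypLaplacian f p + (q p : ℂ) * (f : ModularCurve → ℂ) p) + C * (f : ModularCurve → ℂ) p
  push_cast
  ring

theorem energy_nonneg (f : ModularCurve → ℂ) : 0 ≤ energy f :=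
  integral_nonneg fun _ => by positivity

theorem GrowsInCusp.exists_neg_mul_le {q : ModularCurve → ℝ} (hgrowth : GrowsInCusp q)
    (hq : IsSmooth q) : ∃ C : ℝ, 0 ≤ C ∧
      ∀ f : TestFn, -C * ‖toL2 f‖ ^ 2 ≤ (⟪toL2 (hamiltonian q hq f), toL2 f⟫_ℂ).re := by
  obtain ⟨c, hc, C, h⟩ := hgrowth.exists_add_ge hq
  refine ⟨|C|, abs_nonneg C, fun f => ?_⟩
  have h1 := (energy_nonneg f).trans (energy_le q hq hc h f)
  have h2 : 0 < 3 + c⁻¹ := by positivity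
  have h3 := nonneg_of_mul_nonneg_right h1 h2
  have h4 := mul_le_mul_of_nonneg_right (le_abs_self C) (sq_nonneg ‖toL2 f‖)
  linarith

/-- The positive lower bound absorbs the term C ‖f‖² of `energy_le`, so no shift of the operator is
needed. -/
theorem GrowsInCusp.exists_energy_le {q : ModularCurve → ℝ} (hgrowth : GrowsInCusp q)
    (hq : IsSmooth q) {δ : ℝ} (hδ : 0 < δ)
    (hpos : ∀ f : TestFn, δ * ‖toL2 f‖ ^ 2 ≤ (⟪toL2 (hamiltonian q hq f), toL2 f⟫_ℂ).re) :
    ∃ K : ℝ, 0 ≤ K ∧ ∀ f : TestFn,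
      energy f ≤ K * (⟪toL2 (hamiltonian q hq f), toL2 f⟫_ℂ).re := by
  obtain ⟨c, hc, C, h⟩ := hgrowth.exists_add_ge hq
  refine ⟨(3 + c⁻¹) * (1 + |C| * δ⁻¹), by positivity, fun f => ?_⟩
  refine (energy_le q hq hc h f).trans ?_
  rw [mul_assoc]
  refine mul_le_mul_of_nonneg_left ?_ (by positivity)
  have h1 := mul_le_mul_of_nonneg_right (le_abs_self C) (sq_nonneg ‖toL2 f‖)
  have h2 : ‖toL2 f‖ ^ 2 ≤ δ⁻¹ * (⟪toL2 (hamiltonian q hq f), toL2 f⟫_ℂ).re := by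
    rw [← div_le_iff₀' (inv_pos.2 hδ), div_inv_eq_mul, mul_comm]
    exact hpos f
  have h3 := mul_le_mul_of_nonneg_left h2 (abs_nonneg C)
  linarith

/-! ### The inner products `⟨Sⁿ f, g⟩` -/

section Powers

variable (q : ModularCurve → ℝ) (hq : IsSmooth q)

theorem inner_hamiltonian_pow (n : ℕ) (f g : TestFn) :
    ⟪toL2 ((hamiltonian q hq ^ n) f), toL2 g⟫_ℂ = ⟪toL2 f, toL2 ((hamiltonian q hq ^ n) g)⟫_ℂ := by
  induction n generalizing f g with
  | zero => rfl
  | succ n ih =>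
    rw [pow_succ', Module.End.mul_apply, inner_hamiltonian_symm, ih, ← Module.End.mul_apply,
      ← pow_succ, ← pow_succ']

theorem sobolevForm_add (m k : ℕ) (f g : TestFn) :
    sobolevForm q hq (2 * m + k) f g =
      sobolevForm q hq k ((hamiltonian q hq ^ m) f) ((hamiltonian q hq ^ m) g) := by
  simp only [sobolevForm]
  rw [inner_hamiltonian_pow, ← Module.End.mul_apply, ← Module.End.mul_apply, ← pow_add, ← pow_add]
  congr 4
  ring

theorem sobolevForm_zero (f g : TestFn) : sobolevForm q hq 0 f g = ⟪toL2 f, toL2 g⟫_ℂ := rfl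

theorem sobolevForm_one (f g : TestFn) :
    sobolevForm q hq 1 f g = ⟪toL2 f, toL2 (hamiltonian q hq g)⟫_ℂ := by
  rw [sobolevForm, pow_one]

theorem re_inner_symm (f : TestFn) : (⟪toL2 f, toL2 (hamiltonian q hq f)⟫_ℂ).re =
    (⟪toL2 (hamiltonian q hq f), toL2 f⟫_ℂ).re := by
  rw [inner_hamiltonian_symm]

variable {q hq}

/-- By symmetry ⟨Sⁿ f, f⟩ is ‖Sᵐ f‖² for n = 2m and ⟨S Sᵐ f, Sᵐ f⟩ for n = 2m + 1. The lower bound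
makes S, hence Sᵐ, injective. -/
theorem isInnerForm {δ : ℝ} (hδ : 0 < δ)
    (hpos : ∀ f : TestFn, δ * ‖toL2 f‖ ^ 2 ≤ (⟪toL2 (hamiltonian q hq f), toL2 f⟫_ℂ).re) (n : ℕ) :
    IsInnerForm q hq n := by
  have hn : ∀ f : TestFn, f ≠ 0 → 0 < ‖toL2 f‖ ^ 2 := fun f hf => by
    have : toL2 f ≠ 0 := (map_ne_zero_iff _ toL2_injective).2 hf
    positivity
  have h1 : ∀ f : TestFn, f ≠ 0 → hamiltonian q hq f ≠ 0 := by
    intro f hf h0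
    have h2 := hpos f
    rw [h0] at h2
    simp only [map_zero, inner_zero_left, Complex.zero_re] at h2
    exact absurd h2 (not_le.2 (mul_pos hδ (hn f hf)))
  have hm : ∀ (m : ℕ) (f : TestFn), f ≠ 0 → (hamiltonian q hq ^ m) f ≠ 0 := by
    intro m
    induction m with
    | zero => exact fun f hf => hf
    | succ m ih =>
      intro f hf
      rw [pow_succ', Module.End.mul_apply]
      exact h1 _ (ih f hf)
  refine ⟨fun f g => ?_, fun f hf => ?_⟩
  · rw [sobolevForm, inner_conj_symm, inner_hamiltonian_pow, sobolevForm]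
  · rcases Nat.even_or_odd' n with ⟨m, rfl | rfl⟩
    · have h2 := sobolevForm_add q hq m 0 f f
      rw [add_zero] at h2
      rw [h2, sobolevForm_zero, inner_self_eq_norm_sq_to_K]
      norm_cast
      exact hn _ (hm m f hf)
    · rw [sobolevForm_add, sobolevForm_one, re_inner_symm]
      exact (mul_pos hδ (hn _ (hm m f hf))).trans_le (hpos _)

variable (q hq)

/-- `toSobolev` as a linear map. -/
noncomputable def toSobolevₗ (n : ℕ) (h : IsInnerForm q hq n) : TestFn →ₗ[ℂ] SobolevSpace q hq n h :=
  (UniformSpace.Completion.toComplₗᵢ (𝕜 := ℂ) (E := PreSobolev q hq n h)).toLinearMap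

variable {q hq}

theorem inner_toSobolevₗ {n : ℕ} (h : IsInnerForm q hq n) (f g : TestFn) :
    ⟪toSobolevₗ q hq n h f, toSobolevₗ q hq n h g⟫_ℂ = sobolevForm q hq n f g :=
  UniformSpace.Completion.inner_coe (E := PreSobolev q hq n h) f g

theorem denseRange_toSobolevₗ {n : ℕ} (h : IsInnerForm q hq n) :
    DenseRange (toSobolevₗ q hq n h) :=
  UniformSpace.Completion.denseRange_coe (α := PreSobolev q hq n h)

end Powers

/-! ### The form space and its embedding in `L²` -/

section FormSpace

variable {V : Type*} [NormedAddCommGroup V] [InnerProductSpace ℂ V]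

/-- `V` is the completion of the test functions for the form `⟨S f, g⟩`, and `J` is its natural map
to `L²`. -/
structure IsFormSpace (q : ModularCurve → ℝ) (hq : IsSmooth q) (ε : TestFn →ₗ[ℂ] V)
    (J : V →L[ℂ] L2) : Prop where
  dense : DenseRange ε
  inner_eq : ∀ f g, ⟪ε f, ε g⟫_ℂ = ⟪toL2 f, toL2 (hamiltonian q hq g)⟫_ℂ
  map_eq : ∀ f, J (ε f) = toL2 f

theorem norm_sq_eq_of_inner {F : Type*} [NormedAddCommGroup F] [InnerProductSpace ℂ F] {v : F}
    {a : ℂ} (h : ⟪v, v⟫_ℂ = a) : ‖v‖ ^ 2 = a.re := by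
  rw [← h, inner_self_eq_norm_sq_to_K]
  norm_cast

/-- The form space is V¹; the lower bound δ makes the inclusion in L² bounded by δ^(-1/2), so it
extends to the completion. -/
theorem exists_isFormSpace {q : ModularCurve → ℝ} {hq : IsSmooth q} {δ : ℝ} (hδ : 0 < δ)
    (hpos : ∀ f : TestFn, δ * ‖toL2 f‖ ^ 2 ≤ (⟪toL2 (hamiltonian q hq f), toL2 f⟫_ℂ).re) :
    ∃ J : SobolevSpace q hq 1 (isInnerForm hδ hpos 1) →L[ℂ] L2,
      IsFormSpace q hq (toSobolevₗ q hq 1 (isInnerForm hδ hpos 1)) J := by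
  set h := isInnerForm hδ hpos 1
  have hin : ∀ f g, ⟪toSobolevₗ q hq 1 h f, toSobolevₗ q hq 1 h g⟫_ℂ =
      ⟪toL2 f, toL2 (hamiltonian q hq g)⟫_ℂ := fun f g => by
    rw [inner_toSobolevₗ h, sobolevForm_one]
  refine ⟨toL2.extendOfNorm (toSobolevₗ q hq 1 h), denseRange_toSobolevₗ h, hin,
    LinearMap.extendOfNorm_eq (denseRange_toSobolevₗ h) ⟨√δ⁻¹, fun f => ?_⟩⟩
  refine abs_le_of_sq_le_sq' (b := √δ⁻¹ * ‖toSobolevₗ q hq 1 h f‖) ?_ (by positivity) |>.2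
  rw [mul_pow, Real.sq_sqrt (inv_pos.2 hδ).le, norm_sq_eq_of_inner (hin f f), re_inner_symm,
    ← div_le_iff₀' (inv_pos.2 hδ), div_inv_eq_mul, mul_comm]
  exact hpos f

theorem norm_le_of_norm_inner_le {F : Type*} [NormedAddCommGroup F] [InnerProductSpace ℂ F]
    {X : Type*} {e : X → F} (he : DenseRange e) {v : F} {A : ℝ} (hA : 0 ≤ A)
    (h : ∀ x, ‖⟪v, e x⟫_ℂ‖ ^ 2 ≤ A * ‖e x‖ ^ 2) : ‖v‖ ^ 2 ≤ A := by
  have h1 : ‖⟪v, v⟫_ℂ‖ ^ 2 ≤ A * ‖v‖ ^ 2 :=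
    he.induction_on (p := fun w => ‖⟪v, w⟫_ℂ‖ ^ 2 ≤ A * ‖w‖ ^ 2) v
      (isClosed_le (by fun_prop) (by fun_prop)) h
  rw [inner_self_eq_norm_sq_to_K] at h1
  rcases eq_or_ne v 0 with rfl | hv
  · simpa using hA
  · have h2 : 0 < ‖v‖ ^ 2 := by positivity
    simp only [norm_pow, RCLike.norm_ofReal, abs_norm] at h1
    exact le_of_mul_le_mul_right (by linarith [sq (‖v‖ ^ 2)]) h2

namespace IsFormSpace

variable {q : ModularCurve → ℝ} {hq : IsSmooth q} {ε : TestFn →ₗ[ℂ] V}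
  {J : V →L[ℂ] L2}

theorem norm_sq (h : IsFormSpace q hq ε J) (f : TestFn) :
    ‖ε f‖ ^ 2 = (⟪toL2 (hamiltonian q hq f), toL2 f⟫_ℂ).re := by
  rw [norm_sq_eq_of_inner (h.inner_eq f f), re_inner_symm]

/-- As a consequence J J* inverts S on test functions seen in L², and J* J does so on test functions
seen in V. -/
theorem adjoint_toL2_hamiltonian [CompleteSpace V] (h : IsFormSpace q hq ε J) (f : TestFn) :
    J.adjoint (toL2 (hamiltonian q hq f)) = ε f := by
  refine h.dense.eq_of_inner_right ℂ ?_
  intro g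
  rw [ContinuousLinearMap.adjoint_inner_right, h.map_eq, h.inner_eq]

/-- The norm of J* J ε f is the norm of the functional g ↦ ⟨f, g⟩ on V, so `exists_pairing_bound`
with B = K applies. One factor K bounds the energy of the family, the other that of g. -/
theorem summable_adjoint_comp_self [CompleteSpace V] (h : IsFormSpace q hq ε J) {K : ℝ} (hK : 0 ≤ K)
    (hE : ∀ f : TestFn, energy f ≤ K * (⟪toL2 (hamiltonian q hq f), toL2 f⟫_ℂ).re)
    {ι : Type*} (b : HilbertBasis ι ℂ V) : Summable fun i => ‖J.adjoint (J (b i))‖ ^ 2 := by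
  refine summable_norm_sq_of_dense (J.adjoint ∘L J) ε h.dense (64 * K * K) (fun s f hf => ?_) b
  obtain ⟨A, hA, hA2⟩ := exists_pairing_bound hK s f fun c => by
    refine (hE _).trans (mul_le_mul_of_nonneg_left ?_ hK)
    rw [← h.norm_sq]
    exact hf c
  have h1 : ∀ i ∈ s, ‖(J.adjoint ∘L J) (ε (f i))‖ ^ 2 ≤ A i * K := by
    intro i hi
    refine norm_le_of_norm_inner_le h.dense (mul_nonneg (hA2 i hi).1 hK) fun g => ?_
    rw [ContinuousLinearMap.comp_apply, ContinuousLinearMap.adjoint_inner_left, h.map_eq, h.map_eq,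
      h.norm_sq, mul_assoc]
    exact ((hA2 i hi).2 g).trans (mul_le_mul_of_nonneg_left (hE g) (hA2 i hi).1)
  refine (Finset.sum_le_sum h1).trans ?_
  rw [← Finset.sum_mul]
  exact mul_le_mul_of_nonneg_right hA hK

/-- The form space of `q + C` as a completion of the domain of `-Δ + q`. -/
theorem isFormCompletion {q : ModularCurve → ℝ} (hq : IsSmooth q) {C : ℝ}
    (h : IsFormSpace (fun p => q p + C) (hq.add_const C) ε J) :
    IsFormCompletion (hamiltonianL2 q hq) C J
      (ε ∘ₗ (LinearEquiv.ofInjective toL2 toL2_injective).symm.toLinearMap) := by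
  have hsymm : ∀ f : TestFn,
      (LinearEquiv.ofInjective toL2 toL2_injective).symm ⟨toL2 f, ⟨f, rfl⟩⟩ = f :=
    fun f => (LinearEquiv.symm_apply_eq _).mpr rfl
  have he : ∀ f : TestFn, (ε ∘ₗ (LinearEquiv.ofInjective toL2 toL2_injective).symm.toLinearMap)
      ⟨toL2 f, ⟨f, rfl⟩⟩ = ε f := fun f => congrArg ε (hsymm f)
  refine ⟨?_, ?_, ?_⟩
  · refine h.dense.mono ?_
    rintro _ ⟨f, rfl⟩
    exact ⟨_, he f⟩
  · rintro ⟨_, f, rfl⟩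
    exact (congrArg J (he f)).trans (h.map_eq f)
  · rintro ⟨_, f, rfl⟩ ⟨_, g, rfl⟩
    refine (congrArg₂ (fun a b => ⟪a, b⟫_ℂ) (he f) (he g)).trans ?_
    rw [h.inner_eq, hamiltonian_add_const, hamiltonianL2_apply, map_add, map_smul, inner_add_right,
      inner_smul_right]

end IsFormSpace

end FormSpace

/-! ### The transition maps -/

/-- If `Sⁿ = (Sᵐ)* B Sᵐ` for a form `B` on which `S⁻¹` extends to a Hilbert-Schmidt operator `R`,
then the transition map `Vⁿ⁺² → Vⁿ` is Hilbert-Schmidt. -/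
theorem exists_transition {F : Type*} [NormedAddCommGroup F] [InnerProductSpace ℂ F]
    [CompleteSpace F] {q : ModularCurve → ℝ} {hq : IsSmooth q} {ε : TestFn →ₗ[ℂ] F} (R : F →L[ℂ] F)
    (hR : ∀ f, R (ε (hamiltonian q hq f)) = ε f) {κ : Type*} (c : HilbertBasis κ ℂ F)
    (hc : Summable fun k => ‖R (c k)‖ ^ 2) {n m : ℕ} (h : IsInnerForm q hq n)
    (h' : IsInnerForm q hq (n + 2))
    (h0 : ∀ f g, sobolevForm q hq n f g =
      ⟪ε ((hamiltonian q hq ^ m) f), ε ((hamiltonian q hq ^ m) g)⟫_ℂ)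
    (h2 : ∀ f g, sobolevForm q hq (n + 2) f g =
      ⟪ε ((hamiltonian q hq ^ (m + 1)) f), ε ((hamiltonian q hq ^ (m + 1)) g)⟫_ℂ) :
    ∃ j : SobolevSpace q hq (n + 2) h' →L[ℂ] SobolevSpace q hq n h,
      (∀ f : TestFn, j (toSobolev q hq (n + 2) h' f) = toSobolev q hq n h f) ∧
        IsHilbertSchmidt j := by
  -- The map Sᵐ⁺¹ is isometric from the norm of Vⁿ⁺² to F, and Sᵐ = R Sᵐ⁺¹. After extension to an
  -- isometry A this gives ‖j v‖ = ‖R A v‖.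
  set a : TestFn →ₗ[ℂ] F := ε ∘ₗ (hamiltonian q hq ^ (m + 1)) with ha
  have hd := denseRange_toSobolevₗ h'
  have hinner : ∀ f g, ⟪a f, a g⟫_ℂ =
      ⟪toSobolevₗ q hq (n + 2) h' f, toSobolevₗ q hq (n + 2) h' g⟫_ℂ := fun f g => by
    rw [inner_toSobolevₗ h', h2]
    rfl
  have hna : ∀ f, ‖a f‖ = ‖toSobolevₗ q hq (n + 2) h' f‖ := fun f => by
    rw [@norm_eq_sqrt_re_inner ℂ _ _ _ _ (a f), hinner,
      ← @norm_eq_sqrt_re_inner ℂ _ _ _ _ (toSobolevₗ q hq (n + 2) h' f)]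
  have hRa : ∀ f, ‖toSobolevₗ q hq n h f‖ = ‖R (a f)‖ := fun f => by
    have h3 : R (a f) = ε ((hamiltonian q hq ^ m) f) := by
      rw [← hR, ← Module.End.mul_apply, ← pow_succ']
      rfl
    rw [h3, @norm_eq_sqrt_re_inner ℂ _ _ _ _ (toSobolevₗ q hq n h f), inner_toSobolevₗ h, h0,
      ← @norm_eq_sqrt_re_inner ℂ _ _ _ _ (ε _)]
  have hA := LinearMap.extendOfNorm_eq (f := a) hd ⟨1, fun f => by rw [hna, one_mul]⟩
  set A := a.extendOfNorm (toSobolevₗ q hq (n + 2) h') with hAd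
  have hj := LinearMap.extendOfNorm_eq (f := toSobolevₗ q hq n h) hd ⟨‖R‖, fun f => by
    rw [hRa, ← hna]
    exact R.le_opNorm _⟩
  set j := (toSobolevₗ q hq n h).extendOfNorm (toSobolevₗ q hq (n + 2) h') with hjd
  refine ⟨j, hj, fun ι b => ?_⟩
  have hAi : ∀ v w, ⟪A v, A w⟫_ℂ = ⟪v, w⟫_ℂ := fun v w =>
    hd.induction_on₂ (p := fun v w => ⟪A v, A w⟫_ℂ = ⟪v, w⟫_ℂ)
      (isClosed_eq (by fun_prop) (by fun_prop)) (fun f g => by rw [hA, hA, hinner]) v w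
  have hjA : ∀ v, ‖j v‖ = ‖R (A v)‖ := fun v =>
    hd.induction_on (p := fun v => ‖j v‖ = ‖R (A v)‖) v
      (isClosed_eq (by fun_prop) (by fun_prop)) fun f => by rw [hj, hA, hRa]
  -- A is not shown to be onto, so the image of a basis is only an orthonormal family; that is
  -- enough, by Bessel's inequality.
  have hu : Orthonormal ℂ fun i => A (b i) := by
    classical
    rw [orthonormal_iff_ite]
    intro i k
    rw [hAi]
    exact orthonormal_iff_ite.1 b.orthonormal i k
  simp only [hjA]
  exact summable_norm_sq_of_orthonormal R c hc hu

/-- For n = 2m the norm of Vⁿ is that of Sᵐ f in L², where S is inverted by J J*. For n = 2m + 1 it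
is that of Sᵐ f in V¹, where S is inverted by J* J. -/
theorem exists_transition_of_growsInCusp {q : ModularCurve → ℝ} {hq : IsSmooth q}
    (hgrowth : GrowsInCusp q) {δ : ℝ} (hδ : 0 < δ)
    (hpos : ∀ f : TestFn, δ * ‖toL2 f‖ ^ 2 ≤ (⟪toL2 (hamiltonian q hq f), toL2 f⟫_ℂ).re)
    (hV : ∀ n, IsInnerForm q hq n) (n : ℕ) :
    ∃ j : SobolevSpace q hq (n + 2) (hV (n + 2)) →L[ℂ] SobolevSpace q hq n (hV n),
      (∀ f : TestFn, j (toSobolev q hq (n + 2) (hV (n + 2)) f) = toSobolev q hq n (hV n) f) ∧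
        IsHilbertSchmidt j := by
  obtain ⟨J, h⟩ := exists_isFormSpace hδ hpos
  obtain ⟨K, hK, hE⟩ := hgrowth.exists_energy_le hq hδ hpos
  obtain ⟨w, b, -⟩ := exists_hilbertBasis ℂ (SobolevSpace q hq 1 (isInnerForm hδ hpos 1))
  obtain ⟨w', c, -⟩ := exists_hilbertBasis ℂ L2
  have hb := h.summable_adjoint_comp_self hK hE b
  have hc := summable_norm_sq_self_comp_adjoint J b c hb
  rcases Nat.even_or_odd' n with ⟨m, rfl | rfl⟩
  · exact exists_transition (ε := toL2) (m := m) (J ∘L J.adjoint)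
      (fun f => by
        rw [ContinuousLinearMap.comp_apply, h.adjoint_toL2_hamiltonian, h.map_eq]) c hc _ _
      (fun f g => sobolevForm_add q hq m 0 f g) (fun f g => sobolevForm_add q hq (m + 1) 0 f g)
  · exact exists_transition (m := m) (J.adjoint ∘L J)
      (fun f => by
        rw [ContinuousLinearMap.comp_apply, h.map_eq, h.adjoint_toL2_hamiltonian]) b hb _ _
      (fun f g => by rw [sobolevForm_add, inner_toSobolevₗ])
      (fun f g => by
        rw [inner_toSobolevₗ, ← sobolevForm_add]
        congr 1)

theorem friedrichs_hamiltonianL2 {q : ModularCurve → ℝ} (hq : IsSmooth q)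
    (hgrowth : GrowsInCusp q) (hS : IsSemibounded (hamiltonianL2 q hq)) :
    IsSelfAdjoint (friedrichs (hamiltonianL2 q hq) hS) ∧
      HasHilbertSchmidtResolvent (friedrichs (hamiltonianL2 q hq) hS) := by
  obtain ⟨C, hC0, hC⟩ := hgrowth.exists_neg_mul_le hq
  -- Without a sign condition on q the potential is shifted by C + 1. This keeps the growth in the
  -- cusp and gives the lower bound 1; the form space of the shifted potential is the form
  -- completion for S itself with constant C + 1.
  have hpos : ∀ f : TestFn, 1 * ‖toL2 f‖ ^ 2 ≤
      (⟪toL2 (hamiltonian (fun p => q p + (C + 1)) (hq.add_const (C + 1)) f), toL2 f⟫_ℂ).re := by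
    intro f
    have h1 := hC f
    rw [hamiltonian_add_const q hq, map_add, map_smul, inner_add_left, inner_smul_left,
      Complex.conj_ofReal, Complex.add_re, Complex.re_ofReal_mul, ← norm_sq_eq_of_inner rfl]
    linarith
  have hgrowth' : GrowsInCusp fun p => q p + (C + 1) := by
    obtain ⟨c, hc, Y, hY⟩ := hgrowth
    exact ⟨c, hc, Y, fun z hz => (hY z hz).trans (by linarith)⟩
  obtain ⟨J, h⟩ := exists_isFormSpace one_pos hpos
  obtain ⟨K, hK, hE⟩ := hgrowth'.exists_energy_le _ one_pos hpos
  obtain ⟨w, b, -⟩ := exists_hilbertBasis ℂ (SobolevSpace _ _ 1 (isInnerForm one_pos hpos 1))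
  have hF := h.isFormCompletion hq
  exact ⟨hF.isSelfAdjoint dense_range_toL2 hS (isFormalAdjoint_hamiltonianL2 q hq),
    hF.hasHilbertSchmidtResolvent dense_range_toL2 hS b (h.summable_adjoint_comp_self hK hE b)⟩

end AutomorphicHamiltonian


theorem mainTheorem4 (q : ModularCurve → ℝ) (hq : IsSmooth q) (hgrowth : GrowsInCusp q) :
    Dense ((hamiltonianL2 q hq).domain : Set L2) ∧
    (hamiltonianL2 q hq).IsFormalAdjoint (hamiltonianL2 q hq) ∧
    (∃ hS : IsSemibounded (hamiltonianL2 q hq),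
      IsSelfAdjoint (friedrichs (hamiltonianL2 q hq) hS) ∧
      HasHilbertSchmidtResolvent (friedrichs (hamiltonianL2 q hq) hS)) ∧
    ((∀ p, 0 ≤ q p) → HasPositiveLowerBound (hamiltonianL2 q hq)) ∧
    (HasPositiveLowerBound (hamiltonianL2 q hq) →
      ∃ hV : ∀ n, IsInnerForm q hq n, ∀ n : ℕ,
        ∃ j : SobolevSpace q hq (n + 2) (hV (n + 2)) →L[ℂ] SobolevSpace q hq n (hV n),
          (∀ f : TestFn, j (toSobolev q hq (n + 2) (hV (n + 2)) f) = toSobolev q hq n (hV n) f) ∧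
          IsHilbertSchmidt j) := by
  refine ⟨dense_range_toL2, isFormalAdjoint_hamiltonianL2 q hq, ?_, fun h0 => ?_, ?_⟩
  · obtain ⟨C, -, hC⟩ := hgrowth.exists_neg_mul_le hq
    have hS : IsSemibounded (hamiltonianL2 q hq) :=
      ⟨-C, (forall_domain_hamiltonianL2 q hq (-C)).2 hC⟩
    exact ⟨hS, friedrichs_hamiltonianL2 hq hgrowth hS⟩
  · obtain ⟨K, hK, h⟩ := exists_norm_sq_le q hq hgrowth h0
    refine ⟨K⁻¹, inv_pos.2 hK, (forall_domain_hamiltonianL2 q hq K⁻¹).2 fun f => ?_⟩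
    rw [inv_mul_le_iff₀ hK]
    exact h f
  · rintro ⟨δ, hδ, h⟩
    have hpos := (forall_domain_hamiltonianL2 q hq δ).1 h
    exact ⟨isInnerForm hδ hpos,
      exists_transition_of_growsInCusp hgrowth hδ hpos (isInnerForm hδ hpos)⟩
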